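/- Let $m,n$ be positive integers with $N:=mn\ge 2$. Place $1,2,\dots,N,\overline1,\overline2,\dots,\overline N$ (where $\overline i=-i$) in this clockwise order around a circle. A type $B$ non-crossing partition is a non-crossing partition of this set that is invariant under $i\mapsto -i$; a block invariant under $i\mapsto-i$ is called a zero block. Let $\widetilde{NC}^{(m)}(B_n)$ be the set of type $B$ non-crossing partitions all of whose block sizes are divisible by $m$, partially ordered by refinement (finer partitions are smaller), with its rank function (the rank of an element is the maximal length of a chain ending in it). Let $\widetilde{NC}^{(m)}_+(B_n)$ be the subset of positive elements, i.e. those in which the block of $1$ contains a negative number. The pseudo-rotation $\kappa_B$ is the following map on $\widetilde{NC}^{(m)}_+(B_n)$. "Rotation" is rotation by one unit clockwise, written $x\mapsto x+1$ (so $i\mapsto i+1$ and $\overline{i}\mapsto\overline{i+1}$ for $i<N$, $N\mapsto\overline1$, $\overline N\mapsto 1$); "successive" elements of a block are meant in clockwise cyclic order, and every change below is accompanied by its image under $i\mapsto-i$. * If the block of $\overline N$ contains another negative element, $\kappa_B$ rotates all blocks. * If $\{N\}$ is a block, $\kappa_B$ relabels the elements of the blocks by $N\mapsto\overline2$, $\overline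 N\mapsto2$, $1\mapsto1$, $\overline1\mapsto\overline1$, and $i\mapsto i+1$, $\overline i\mapsto\overline{i+1}$ for $2\le i\le N-1$. * Otherwise $a,\overline N,1$ are successive in a block for some positive $a$. (i) If some block containing none of $1,\overline1,N,\overline N$ contains both positive and negative elements, let $b>0$ be minimal such that $\overline d,b$ (with $\overline d$ negative) are successive in such a block, and let $e$ be the successor of $b$. If $b\neq d$, then in the image $\overline{d+1},1,e+1$ are successive and $a+1,b+1,2$ are successive; if $b=d$, then in the image $\{1,\overline1\}$ is a block and $a+1,b+1,2$ are successive. All other succession relations are rotated. (ii) If there is no such block, then in the image $\overline{a+1},1,\overline2$ are successive, and all other succession relations are rotated. Let $[k]_q=1+q+\dots+q^{k-1}$, $[k]_q!=[k]_q\cdots[1]_q$, and for non-negative integers put $$\begin{bmatrix}M\\k\end{bmatrix}_q=\frac{[M]_q[M-1]_q\cdots[M-k+1]_q}{[k]_q!},\qquad \begin{bmatrix}b_1+\dots+b_n\\b_1,\dots,b_n\end{bmatrix}_q=\frac{[b_1+\dots+b_n]_q!}{[b_1]_q!\cdots[b_n]_q!}$$ (so that $\begin{bmatrix}M\\k\end{bmatrix}_q=0$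 if $k>M$). For a finite set $M$, a polynomial $P(q)$ with non-negative integer coefficients, and a finite cyclic group $C$ acting on $M$, the triple $(M,P,C)$ exhibits the cyclic sieving phenomenon if for every $\rho$ dividing $\#C$ and every $g\in C$ of order $\rho$ the number of elements of $M$ fixed by $g$ is $P(e^{2\pi i/\rho})$. Theorem. Let $s$ be an integer with $0\le s\le n$, and let $b_1,\dots,b_n$ be non-negative integers with $b_1+2b_2+\dots+nb_n\le n$. Each of the sets $M$ below is stable under $\kappa_B$, and the cyclic group $C$ of order $2mn-2$ acts on it, a generator acting as $\kappa_B$. The triple $(M,P,C)$ exhibits the cyclic sieving phenomenon in each of the following cases: 1. $M=\widetilde{NC}^{(m)}_+(B_n)$ and $P(q)=\begin{bmatrix}(m+1)n-1\\n\end{bmatrix}_{q^2}$; 2. $M$ consists of the elements of $\widetilde{NC}^{(m)}_+(B_n)$ all of whose blocks have size $m$, and $P(q)=\begin{bmatrix}mn-1\\n\end{bmatrix}_{q^2}$; 3. $M$ consists of the elements of $\widetilde{NC}^{(m)}_+(B_n)$ of rank $s$ (or, equivalently, with exactly $2(n-s)$ non-zero blocks), and $P(q)=\begin{bmatrix}n\\s\end{bmatrix}_{q^2}\begin{bmatrix}mn-1\\n-s\end{bmatrix}_{q^2}$;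 4. $M$ consists of the elements of $\widetilde{NC}^{(m)}_+(B_n)$ whose number of non-zero blocks of size $mi$ is $2b_i$ for $i=1,\dots,n$, and $P(q)=\begin{bmatrix}b_1+\dots+b_n\\b_1,\dots,b_n\end{bmatrix}_{q^2}\begin{bmatrix}mn-1\\b_1+\dots+b_n\end{bmatrix}_{q^2}$. -/

import Mathlib

open Polynomial

/-! ### `q`-integers, `q`-binomial and `q`-multinomial coefficients -/

namespace QAnalog

/-- The `q`-integer `[k]_q = 1 + q + ⋯ + q^(k-1)`; the variable `X` plays the role of `q`. -/
noncomputable def qInt (k : ℕ) : ℤ[X] := ∑ i ∈ Finset.range k, X ^ i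

/-- The `q`-factorial `[k]_q! = [k]_q [k-1]_q ⋯ [1]_q`. -/
noncomputable def qFactorial (k : ℕ) : ℤ[X] := ∏ i ∈ Finset.range k, qInt (i + 1)

/-- The `q`-binomial coefficient `[M]_q [M-1]_q ⋯ [M-k+1]_q / [k]_q!`, as a polynomial quotient. The
division is exact, see `qFactorial_mul_qBinomial`; for `k > M` the factor `[0]_q = 0` occurs. -/
noncomputable def qBinomial (M k : ℕ) : ℤ[X] :=
  (∏ i ∈ Finset.range k, qInt (M - i)) /ₘ qFactorial k

/-- The `q`-multinomial coefficient `[∑ b_i]_q! / ∏ [b_i]_q!`, as a polynomial quotient. The division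
is exact, see `prod_qFactorial_mul_qMultinomial`. -/
noncomputable def qMultinomial {ι : Type*} (s : Finset ι) (b : ι → ℕ) : ℤ[X] :=
  qFactorial (∑ i ∈ s, b i) /ₘ ∏ i ∈ s, qFactorial (b i)

theorem qFactorial_monic (k : ℕ) : (qFactorial k).Monic :=
  monic_prod_of_monic _ _ fun i _ => monic_geom_sum_X (Nat.succ_ne_zero i)

theorem qFactorial_dvd (M k : ℕ) : qFactorial k ∣ ∏ i ∈ Finset.range k, qInt (M - i) := by
  induction M generalizing k with
  | zero =>
    cases k with
    | zero => simp [qFactorial]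
    | succ k =>
      rw [Finset.prod_eq_zero (i := 0) (by simp) (by simp [qInt])]
      exact dvd_zero _
  | succ M ih =>
    cases k with
    | zero => simp [qFactorial]
    | succ k =>
      rcases Nat.lt_or_ge M k with h | h
      · rw [Finset.prod_eq_zero (i := M + 1) (by simp; omega) (by simp [qInt])]
        exact dvd_zero _
      · have h1 : ∏ i ∈ Finset.range (k + 1), qInt (M + 1 - i)
            = qInt (k + 1) * (∏ i ∈ Finset.range k, qInt (M - i))
              + X ^ (k + 1) * ∏ i ∈ Finset.range (k + 1), qInt (M - i) := by
          rw [Finset.prod_range_succ', Finset.prod_range_succ _ k]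
          have h2 : qInt (M + 1) = qInt (k + 1) + X ^ (k + 1) * qInt (M - k) := by
            have h3 : M + 1 = (k + 1) + (M - k) := by omega
            conv_lhs => rw [h3]
            simp only [qInt]
            rw [Finset.sum_range_add, Finset.mul_sum]
            simp only [pow_add]
          simp only [Nat.add_sub_add_right, Nat.sub_zero]
          rw [h2]
          ring
        rw [h1]
        refine dvd_add ?_ (Dvd.dvd.mul_left (ih (k + 1)) _)
        rw [qFactorial, Finset.prod_range_succ, mul_comm]
        exact mul_dvd_mul_left _ (ih k)

theorem qFactorial_mul_qBinomial (M k : ℕ) :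
    qFactorial k * qBinomial M k = ∏ i ∈ Finset.range k, qInt (M - i) := by
  have h := modByMonic_add_div (∏ i ∈ Finset.range k, qInt (M - i)) (qFactorial k)
  rwa [(modByMonic_eq_zero_iff_dvd (qFactorial_monic k)).2 (qFactorial_dvd M k), zero_add] at h

theorem qFactorial_add (k l : ℕ) :
    qFactorial (k + l) = (∏ i ∈ Finset.range k, qInt (k + l - i)) * qFactorial l := by
  induction k with
  | zero => simp
  | succ k ih =>
    have h : k + 1 + l = (k + l) + 1 := by omega
    rw [h, qFactorial, Finset.prod_range_succ, ← qFactorial, ih, Finset.prod_range_succ']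
    simp only [Nat.add_sub_add_right, Nat.sub_zero]
    ring

theorem prod_qFactorial_dvd {ι : Type*} (s : Finset ι) (b : ι → ℕ) :
    ∏ i ∈ s, qFactorial (b i) ∣ qFactorial (∑ i ∈ s, b i) := by
  classical
  induction s using Finset.induction_on with
  | empty => simp
  | insert a s ha ih =>
    rw [Finset.prod_insert ha, Finset.sum_insert ha, qFactorial_add]
    exact mul_dvd_mul (qFactorial_dvd _ _) ih

theorem prod_qFactorial_mul_qMultinomial {ι : Type*} (s : Finset ι) (b : ι → ℕ) :
    (∏ i ∈ s, qFactorial (b i)) * qMultinomial s b = qFactorial (∑ i ∈ s, b i) := by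
  have h := modByMonic_add_div (qFactorial (∑ i ∈ s, b i)) (∏ i ∈ s, qFactorial (b i))
  rwa [(modByMonic_eq_zero_iff_dvd (monic_prod_of_monic _ _ fun i _ => qFactorial_monic (b i))).2
    (prod_qFactorial_dvd s b), zero_add] at h

end QAnalog

/-! ### Cyclic sieving -/

/-- `(S, P, C)` exhibits the cyclic sieving phenomenon: `P` has non-negative coefficients and, for
every `ρ` dividing `#C` and every `g ∈ C` of order `ρ`, the number of elements of `S` fixed by `g`
is `P (e^(2πi/ρ))`. -/
def ExhibitsCyclicSieving (S : Type*) (P : ℤ[X]) (C : Type*) [Group C] [IsCyclic C]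
    [MulAction C S] : Prop :=
  (∀ i, 0 ≤ P.coeff i) ∧
    ∀ ρ : ℕ, ρ ∣ Nat.card C → ∀ g : C, orderOf g = ρ →
      (Nat.card {x : S // g • x = x} : ℂ) = aeval (Complex.exp (2 * Real.pi * Complex.I / ρ)) P

/-- The set `M` is stable under the map `f`, the powers of `f` form on `M` an action of the cyclic
group of order `k` whose generator acts as `f`, and `M`, `P` and this group exhibit the cyclic
sieving phenomenon. -/
def CyclicSievingUnder {α : Type*} (M : Set α) (P : ℤ[X]) (f : α → α) (k : ℕ) : Prop :=
  ∃ _ : MulAction (Multiplicative (ZMod k)) M,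
    (∀ π : M, ((Multiplicative.ofAdd (1 : ZMod k) • π : M) : α) = f π) ∧
      ExhibitsCyclicSieving M P (Multiplicative (ZMod k))

/-! ### Type `B` non-crossing partitions and the pseudo-rotation -/

namespace TypeB

/-- The elements `1, 2, …, N, -1, -2, …, -N`, placed in this (clockwise) order around a circle: `i` is
the point `i - 1` and `-i` is the point `N + i - 1` of `ℤ/2Nℤ`. Thus `x ↦ x + 1` is the rotation by
one unit in clockwise direction, mapping `i` to `i + 1`, `N` to `-1` and `-N` to `1`. -/
abbrev Pt (N : ℕ) : Type := ZMod (2 * N)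

variable {N : ℕ}

/-- The point of the positive element `i`, for `1 ≤ i ≤ N`. -/
def pos (N i : ℕ) : Pt N := (i : Pt N) - 1

/-- The map `i ↦ -i`. -/
def bar (x : Pt N) : Pt N := x + (N : Pt N)

/-- `x` is one of the negative elements `-1, …, -N`. -/
def IsNeg (x : Pt N) : Prop := N ≤ x.val

/-- Set partitions are given by their equivalence relations; they are ordered by refinement, `π ≤ π'`
meaning that `π` is finer than `π'`. No two different blocks cross: -/
def IsNoncrossing (π : Setoid (Pt N)) : Prop :=
  ∀ a b c d : Pt N, a.val < b.val → b.val < c.val → c.val < d.val → π a c → π b d → π a b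

/-- Invariance under substitution of `i` by `-i`, for all `i`. -/
def IsSymmetric (π : Setoid (Pt N)) : Prop :=
  ∀ x y : Pt N, π x y → π (bar x) (bar y)

/-- The type `B` non-crossing partitions of `{1, …, mn, -1, …, -mn}` all of whose block sizes are
divisible by `m`. -/
def mNCB (m n : ℕ) : Set (Setoid (Pt (m * n))) :=
  {π | IsNoncrossing π ∧ IsSymmetric π ∧ ∀ B ∈ π.classes, m ∣ B.ncard}

/-- The block containing `1` also contains a negative element. -/
def IsPositive (π : Setoid (Pt N)) : Prop :=
  ∃ x : Pt N, IsNeg x ∧ π (pos N 1) x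

/-- The positive `m`-divisible type `B` non-crossing partitions. -/
def mNCBPlus (m n : ℕ) : Set (Setoid (Pt (m * n))) :=
  {π | π ∈ mNCB m n ∧ IsPositive π}

/-- The non-zero blocks: those which are not invariant under `i ↦ -i`. -/
def nonzeroBlocks (π : Setoid (Pt N)) : Set (Set (Pt N)) :=
  {B | B ∈ π.classes ∧ bar '' B ≠ B}

/-- The rank of `π` in the graded poset of all `m`-divisible type `B` non-crossing partitions, ordered
by refinement: the maximal length of a chain ending in `π`. -/
noncomputable def rank (m n : ℕ) (π : mNCB m n) : ℕ∞ := Order.height π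

/-- The successor of `x` in its block, in clockwise direction (`x` itself if `{x}` is a block). -/
noncomputable def next (π : Setoid (Pt N)) (x : Pt N) : Pt N :=
  x + ((sInf {k : ℕ | 0 < k ∧ π x (x + (k : Pt N))} : ℕ) : Pt N)

/-- The predecessor of `x` in its block, in clockwise direction (`x` itself if `{x}` is a block). -/
noncomputable def prev (π : Setoid (Pt N)) (x : Pt N) : Pt N :=
  x - ((sInf {k : ℕ | 0 < k ∧ π x (x - (k : Pt N))} : ℕ) : Pt N)

/-- The successor map rotated by one unit in clockwise direction. -/
noncomputable def rotNext (π : Setoid (Pt N)) (x : Pt N) : Pt N := next π (x - 1) + 1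

/-- Make `v` the successor of `u` and `-v` the successor of `-u`, leaving the other values of the
successor map `f` unchanged. -/
def link (u v : Pt N) (f : Pt N → Pt N) : Pt N → Pt N :=
  Function.update (Function.update f u v) (bar u) (bar v)

/-- The partition in which every `x` is in the same block as its successor `f x`. -/
def ofNext (f : Pt N → Pt N) : Setoid (Pt N) := Relation.EqvGen.setoid fun x y => f x = y

/-- `x` is contained in none of the blocks of `1`, `-1`, `N`, `-N`. -/
def OffSpecial (π : Setoid (Pt N)) (x : Pt N) : Prop :=
  ¬ π x (pos N 1) ∧ ¬ π x (bar (pos N 1)) ∧ ¬ π x (pos N N) ∧ ¬ π x (bar (pos N N))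

/-- The set of all `i ∈ {1, …, N}` which are preceded by a negative element in their block, this block
containing none of `1`, `-1`, `N`, `-N`. -/
def turningIndices (π : Setoid (Pt N)) : Set ℕ :=
  {i | 1 ≤ i ∧ i ≤ N ∧ OffSpecial π (pos N i) ∧ IsNeg (prev π (pos N i))}

/-- The minimal `b` such that `-d` and `b` are successive elements in a block containing none of
`1`, `-1`, `N`, `-N`, with `-d` negative and `b` positive. -/
noncomputable def turningPoint (π : Setoid (Pt N)) : Pt N := pos N (sInf (turningIndices π))

open Classical in
/-- The pseudo-rotation of positive type `B` non-crossing partitions. -/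
noncomputable def kappa (π : Setoid (Pt N)) : Setoid (Pt N) :=
  if ∃ x : Pt N, IsNeg x ∧ x ≠ bar (pos N N) ∧ π (bar (pos N N)) x then
    -- the block of `-N` contains another negative element: rotation by one unit
    Setoid.comap (fun x => x - 1) π
  else if ∀ x : Pt N, π (pos N N) x → x = pos N N then
    -- `{N}` is a block: `N` becomes `-2`, `-N` becomes `2`, `1` and `-1` are fixed,
    -- everything else is rotated; the map below is the inverse of this relabelling
    Setoid.comap (fun x =>
      if x = pos N 1 ∨ x = bar (pos N 1) then x
      else if x = pos N 2 then bar (pos N N)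
      else if x = bar (pos N 2) then pos N N
      else x - 1) π
  else
    -- `a`, `-N`, `1` are successive elements in a block
    let a := prev π (bar (pos N N))
    if ∃ x y : Pt N, OffSpecial π x ∧ π x y ∧ IsNeg x ∧ ¬ IsNeg y then
      -- `-d`, `b`, `e` are successive elements in a block
      let b := turningPoint π
      let d' := prev π b
      let e := next π b
      if d' = bar b then
        -- `{b, -b}` is a zero block: `{1, -1}` becomes a block, and
        -- `a + 1`, `b + 1`, `2` become successive
        ofNext (link (pos N 1) (bar (pos N 1)) (link (a + 1) (b + 1) (link (b + 1) (pos N 2)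
          (rotNext π))))
      else
        -- `-(d + 1)`, `1`, `e + 1` become successive, and so do `a + 1`, `b + 1`, `2`
        ofNext (link (d' + 1) (pos N 1) (link (pos N 1) (e + 1)
          (link (a + 1) (b + 1) (link (b + 1) (pos N 2) (rotNext π)))))
    else
      -- `-(a + 1)`, `1`, `-2` become successive
      ofNext (link (bar (a + 1)) (pos N 1) (link (pos N 1) (bar (pos N 2)) (rotNext π)))

end TypeB

/-!
Positive partitions correspond to words, and the pseudo-rotation to the rotation of words; cyclic
sieving for words under rotation then follows from the `q`-Lucas theorem.

**From partitions to words.** Put `N = mn`. Identify the circle with `ℤ/2Nℤ`, where `i ↦ -i` is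
the translation by `N`. Every non-zero block of a symmetric non-crossing partition is contained in
a half-turn, hence it has a first element, its opener. Such a partition is determined by the
`N`-periodic sequence recording, at every point, the size of the block opened there, or `0`
(`partition_heightOf`): reading clockwise, a point which is not an opener goes into the most
recently opened block which still lacks elements, or into the zero block if there is none. With
the partial sums `H` of the sequence of sizes minus one, this rule becomes the definition of
`partition N H`, and every `N`-periodic sequence with sum at most `N` over a half-turn occurs
(`openedSize_partition`). All block sizes are divisible by `m` if and only if all terms of the
sequence are (`forall_dvd_ncard_iff`), and the partition is positive if and only if no block is
opened at the point of `1` (`isPositive_iff`). Division by `m` and omission of the term for `1`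
leave a word in `ℕ` of length `N - 1` with sum at most `n` (`bijOn_ofWord`).

**The pseudo-rotation.** Rotating the word means to move an opener at `-N`, if there is one,
together with the size of its block, to the next point `1`, and then to rotate the partition by
one unit, so that no block is opened at `1` again. In the partition, the first of these steps only
exchanges the point of `-N` with one other point `b`, and likewise their antipodes
(`partition_moveOpener`). Here `b` is the first point from `1` on which does not belong to a block
opened at one of the points from `-N` to `b`, or `N` if there is no such point. It is the point of
`1` if `{N}` is a block, the turning point `b` in the next case of the definition of `kappa`, and
`N`, the antipode of `-N`, in the last case. Since a partition can be recovered from its successor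
map, which is conjugated by the exchange (`ofNext_conj`), a comparison of successors in each case
shows that `kappa` is the composition of the two steps (`kappa_partition`, `kappa_ofWord`).

**Statistics.** A non-zero letter `i` gives rise to a pair of antipodal non-zero blocks of size
`mi`. So the number of non-zero blocks, and the number of those of a given size, are read off from
the word, and all blocks have size `m` if and only if there are `n` non-zero letters
(`forall_ncard_eq_iff`). The rank is `n` minus half the number of non-zero blocks (`rank_eq_iff`):
this number decreases strictly under proper coarsening (`ncard_nonzeroBlocks_lt`), and as long as
there are less than `2n` non-zero blocks, `m` consecutive elements of some block can be split off,
along with their antipodes, which increases the number of non-zero blocks by at most two.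

**Cyclic sieving for words.** Words of length `N - 1` which are fixed by a rotation of order `r`
are words on the `(N - 1) / r` orbits of the rotation, with sum at most `n / r`. The elementary
counts of all such words, of those with given support size and of those with given content are the
values of the `q`-binomial and `q`-multinomial coefficients at a primitive `r`-th root of unity,
by the `q`-Lucas theorem (`Word.card_fixed_sum_le`, `Word.card_fixed_support`,
`Word.card_fixed_content`). The group of order `2N - 2` acts through its quotient of order
`N - 1`, and for this reason `q` is replaced by `q²` (`cyclicSievingUnder_of_words`).
-/

/-! ### `q`-binomial and `q`-multinomial coefficients at roots of unity -/

namespace QAnalog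

theorem qBinomial_zero_right (M : ℕ) : qBinomial M 0 = 1 := by
  simpa [qFactorial] using qFactorial_mul_qBinomial M 0

theorem qBinomial_eq_zero_of_lt {M k : ℕ} (h : M < k) : qBinomial M k = 0 := by
  have h1 := qFactorial_mul_qBinomial M k
  rw [Finset.prod_eq_zero (i := M) (by simpa using h) (by simp [qInt])] at h1
  exact (mul_eq_zero.1 h1).resolve_left (qFactorial_monic _).ne_zero

theorem qBinomial_zero_succ (k : ℕ) : qBinomial 0 (k + 1) = 0 :=
  qBinomial_eq_zero_of_lt k.succ_pos

/-- The `q`-Pascal recurrence. -/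
theorem qBinomial_succ_succ (M k : ℕ) :
    qBinomial (M + 1) (k + 1) = qBinomial M k + X ^ (k + 1) * qBinomial M (k + 1) := by
  apply mul_left_cancel₀ (qFactorial_monic (k + 1)).ne_zero
  have e : qFactorial (k + 1) = qFactorial k * qInt (k + 1) := by
    rw [qFactorial, Finset.prod_range_succ, ← qFactorial]
  have h1 : qFactorial (k + 1) * qBinomial M k
      = qInt (k + 1) * ∏ i ∈ Finset.range k, qInt (M - i) := by
    rw [e, ← qFactorial_mul_qBinomial]; ring
  rw [mul_add, h1, mul_left_comm, qFactorial_mul_qBinomial, qFactorial_mul_qBinomial,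
    Finset.prod_range_succ', Finset.prod_range_succ _ k]
  simp only [Nat.add_sub_add_right, Nat.sub_zero]
  rcases Nat.lt_or_ge M k with h | h
  · rw [Finset.prod_eq_zero (i := M) (by simpa using h) (by simp [qInt])]
    simp
  · have h2 : qInt (M + 1) = qInt (k + 1) + X ^ (k + 1) * qInt (M - k) := by
      have h3 : M + 1 = (k + 1) + (M - k) := by omega
      conv_lhs => rw [h3]
      simp only [qInt]
      rw [Finset.sum_range_add, Finset.mul_sum]
      simp only [pow_add]
    rw [h2]
    ring

theorem qBinomial_coeff_nonneg (M k i : ℕ) : 0 ≤ (qBinomial M k).coeff i := by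
  induction M generalizing k i with
  | zero =>
    cases k with
    | zero => rw [qBinomial_zero_right, coeff_one]; split_ifs <;> simp
    | succ k => rw [qBinomial_zero_succ]; simp
  | succ M ih =>
    cases k with
    | zero => rw [qBinomial_zero_right, coeff_one]; split_ifs <;> simp
    | succ k =>
      rw [qBinomial_succ_succ, coeff_add, coeff_X_pow_mul']
      split_ifs
      · exact add_nonneg (ih _ _) (ih _ _)
      · simpa using ih k i

theorem qBinomial_self (k : ℕ) : qBinomial k k = 1 := by
  apply mul_left_cancel₀ (qFactorial_monic k).ne_zero
  have h := qFactorial_add k 0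
  simp only [add_zero] at h
  rw [qFactorial_mul_qBinomial, mul_one, h]
  simp [qFactorial]

theorem qBinomial_symm {n s : ℕ} (h : s ≤ n) : qBinomial n (n - s) = qBinomial n s := by
  obtain ⟨t, rfl⟩ := Nat.exists_eq_add_of_le h
  rw [Nat.add_sub_cancel_left]
  apply mul_left_cancel₀ (mul_ne_zero (qFactorial_monic s).ne_zero (qFactorial_monic t).ne_zero)
  have h1 := qFactorial_add s t
  have h2 := qFactorial_add t s
  rw [← qFactorial_mul_qBinomial] at h1 h2
  rw [add_comm t s] at h2
  calc qFactorial s * qFactorial t * qBinomial (s + t) t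
      = qFactorial t * qBinomial (s + t) t * qFactorial s := by ring
    _ = qFactorial s * qBinomial (s + t) s * qFactorial t := by rw [← h1, ← h2]
    _ = _ := by ring

theorem qMultinomial_empty {ι : Type*} (b : ι → ℕ) : qMultinomial ∅ b = 1 := by
  simpa [qFactorial] using prod_qFactorial_mul_qMultinomial ∅ b

theorem qMultinomial_insert {ι : Type*} [DecidableEq ι] {s : Finset ι} {a : ι} (ha : a ∉ s)
    (b : ι → ℕ) :
    qMultinomial (insert a s) b = qBinomial (b a + ∑ i ∈ s, b i) (b a) * qMultinomial s b := by
  have h := prod_qFactorial_mul_qMultinomial (insert a s) b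
  have hs := prod_qFactorial_mul_qMultinomial s b
  rw [Finset.prod_insert ha, Finset.sum_insert ha, qFactorial_add, ← hs,
    ← qFactorial_mul_qBinomial] at h
  have hne : qFactorial (b a) * ∏ i ∈ s, qFactorial (b i) ≠ 0 :=
    mul_ne_zero (qFactorial_monic _).ne_zero
      (Finset.prod_ne_zero_iff.2 fun i _ => (qFactorial_monic _).ne_zero)
  apply mul_left_cancel₀ hne
  rw [h]
  ring

theorem mul_coeff_nonneg {P Q : ℤ[X]} (hP : ∀ i, 0 ≤ P.coeff i) (hQ : ∀ i, 0 ≤ Q.coeff i) (i : ℕ) :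
    0 ≤ (P * Q).coeff i := by
  rw [coeff_mul]
  exact Finset.sum_nonneg fun x _ => mul_nonneg (hP _) (hQ _)

theorem qMultinomial_coeff_nonneg {ι : Type*} (s : Finset ι) (b : ι → ℕ) (i : ℕ) :
    0 ≤ (qMultinomial s b).coeff i := by
  classical
  induction s using Finset.induction_on generalizing i with
  | empty => rw [qMultinomial_empty, coeff_one]; split_ifs <;> simp
  | insert a s ha ih =>
    rw [qMultinomial_insert ha]
    exact mul_coeff_nonneg (qBinomial_coeff_nonneg _ _) ih i

theorem comp_X_sq_coeff_nonneg {P : ℤ[X]} (hP : ∀ i, 0 ≤ P.coeff i) (i : ℕ) :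
    0 ≤ (P.comp (X ^ 2)).coeff i := by
  rw [← expand_eq_comp_X_pow, coeff_expand (by norm_num)]
  split_ifs
  · exact hP _
  · exact le_rfl

variable {ω : ℂ} {r : ℕ}

theorem aeval_qInt_ne_zero (hω : IsPrimitiveRoot ω r) {k : ℕ} (h0 : 0 < k) (hk : k < r) :
    aeval ω (qInt k) ≠ 0 := by
  simp only [qInt, map_sum, map_pow, aeval_X]
  intro h
  have h1 := geom_sum_mul ω k
  rw [h, zero_mul] at h1
  exact hω.pow_ne_one_of_pos_of_lt h0.ne' hk (sub_eq_zero.1 h1.symm)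

theorem aeval_qInt_eq_zero (hω : IsPrimitiveRoot ω r) (hr : 1 < r) : aeval ω (qInt r) = 0 := by
  simp only [qInt, map_sum, map_pow, aeval_X]
  exact hω.geom_sum_eq_zero hr

/-- The inner entries of row `r` vanish at a primitive `r`-th root of unity. -/
theorem aeval_qBinomial_order (hω : IsPrimitiveRoot ω r) {k : ℕ} (h0 : 0 < k) (hk : k < r) :
    aeval ω (qBinomial r k) = 0 := by
  have h := congrArg (aeval ω) (qFactorial_mul_qBinomial r k)
  rw [map_mul, map_prod, Finset.prod_eq_zero (i := 0) (by simpa using h0)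
    (by simpa using aeval_qInt_eq_zero hω (by omega))] at h
  refine (mul_eq_zero.1 h).resolve_left ?_
  rw [qFactorial, map_prod]
  refine Finset.prod_ne_zero_iff.2 fun i hi => aeval_qInt_ne_zero hω (by omega) ?_
  have := Finset.mem_range.1 hi
  omega

/-- Raising the upper index by the order `r` of the root of unity, for a large lower index. This and
the next lemma give the `q`-Lucas theorem; both follow from the `q`-Pascal recurrence, whose
weight `q ^ (k + 1)` does not change when `k` is raised by `r`. -/
theorem aeval_qBinomial_add_order (hω : IsPrimitiveRoot ω r) (hr : 0 < r) (M k : ℕ) :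
    (aeval ω (qBinomial (M + r) (k + r)) = aeval ω (qBinomial M k)
      + aeval ω (qBinomial M (k + r))) ∧
    (k < r → aeval ω (qBinomial (M + r) k) = aeval ω (qBinomial M k)) := by
  have hone := hω.pow_eq_one
  induction M generalizing k with
  | zero =>
    obtain ⟨t, rfl⟩ : ∃ t, r = t + 1 := ⟨r - 1, by omega⟩
    refine ⟨?_, fun hk => ?_⟩
    · rw [← add_assoc k, qBinomial_zero_succ, zero_add, map_zero, add_zero]
      cases k with
      | zero => rw [zero_add, qBinomial_self, qBinomial_zero_right]
      | succ k =>
        rw [qBinomial_zero_succ]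
        rw [qBinomial_eq_zero_of_lt (by omega)]
    · cases k with
      | zero => rw [qBinomial_zero_right, qBinomial_zero_right]
      | succ k =>
        rw [qBinomial_zero_succ, zero_add, aeval_qBinomial_order hω (by omega) hk, map_zero]
  | succ M ih =>
    have e : M + 1 + r = (M + r) + 1 := by omega
    rw [e]
    refine ⟨?_, fun hk => ?_⟩
    · obtain ⟨t, rfl⟩ : ∃ t, r = t + 1 := ⟨r - 1, by omega⟩
      rw [← add_assoc k t 1, qBinomial_succ_succ, qBinomial_succ_succ]
      simp only [map_add, map_mul, map_pow, aeval_X]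
      have h2 := (ih k).1
      rw [← add_assoc k t 1] at h2
      rw [h2]
      have e2 : ω ^ (k + t + 1) = ω ^ k := by rw [add_assoc, pow_add, hone, mul_one]
      rw [e2]
      cases k with
      | zero =>
        simp only [zero_add, pow_zero, one_mul]
        rw [(ih t).2 (by omega), qBinomial_zero_right, qBinomial_zero_right]
        simp only [map_one]
        ring
      | succ k =>
        have h3 := (ih k).1
        have e3 : k + (t + 1) = k + 1 + t := by omega
        rw [e3] at h3
        rw [h3, qBinomial_succ_succ]
        simp only [map_add, map_mul, map_pow, aeval_X]
        ring
    · cases k with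
      | zero => rw [qBinomial_zero_right, qBinomial_zero_right]
      | succ k =>
        rw [qBinomial_succ_succ, qBinomial_succ_succ]
        simp only [map_add, map_mul, map_pow, aeval_X]
        rw [(ih k).2 (by omega), (ih (k + 1)).2 hk]

/-- The `q`-Lucas theorem. -/
theorem aeval_qBinomial_lucas (hω : IsPrimitiveRoot ω r) (a b : ℕ) {i j : ℕ} (hi : i < r)
    (hj : j < r) :
    aeval ω (qBinomial (r * a + i) (r * b + j)) = (a.choose b : ℂ) * aeval ω (qBinomial i j) := by
  have hr : 0 < r := by omega
  induction a generalizing b with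
  | zero =>
    cases b with
    | zero => simp
    | succ b =>
      rw [mul_zero, zero_add, qBinomial_eq_zero_of_lt (by rw [mul_add]; omega)]
      simp
  | succ a ih =>
    have e : r * (a + 1) + i = (r * a + i) + r := by ring
    rw [e]
    cases b with
    | zero =>
      rw [mul_zero, zero_add, (aeval_qBinomial_add_order hω hr _ j).2 hj]
      have := ih 0
      rw [mul_zero, zero_add] at this
      simpa using this
    | succ b =>
      have e2 : r * (b + 1) + j = (r * b + j) + r := by ring
      rw [e2, (aeval_qBinomial_add_order hω hr _ _).1, ← e2, ih, ih, Nat.choose_succ_succ]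
      push_cast
      ring

/-- The upper index is divisible by the order of the root of unity. -/
theorem aeval_qBinomial_mul_left (hω : IsPrimitiveRoot ω r) (hr : 0 < r) (a k : ℕ) :
    aeval ω (qBinomial (r * a) k) = if r ∣ k then (a.choose (k / r) : ℂ) else 0 := by
  have h := aeval_qBinomial_lucas hω a (k / r) hr (Nat.mod_lt k hr)
  rw [add_zero, Nat.div_add_mod] at h
  rw [h]
  split_ifs with hd
  · rw [Nat.mod_eq_zero_of_dvd hd, qBinomial_self]; simp
  · have : 0 < k % r := Nat.pos_of_ne_zero fun h0 => hd (Nat.dvd_of_mod_eq_zero h0)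
    rw [qBinomial_eq_zero_of_lt this]; simp

/-- The lower index is divisible by the order of the root of unity. -/
theorem aeval_qBinomial_mul_right (hω : IsPrimitiveRoot ω r) (hr : 0 < r) (n b : ℕ) :
    aeval ω (qBinomial n (r * b)) = ((n / r).choose b : ℂ) := by
  have h := aeval_qBinomial_lucas hω (n / r) b (Nat.mod_lt n hr) hr
  rw [add_zero, Nat.div_add_mod] at h
  rw [h, qBinomial_zero_right]
  simp

/-- The two indices have the same residue modulo the order of the root of unity. -/
theorem aeval_qBinomial_mul_add (hω : IsPrimitiveRoot ω r) (hr : 0 < r) (a n : ℕ) :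
    aeval ω (qBinomial (r * a + n) n) = ((a + n / r).choose (n / r) : ℂ) := by
  have h := aeval_qBinomial_lucas hω (a + n / r) (n / r) (Nat.mod_lt n hr) (Nat.mod_lt n hr)
  rw [mul_add, add_assoc, Nat.div_add_mod] at h
  rw [h, qBinomial_self]
  simp

theorem aeval_qMultinomial {ι : Type*} (hω : IsPrimitiveRoot ω r) (hr : 0 < r) (s : Finset ι)
    (c : ι → ℕ) :
    aeval ω (qMultinomial s fun i => r * c i) = (Nat.multinomial s c : ℂ) := by
  classical
  induction s using Finset.induction_on with
  | empty => simp [qMultinomial_empty]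
  | insert a s ha ih =>
    rw [qMultinomial_insert ha, map_mul, ih, ← Finset.mul_sum, ← mul_add,
      aeval_qBinomial_mul_left hω hr, if_pos (dvd_mul_right _ _), Nat.mul_div_cancel_left _ hr,
      Nat.multinomial_insert ha]
    push_cast
    rfl

theorem aeval_qMultinomial_eq_zero {ι : Type*} (hω : IsPrimitiveRoot ω r) (hr : 0 < r)
    (s : Finset ι) (b : ι → ℕ) (hs : r ∣ ∑ i ∈ s, b i) (hb : ¬ ∀ i ∈ s, r ∣ b i) :
    aeval ω (qMultinomial s b) = 0 := by
  classical
  induction s using Finset.induction_on with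
  | empty => simp at hb
  | insert a s ha ih =>
    rw [qMultinomial_insert ha, map_mul, ← Finset.sum_insert ha]
    obtain ⟨c, hc⟩ := hs
    rw [hc, aeval_qBinomial_mul_left hω hr]
    by_cases h : r ∣ b a
    · have hs' : r ∣ ∑ i ∈ s, b i := by
        rw [Finset.sum_insert ha] at hc
        exact (Nat.dvd_add_right h).1 ⟨c, hc⟩
      rw [ih hs' (fun h' => hb (by simpa [h] using h')), mul_zero]
    · rw [if_neg h, zero_mul]

end QAnalog

/-! ### Counting words -/

namespace Word

theorem finite_sum_le {Q : Type*} [Fintype Q] (n : ℕ) : {u : Q → ℕ | ∑ j, u j ≤ n}.Finite :=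
  (Set.Finite.pi' fun _ : Q => Set.finite_Iic n).subset fun u hu j =>
    (Finset.single_le_sum (f := u) (fun _ _ => Nat.zero_le _) (Finset.mem_univ j)).trans hu

/-- Splitting off the first letter `v` of a word with sum at most `n`. -/
def consEquiv (q n : ℕ) (P : ℕ → (Fin q → ℕ) → Prop) :
    {u : Fin (q + 1) → ℕ // P (u 0) (Fin.tail u) ∧ ∑ j, u j ≤ n} ≃
      Σ v : Fin (n + 1), {u : Fin q → ℕ // P v u ∧ ∑ j, u j ≤ n - v} where
  toFun u := ⟨⟨u.1 0, by have := u.2.2; rw [Fin.sum_univ_succ] at this; omega⟩, Fin.tail u.1, u.2.1,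
    by have := u.2.2; rw [Fin.sum_univ_succ] at this; simp only [Fin.tail]; omega⟩
  invFun x := ⟨Fin.cons (x.1 : ℕ) x.2.1, by simpa using x.2.2.1, by
    have := x.2.2.2
    have h := x.1.2
    rw [Fin.sum_univ_succ]
    simp only [Fin.cons_zero, Fin.cons_succ]
    omega⟩
  left_inv u := by simp
  right_inv x := Sigma.subtype_ext (by simp) (by simp)

theorem card_consEquiv (q n : ℕ) (P : ℕ → (Fin q → ℕ) → Prop) :
    Nat.card {u : Fin (q + 1) → ℕ // P (u 0) (Fin.tail u) ∧ ∑ j, u j ≤ n} =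
      ∑ v ∈ Finset.range (n + 1), Nat.card {u : Fin q → ℕ // P v u ∧ ∑ j, u j ≤ n - v} := by
  have (v : ℕ) : Finite {u : Fin q → ℕ // P v u ∧ ∑ j, u j ≤ n - v} :=
    ((finite_sum_le (n - v)).subset fun u hu => hu.2).to_subtype
  rw [Nat.card_congr (consEquiv q n P), Nat.card_sigma,
    Fin.sum_univ_eq_sum_range (fun v => Nat.card {u : Fin q → ℕ // P v u ∧ ∑ j, u j ≤ n - v})]

theorem card_fin_sum_le (q n : ℕ) :
    Nat.card {u : Fin q → ℕ // ∑ j, u j ≤ n} = (q + n).choose n := by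
  have key : Nat.card {u : Fin q → ℕ // True ∧ ∑ j, u j ≤ n} = (n + q).choose q := by
    induction q generalizing n with
    | zero => simp
    | succ q ih =>
      rw [card_consEquiv q n (fun _ _ => True)]
      simp only [ih]
      rw [← add_assoc, ← Nat.sum_range_add_choose, ← Finset.sum_range_reflect]
      refine Finset.sum_congr rfl fun v hv => ?_
      have := Finset.mem_range.1 hv
      congr 2; omega
  simp only [true_and] at key
  rw [key, add_comm, Nat.choose_symm_add]

theorem sum_range_choose_eq (n k : ℕ) : ∑ i ∈ Finset.range n, i.choose k = n.choose (k + 1) := by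
  induction n with
  | zero => simp
  | succ n ih => rw [Finset.sum_range_succ, ih, Nat.choose_succ_succ, add_comm]

theorem card_fin_support_sum_le (q k n : ℕ) :
    Nat.card {u : Fin q → ℕ // Nat.card {j // u j ≠ 0} = k ∧ ∑ j, u j ≤ n} =
      q.choose k * n.choose k := by
  induction q generalizing k n with
  | zero =>
    cases k with
    | zero => simp
    | succ k => simp
  | succ q ih =>
    have e : ∀ u : Fin (q + 1) → ℕ, Nat.card {j // u j ≠ 0} =
        (if u 0 ≠ 0 then 1 else 0) + Nat.card {j // Fin.tail u j ≠ 0} := by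
      intro u
      rw [Nat.card_eq_fintype_card, Nat.card_eq_fintype_card, Fintype.card_subtype,
        Fintype.card_subtype, Fin.card_filter_univ_succ]
      split_ifs <;> simp [Fin.tail, add_comm] <;> rfl
    simp only [e]
    rw [card_consEquiv q n (fun v u => (if v ≠ 0 then 1 else 0) + Nat.card {j // u j ≠ 0} = k),
      Finset.sum_range_succ']
    simp only [ne_eq, not_true_eq_false, if_false, zero_add, Nat.sub_zero]
    rw [ih]
    cases k with
    | zero => simp
    | succ k =>
      have h : ∀ v ∈ Finset.range n, Nat.card {u : Fin q → ℕ //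
          (if ¬ v + 1 = 0 then 1 else 0) + Nat.card {j // ¬ u j = 0} = k + 1 ∧
            ∑ j, u j ≤ n - (v + 1)} = q.choose k * (n - 1 - v).choose k := by
        intro v _
        rw [← Nat.sub_sub, Nat.sub_right_comm, ← ih]
        simp [add_comm 1]
      rw [Finset.sum_congr rfl h, ← Finset.mul_sum,
        Finset.sum_range_reflect (fun i => i.choose k), sum_range_choose_eq, Nat.choose_succ_succ]
      ring

variable {Q : Type*} [Fintype Q]

theorem card_sum_le (n : ℕ) :
    Nat.card {u : Q → ℕ // ∑ j, u j ≤ n} = (Nat.card Q + n).choose n := by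
  rw [← card_fin_sum_le]
  have e : Q ≃ Fin (Nat.card Q) := Finite.equivFin Q
  refine Nat.card_congr ((Equiv.arrowCongr e (Equiv.refl ℕ)).subtypeEquiv fun u => ?_)
  simp [Equiv.sum_comp e.symm u]

theorem card_support_sum_le (k n : ℕ) :
    Nat.card {u : Q → ℕ // Nat.card {j // u j ≠ 0} = k ∧ ∑ j, u j ≤ n} =
      (Nat.card Q).choose k * n.choose k := by
  rw [← card_fin_support_sum_le]
  have e : Q ≃ Fin (Nat.card Q) := Finite.equivFin Q
  refine Nat.card_congr ((Equiv.arrowCongr e (Equiv.refl ℕ)).subtypeEquiv fun u => ?_)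
  have h : Nat.card {j // u j ≠ 0} = Nat.card {j // u (e.symm j) ≠ 0} :=
    Nat.card_congr (e.subtypeEquiv fun j => by simp)
  change _ = k ∧ _ ≤ n ↔ Nat.card {j // u (e.symm j) ≠ 0} = k ∧ ∑ j, u (e.symm j) ≤ n
  rw [Equiv.sum_comp e.symm u, h]

/-- The words over the alphabet `S ∪ {0}` in which each letter `i ∈ S` occurs `c i` times. -/
def content (Q : Type*) [Fintype Q] (S : Finset ℕ) (c : ℕ → ℕ) : Set (Q → ℕ) :=
  {u | (∀ j, u j ≠ 0 → u j ∈ S) ∧ ∀ i ∈ S, Nat.card {j // u j = i} = c i}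

theorem content_finite (S : Finset ℕ) (c : ℕ → ℕ) : (content Q S c).Finite := by
  refine (Set.Finite.pi' fun _ : Q => Set.finite_Iic (S.sup id)).subset fun u hu j => ?_
  rcases eq_or_ne (u j) 0 with h | h
  · simp [h]
  · exact Finset.le_sup (f := id) (hu.1 j h)

theorem card_zeros {S : Finset ℕ} (h0 : 0 ∉ S) {c : ℕ → ℕ} {u : Q → ℕ} (hu : u ∈ content Q S c) :
    Nat.card {j // u j = 0} = Nat.card Q - ∑ i ∈ S, c i := by
  classical
  have h := Finset.card_eq_sum_card_fiberwise (f := u) (s := Finset.univ) (t := insert 0 S)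
    (fun j _ => by
      rcases eq_or_ne (u j) 0 with h | h
      · simp [h]
      · simp [hu.1 j h])
  rw [Finset.sum_insert h0, Finset.sum_congr rfl (g := c) (fun i hi => by
    rw [← hu.2 i hi, Nat.card_eq_fintype_card, Fintype.card_subtype])] at h
  rw [Nat.card_eq_fintype_card, Nat.card_eq_fintype_card, Fintype.card_subtype,
    ← Finset.card_univ, h]
  simp

open Classical in
/-- Deleting a letter `a` from the alphabet: the word in which `a` is replaced by `0`, and the set
of the positions of `a`, which is an arbitrary set of zeros of that word of the right size. -/
noncomputable def contentInsertEquiv {S : Finset ℕ} {a : ℕ} (ha : a ∉ S) (ha0 : a ≠ 0)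
    (h0 : 0 ∉ S) (c : ℕ → ℕ) :
    content Q (insert a S) c ≃
      Σ v : content Q S c, {A : Finset Q // A ∈ Finset.powersetCard (c a)
        (Finset.univ.filter fun j => v.1 j = 0)} where
  toFun u := ⟨⟨fun j => if u.1 j = a then 0 else u.1 j, by
      refine ⟨fun j hj => ?_, fun i hi => ?_⟩
      · by_cases h : u.1 j = a
        · simp [h] at hj
        · simp only [h, if_false] at hj ⊢
          exact (Finset.mem_insert.1 (u.2.1 j hj)).resolve_left h
      · have hia : i ≠ a := fun h => ha (h ▸ hi)
        have hi0 : i ≠ 0 := fun h => h0 (h ▸ hi)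
        rw [← u.2.2 i (Finset.mem_insert_of_mem hi)]
        refine Nat.card_congr (Equiv.subtypeEquivRight fun j => ?_)
        by_cases h : u.1 j = a
        · simp [h, hi0.symm, hia.symm]
        · simp [h]⟩,
    Finset.univ.filter fun j => u.1 j = a, by
      rw [Finset.mem_powersetCard]
      refine ⟨fun j hj => ?_, ?_⟩
      · simp at hj ⊢
        simp [hj]
      · rw [← u.2.2 a (Finset.mem_insert_self a S), Nat.card_eq_fintype_card,
          Fintype.card_subtype]⟩
  invFun x := ⟨fun j => if j ∈ x.2.1 then a else x.1.1 j, by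
      have hA := Finset.mem_powersetCard.1 x.2.2
      have hz : ∀ j ∈ x.2.1, x.1.1 j = 0 := fun j hj => by simpa using hA.1 hj
      refine ⟨fun j hj => ?_, fun i hi => ?_⟩
      · by_cases h : j ∈ x.2.1
        · simp [h]
        · simp only [h, if_false] at hj ⊢
          exact Finset.mem_insert_of_mem (x.1.2.1 j hj)
      · rcases Finset.mem_insert.1 hi with rfl | hi
        · have hna (j) (hj : x.1.1 j = i) : False := ha (by
            rw [← hj]; exact x.1.2.1 j (by rw [hj]; exact ha0))
          refine Eq.trans ?_ hA.2
          rw [← Fintype.card_coe, ← Nat.card_eq_fintype_card]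
          refine Nat.card_congr (Equiv.subtypeEquivRight fun j => ?_)
          by_cases h : j ∈ x.2.1
          · simp [h]
          · simpa [h] using hna j
        · have hia : i ≠ a := fun h => ha (h ▸ hi)
          have hi0 : i ≠ 0 := fun h => h0 (h ▸ hi)
          rw [← x.1.2.2 i hi]
          refine Nat.card_congr (Equiv.subtypeEquivRight fun j => ?_)
          by_cases h : j ∈ x.2.1
          · simp [h, hia.symm, hz j h, hi0.symm]
          · simp [h]⟩
  left_inv u := by
    ext j
    by_cases h : u.1 j = a <;> simp [h]
  right_inv x := by
    have hA := Finset.mem_powersetCard.1 x.2.2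
    have hz : ∀ j ∈ x.2.1, x.1.1 j = 0 := fun j hj => by simpa using hA.1 hj
    have hna (j) (hj : x.1.1 j = a) : False := ha (by
      rw [← hj]; exact x.1.2.1 j (by rw [hj]; exact ha0))
    refine Sigma.subtype_ext (Subtype.ext (funext fun j => ?_)) (Finset.ext fun j => ?_)
    · by_cases h : j ∈ x.2.1
      · simp [h, hz j h]
      · simpa [h] using fun h' => (hna j h').elim
    · by_cases h : j ∈ x.2.1
      · simp [h]
      · simpa [h] using hna j

theorem card_content {S : Finset ℕ} (h0 : 0 ∉ S) (c : ℕ → ℕ) :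
    Nat.card (content Q S c) = Nat.multinomial S c * (Nat.card Q).choose (∑ i ∈ S, c i) := by
  classical
  induction S using Finset.induction_on with
  | empty =>
    have : content Q ∅ c = {fun _ => 0} := by
      ext u
      simp [content, funext_iff]
    simp [this]
  | insert a S ha ih =>
    have ha0 : a ≠ 0 := fun h => h0 (by simp [h])
    have h0' : 0 ∉ S := fun h => h0 (Finset.mem_insert_of_mem h)
    have := (content_finite (Q := Q) S c).to_subtype
    have := Fintype.ofFinite (content Q S c)
    rw [Nat.card_congr (contentInsertEquiv ha ha0 h0' c), Nat.card_sigma]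
    have h : ∀ v : content Q S c, Nat.card {A : Finset Q // A ∈ Finset.powersetCard (c a)
        (Finset.univ.filter fun j => v.1 j = 0)} = (Nat.card Q - ∑ i ∈ S, c i).choose (c a) := by
      intro v
      rw [← card_zeros h0' v.2, Nat.card_eq_fintype_card, Fintype.card_coe,
        Finset.card_powersetCard, Nat.card_eq_fintype_card, Fintype.card_subtype]
    rw [Finset.sum_congr rfl fun v _ => h v, Finset.sum_const, Finset.card_univ,
      ← Nat.card_eq_fintype_card, ih h0', Nat.multinomial_insert ha, Finset.sum_insert ha,
      smul_eq_mul]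
    have h2 := Nat.choose_mul (n := Nat.card Q) (k := c a + ∑ i ∈ S, c i) (s := ∑ i ∈ S, c i)
      (by omega)
    rw [Nat.add_sub_cancel, ← Nat.choose_symm_add] at h2
    rw [mul_assoc, ← h2]
    ring

end Word

/-! ### Words fixed by a rotation -/

namespace Word

variable {k : ℕ} (t : ZMod k)

/-- The orbits of the translation by `t`. -/
abbrev Orbit : Type := ZMod k ⧸ AddSubgroup.zmultiples t

theorem card_orbit : addOrderOf t * Nat.card (Orbit t) = k := by
  have h := AddSubgroup.card_eq_card_quotient_mul_card_addSubgroup (AddSubgroup.zmultiples t)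
  rw [Nat.card_zmultiples, Nat.card_zmod] at h
  rw [mul_comm]
  exact h.symm

theorem card_mk (P : Orbit t → Prop) :
    Nat.card {j : ZMod k // P j} = addOrderOf t * Nat.card {q // P q} := by
  have h := Nat.card_congr
    (QuotientAddGroup.preimageMkEquivAddSubgroupProdSet (AddSubgroup.zmultiples t) {q | P q})
  rw [Nat.card_prod, Nat.card_zmultiples] at h
  exact h

/-- The words invariant under translation by `t` are the words on the orbits. -/
def fixedEquiv : {w : ZMod k → ℕ // ∀ j, w (j - t) = w j} ≃ (Orbit t → ℕ) where
  toFun w := fun q => Quotient.liftOn' q w.1 fun a b hab => by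
    rw [QuotientAddGroup.leftRel_apply] at hab
    obtain ⟨z, hz⟩ := AddSubgroup.mem_zmultiples_iff.1 hab
    have hp : Function.Periodic w.1 t := fun x => by
      have := w.2 (x + t)
      rw [add_sub_cancel_right] at this
      exact this.symm
    have := hp.zsmul z a
    rw [hz] at this
    simpa using this.symm
  invFun u := ⟨fun j => u j, fun j =>
    congrArg u (QuotientAddGroup.eq.2 (by simp))⟩
  left_inv w := rfl
  right_inv u := by
    funext q
    induction q using QuotientAddGroup.induction_on
    rfl

theorem card_fixed (P : (ZMod k → ℕ) → Prop) :
    Nat.card {w : ZMod k → ℕ // P w ∧ ∀ j, w (j - t) = w j} =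
      Nat.card {u : Orbit t → ℕ // P fun j => u j} := by
  refine Nat.card_congr (Equiv.trans ?_ ((fixedEquiv t).symm.subtypeEquiv
    (q := fun w => P w.1) fun u => Iff.rfl).symm)
  exact { toFun := fun w => ⟨⟨w.1, w.2.2⟩, w.2.1⟩, invFun := fun w => ⟨w.1.1, w.2, w.1.2⟩
          left_inv := fun _ => rfl, right_inv := fun _ => rfl }

variable [NeZero k]

noncomputable instance : Fintype (Orbit t) := Fintype.ofFinite _

theorem sum_mk (u : Orbit t → ℕ) : ∑ j : ZMod k, u j = addOrderOf t * ∑ q, u q := by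
  classical
  rw [← Finset.sum_fiberwise (s := Finset.univ) (g := fun j : ZMod k => (j : Orbit t)),
    Finset.mul_sum]
  refine Finset.sum_congr rfl fun q _ => ?_
  rw [Finset.sum_congr rfl (g := fun _ => u q) (fun j hj => by rw [(Finset.mem_filter.1 hj).2]),
    Finset.sum_const, smul_eq_mul, ← Fintype.card_subtype, ← Nat.card_eq_fintype_card,
    card_mk t (fun q' => q' = q)]
  simp

variable {t} {ω : ℂ} (hω : IsPrimitiveRoot ω (addOrderOf t)) (n : ℕ)
include hω

theorem card_fixed_sum_le :
    (Nat.card {w : ZMod k → ℕ // ∑ j, w j ≤ n ∧ ∀ j, w (j - t) = w j} : ℂ) =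
      aeval ω (QAnalog.qBinomial (k + n) n) := by
  have hr : 0 < addOrderOf t := addOrderOf_pos t
  rw [card_fixed t (fun w => ∑ j, w j ≤ n)]
  have h := QAnalog.aeval_qBinomial_mul_add hω hr (Nat.card (Orbit t)) n
  rw [card_orbit] at h
  rw [h, ← card_sum_le]
  simp only [sum_mk, Nat.le_div_iff_mul_le hr, mul_comm]

theorem card_fixed_support {s : ℕ} (hs : s ≤ n) :
    (Nat.card {w : ZMod k → ℕ // (Nat.card {j // w j ≠ 0} = n - s ∧ ∑ j, w j ≤ n) ∧
      ∀ j, w (j - t) = w j} : ℂ) =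
      aeval ω (QAnalog.qBinomial n s * QAnalog.qBinomial k (n - s)) := by
  have hr : 0 < addOrderOf t := addOrderOf_pos t
  rw [card_fixed t (fun w => Nat.card {j // w j ≠ 0} = n - s ∧ ∑ j, w j ≤ n), map_mul,
    ← QAnalog.qBinomial_symm hs]
  have h := QAnalog.aeval_qBinomial_mul_left hω hr (Nat.card (Orbit t)) (n - s)
  rw [card_orbit] at h
  rw [h]
  have e : ∀ u : Orbit t → ℕ, Nat.card {j : ZMod k // u j ≠ 0} =
      addOrderOf t * Nat.card {q // u q ≠ 0} := fun u => card_mk t fun q => u q ≠ 0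
  simp only [e, sum_mk]
  split_ifs with hd
  · obtain ⟨c, hc⟩ := hd
    rw [hc, QAnalog.aeval_qBinomial_mul_right hω hr, Nat.mul_div_cancel_left _ hr,
      ← Nat.cast_mul, mul_comm (Nat.choose _ _), ← card_support_sum_le]
    congr 1
    refine Nat.card_congr (Equiv.subtypeEquivRight fun u => ?_)
    rw [Nat.le_div_iff_mul_le hr, mul_comm (∑ j, u j), Nat.mul_right_inj hr.ne']
  · rw [mul_zero, Nat.cast_eq_zero, Nat.card_eq_zero]
    exact Or.inl ⟨fun u => hd ⟨_, u.2.1.symm⟩⟩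

/-- The fixed words are the words on the orbits whose contents and whose sum are divided by the size
`r` of the orbits. If some `b i` is not divisible by `r`, then both sides vanish. -/
theorem card_fixed_content {b : ℕ → ℕ} (hb : ∑ i ∈ Finset.Icc 1 n, i * b i ≤ n) :
    (Nat.card {w : ZMod k → ℕ // ((∀ i ∈ Finset.Icc 1 n, Nat.card {j // w j = i} = b i) ∧
      ∑ j, w j ≤ n) ∧ ∀ j, w (j - t) = w j} : ℂ) =
      aeval ω (QAnalog.qMultinomial (Finset.Icc 1 n) b *
        QAnalog.qBinomial k (∑ i ∈ Finset.Icc 1 n, b i)) := by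
  have hr : 0 < addOrderOf t := addOrderOf_pos t
  set r := addOrderOf t with hrdef
  rw [card_fixed t (fun w => (∀ i ∈ Finset.Icc 1 n, Nat.card {j // w j = i} = b i) ∧
    ∑ j, w j ≤ n), map_mul]
  have h := QAnalog.aeval_qBinomial_mul_left hω hr (Nat.card (Orbit t))
    (∑ i ∈ Finset.Icc 1 n, b i)
  rw [card_orbit] at h
  rw [h]
  have e : ∀ (u : Orbit t → ℕ) (i : ℕ), Nat.card {j : ZMod k // u j = i} =
      r * Nat.card {q // u q = i} := fun u i => card_mk t fun q => u q = i
  simp only [e, sum_mk]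
  by_cases hall : ∀ i ∈ Finset.Icc 1 n, r ∣ b i
  · set c : ℕ → ℕ := fun i => b i / r with hc
    have hbc : ∀ i ∈ Finset.Icc 1 n, b i = r * c i := fun i hi =>
      (Nat.mul_div_cancel' (hall i hi)).symm
    have hsum : ∑ i ∈ Finset.Icc 1 n, b i = r * ∑ i ∈ Finset.Icc 1 n, c i := by
      rw [Finset.mul_sum]; exact Finset.sum_congr rfl hbc
    have hmul : QAnalog.qMultinomial (Finset.Icc 1 n) b =
        QAnalog.qMultinomial (Finset.Icc 1 n) fun i => r * c i := by
      rw [QAnalog.qMultinomial, QAnalog.qMultinomial, Finset.sum_congr rfl hbc]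
      congr 1
      exact Finset.prod_congr rfl fun i hi => by rw [hbc i hi]
    rw [hmul, QAnalog.aeval_qMultinomial hω hr, hsum, if_pos (dvd_mul_right _ _),
      Nat.mul_div_cancel_left _ hr, ← Nat.cast_mul, ← card_content (by simp)]
    congr 1
    refine Nat.card_congr (Equiv.subtypeEquivRight fun u => ?_)
    rw [content, Set.mem_ofPred_eq]
    have hiff : (∀ i ∈ Finset.Icc 1 n, r * Nat.card {q // u q = i} = b i) ↔
        ∀ i ∈ Finset.Icc 1 n, Nat.card {q // u q = i} = c i :=
      forall₂_congr fun i hi => by rw [hbc i hi, Nat.mul_right_inj hr.ne']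
    rw [hiff, and_comm]
    refine and_congr_left fun hu => ⟨fun hs j hj => ?_, fun hs => ?_⟩
    · rw [Finset.mem_Icc]
      refine ⟨Nat.one_le_iff_ne_zero.2 hj, ?_⟩
      calc u j ≤ ∑ q, u q :=
          Finset.single_le_sum (f := u) (fun _ _ => Nat.zero_le _) (Finset.mem_univ j)
        _ ≤ r * ∑ q, u q := Nat.le_mul_of_pos_left _ hr
        _ ≤ n := hs
    · classical
      have hsu : ∑ q, u q = ∑ i ∈ Finset.Icc 1 n, i * c i := by
        rw [← Finset.sum_filter_add_sum_filter_not Finset.univ (fun q => u q ≠ 0)]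
        rw [Finset.sum_eq_zero (s := Finset.univ.filter fun q => ¬ u q ≠ 0)
          (fun q hq => by simpa using hq), add_zero,
          ← Finset.sum_fiberwise_of_maps_to (g := u) (t := Finset.Icc 1 n)
            (fun q hq => hs q (by simpa using hq))]
        refine Finset.sum_congr rfl fun i hi => ?_
        have hi1 := (Finset.mem_Icc.1 hi).1
        rw [Finset.sum_congr rfl (g := fun _ => i) (fun q hq => (Finset.mem_filter.1 hq).2),
          Finset.sum_const, smul_eq_mul, mul_comm, ← hu i hi, Nat.card_eq_fintype_card,
          Fintype.card_subtype, Finset.filter_filter]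
        congr 2
        ext q
        simp only [Finset.mem_filter, Finset.mem_univ, true_and]
        omega
      refine le_trans (le_of_eq ?_) hb
      rw [hsu, Finset.mul_sum]
      exact Finset.sum_congr rfl fun i hi => by rw [hbc i hi]; ring
  · have hempty : Nat.card {u : Orbit t → ℕ // (∀ i ∈ Finset.Icc 1 n,
        r * Nat.card {q // u q = i} = b i) ∧ r * ∑ q, u q ≤ n} = 0 := by
      rw [Nat.card_eq_zero]
      exact Or.inl ⟨fun u => hall fun i hi => ⟨_, (u.2.1 i hi).symm⟩⟩
    rw [hempty]
    split_ifs with hd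
    · rw [QAnalog.aeval_qMultinomial_eq_zero hω hr _ _ hd hall]; simp
    · simp

end Word

/-! ### Transport of cyclic sieving along an equivariant bijection -/

/-- If `g` has order `ρ` in `ℤ/2kℤ`, then the square of `e^(2πi/ρ)` is a primitive root of unity
whose order is the order of the image of `g` in `ℤ/kℤ`. -/
theorem exp_sq_isPrimitiveRoot {k : ℕ} [NeZero k] (g : ZMod (2 * k)) :
    IsPrimitiveRoot (Complex.exp (2 * Real.pi * Complex.I / (addOrderOf g : ℕ)) ^ 2)
      (addOrderOf (ZMod.castHom (dvd_mul_left k 2) (ZMod k) g)) := by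
  have hg : addOrderOf g ≠ 0 := (addOrderOf_pos g).ne'
  set ζ := Complex.exp (2 * Real.pi * Complex.I / (addOrderOf g : ℕ)) with hζ
  have h1 : IsPrimitiveRoot ζ (addOrderOf g) := Complex.isPrimitiveRoot_exp _ hg
  have h2 : addOrderOf (ZMod.castHom (dvd_mul_left k 2) (ZMod k) g) = orderOf (ζ ^ 2) := by
    rw [orderOf_pow' ζ two_ne_zero, ← h1.eq_orderOf, ← addOrderOf_nsmul' g two_ne_zero]
    refine Nat.dvd_antisymm ?_ ?_ <;>
    · rw [addOrderOf_dvd_iff_nsmul_eq_zero]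
      obtain ⟨z, rfl⟩ := ZMod.intCast_surjective g
      first
      | have h3 := addOrderOf_nsmul_eq_zero (2 • (z : ZMod (2 * k)))
        rw [← map_nsmul]
        generalize addOrderOf (2 • (z : ZMod (2 * k))) = l at h3 ⊢
        simp only [nsmul_eq_mul] at h3 ⊢
        norm_cast at h3 ⊢
        simp only [map_intCast]
        rw [ZMod.intCast_zmod_eq_zero_iff_dvd] at h3 ⊢
        push_cast at h3 ⊢
        obtain ⟨c, hc⟩ := h3
        exact ⟨c, by linarith⟩
      | have h3 := addOrderOf_nsmul_eq_zero
          (ZMod.castHom (dvd_mul_left k 2) (ZMod k) (z : ZMod (2 * k)))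
        generalize addOrderOf (ZMod.castHom (dvd_mul_left k 2) (ZMod k) (z : ZMod (2 * k))) = l
          at h3 ⊢
        rw [map_intCast] at h3
        simp only [nsmul_eq_mul] at h3 ⊢
        norm_cast at h3 ⊢
        rw [ZMod.intCast_zmod_eq_zero_iff_dvd] at h3 ⊢
        push_cast at h3 ⊢
        obtain ⟨c, hc⟩ := h3
        exact ⟨c, by linarith⟩
  rw [h2]
  exact IsPrimitiveRoot.orderOf _

/-- Cyclic sieving for a map which is conjugate, under `Ψ`, to the rotation of words. The group has
twice the order of the rotation, hence the substitution `q ↦ q²`. -/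
theorem cyclicSievingUnder_of_words {α : Type*} {S : Set α} {f : α → α} {k : ℕ} [NeZero k]
    {W : Set (ZMod k → ℕ)} {Ψ : (ZMod k → ℕ) → α} (hΨ : Set.BijOn Ψ W S)
    (hW : ∀ w ∈ W, ∀ t : ZMod k, (fun j => w (j - t)) ∈ W)
    (hf : ∀ w ∈ W, f (Ψ w) = Ψ fun j => w (j - 1)) {P : ℤ[X]} (hP : ∀ i, 0 ≤ P.coeff i)
    (hcount : ∀ (t : ZMod k) (ω : ℂ), IsPrimitiveRoot ω (addOrderOf t) →
      (Nat.card {w // w ∈ W ∧ ∀ j, w (j - t) = w j} : ℂ) = aeval ω P) :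
    CyclicSievingUnder S (P.comp (X ^ 2)) f (2 * k) := by
  let e : W ≃ S := hΨ.equiv Ψ
  let φ := ZMod.castHom (dvd_mul_left k 2) (ZMod k)
  let sh : ZMod k → W → W := fun t w => ⟨fun j => w.1 (j - t), hW w.1 w.2 t⟩
  let act : MulAction (Multiplicative (ZMod (2 * k))) S :=
    { smul := fun g x => e (sh (φ g.toAdd) (e.symm x))
      one_smul := fun x => by
        change e (sh (φ 0) (e.symm x)) = x
        simp [sh]
      mul_smul := fun g h x => by
        change e (sh (φ (g.toAdd + h.toAdd)) (e.symm x)) =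
          e (sh (φ g.toAdd) (e.symm (e (sh (φ h.toAdd) (e.symm x)))))
        rw [Equiv.symm_apply_apply]
        congr 1
        apply Subtype.ext
        funext j
        simp only [sh, map_add, sub_sub] }
  refine ⟨act, fun x => ?_, QAnalog.comp_X_sq_coeff_nonneg hP, fun ρ _ g hg => ?_⟩
  · change (e (sh (φ 1) (e.symm x)) : α) = f x
    obtain ⟨w, rfl⟩ := e.surjective x
    rw [Equiv.symm_apply_apply, map_one]
    exact (hf w.1 w.2).symm
  · have h1 := exp_sq_isPrimitiveRoot g.toAdd
    have h2 : addOrderOf g.toAdd = ρ := by rw [← hg]; rfl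
    rw [h2] at h1
    rw [aeval_comp, map_pow, aeval_X, ← hcount _ _ h1]
    congr 1
    refine Nat.card_congr ?_
    refine (e.symm.subtypeEquiv (q := fun w => ∀ j, w.1 (j - φ g.toAdd) = w.1 j)
      fun x => ?_).trans
      { toFun := fun w => ⟨w.1.1, w.1.2, w.2⟩, invFun := fun w => ⟨⟨w.1, w.2.1⟩, w.2.2⟩
        left_inv := fun _ => rfl, right_inv := fun _ => rfl }
    change e (sh (φ g.toAdd) (e.symm x)) = x ↔ _
    rw [← Equiv.eq_symm_apply, Subtype.ext_iff, funext_iff]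

/-! ### The non-crossing partition of a height function -/

namespace TypeB

variable {N : ℕ}

/-- Height functions on `ℤ`: they descend by at most one unit per step, their steps are
`N`-periodic, and they do not ascend over a period. The step `H (x + 1) - H x = s - 1` means that
a block with `s` elements is opened at the point `x`, and that `x` itself is put into the
innermost block which still lacks elements. -/
structure IsHeight (N : ℕ) (H : ℤ → ℤ) : Prop where
  step : ∀ x, H x ≤ H (x + 1) + 1
  per : ∀ x, H (x + N) = H x + (H N - H 0)
  nonpos : H N ≤ H 0

/-- The point `x` belongs to the block which is opened at `y`: the height falls to `H (x + 1)` for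
the first time after `y` in the step from `x` to `x + 1`, and this value is not below `H y`. -/
def Opens (H : ℤ → ℤ) (y x : ℤ) : Prop :=
  y ≤ x ∧ H y ≤ H (x + 1) ∧ ∀ z, y < z → z ≤ x → H (x + 1) < H z

/-- The point `x` belongs to no block which is opened somewhere. These points form the zero block.
-/
def Outer (H : ℤ → ℤ) (x : ℤ) : Prop := ∀ y ≤ x, H (x + 1) < H y

theorem opens_or_outer (H : ℤ → ℤ) (x : ℤ) : (∃ y, Opens H y x) ∨ Outer H x := by
  by_cases h : Outer H x
  · exact Or.inr h
  · left
    simp only [Outer, not_forall, not_lt] at h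
    obtain ⟨y, hy, hy'⟩ := h
    obtain ⟨u, ⟨h1, h2⟩, h3⟩ := Int.exists_greatest_of_bdd (P := fun y => y ≤ x ∧ H y ≤ H (x + 1))
      ⟨x, fun z hz => hz.1⟩ ⟨y, hy, hy'⟩
    refine ⟨u, h1, h2, fun z hz hzx => ?_⟩
    by_contra hc
    have := h3 z ⟨hzx, not_lt.1 hc⟩
    omega

theorem Opens.not_outer {H : ℤ → ℤ} {x y : ℤ} (h : Opens H y x) : ¬ Outer H x := fun h' => by
  have := h' y h.1
  have := h.2.1
  omega

theorem Opens.unique {H : ℤ → ℤ} {x y z : ℤ} (h : Opens H y x) (h' : Opens H z x) : y = z := by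
  rcases lt_trichotomy y z with hl | hl | hl
  · have := h.2.2 z hl h'.1
    have := h'.2.1
    omega
  · exact hl
  · have := h'.2.2 y hl h.1
    have := h.2.1
    omega

theorem Opens.self {H : ℤ → ℤ} {x y : ℤ} (h : Opens H y x) : Opens H y y := by
  refine ⟨le_rfl, ?_, fun z h1 h2 => by omega⟩
  obtain ⟨h1, h2, h3⟩ := h
  rcases h1.eq_or_lt with rfl | h1
  · exact h2
  · have := h3 (y + 1) (by omega) (by omega)
    omega

theorem opens_self_iff {H : ℤ → ℤ} {y : ℤ} : Opens H y y ↔ H y ≤ H (y + 1) :=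
  ⟨fun h => h.2.1, fun h => ⟨le_rfl, h, fun z h1 h2 => by omega⟩⟩

/-- The blocks opened at the same point do not cross other blocks. -/
theorem Opens.le_of_between {H : ℤ → ℤ} {y v a b c : ℤ} (ha : Opens H y a) (hc : Opens H y c)
    (hab : a < b) (hbc : b < c) (hb : Opens H v b) : y ≤ v := by
  by_contra hlt
  have h1 := hb.2.2 y (by omega) (by have := ha.1; omega)
  have h2 := hc.2.2 (b + 1) (by have := ha.1; omega) (by omega)
  have := hc.2.1
  omega

theorem Opens.not_outer_of_between {H : ℤ → ℤ} {y a b c : ℤ} (ha : Opens H y a) (hc : Opens H y c)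
    (hab : a < b) (hbc : b < c) : ¬ Outer H b := fun hb => by
  have h1 := hb y (by have := ha.1; omega)
  have h2 := hc.2.2 (b + 1) (by have := ha.1; omega) (by omega)
  have := hc.2.1
  omega

/-- A block with elements on both sides of `c` contains `c` if it was opened last among those. -/
theorem Opens.eq_of_cross {H : ℤ → ℤ} {y v b c d : ℤ} (hb : Opens H v b) (hc : Opens H y c)
    (hd : Opens H v d) (hbc : b < c) (hcd : c < d) (h : y ≤ v) : y = v := by
  by_contra hne
  have h1 := hb.1
  have h2 := hc.2.2 v (by omega) (by omega)
  have h3 := hd.2.2 (c + 1) (by omega) (by omega)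
  have h4 := hd.2.1
  omega

namespace IsHeight

variable {H : ℤ → ℤ} (hH : IsHeight N H)
include hH

theorem per_mul (x k : ℤ) : H (x + k * N) = H x + k * (H N - H 0) := by
  induction k using Int.induction_on with
  | zero => simp
  | succ i ih =>
    have := hH.per (x + i * N)
    rw [add_assoc] at this
    rw [add_mul, one_mul, this, ih]
    ring
  | pred i ih =>
    have := hH.per (x + (-i - 1) * N)
    rw [show x + (-(i : ℤ) - 1) * N + N = x + -i * N by ring, ih] at this
    linarith

theorem opens_add_mul {y x : ℤ} (h : Opens H y x) (k : ℤ) : Opens H (y + k * N) (x + k * N) := by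
  refine ⟨by have := h.1; omega, ?_, fun z h1 h2 => ?_⟩
  · rw [show x + k * N + 1 = x + 1 + k * N by ring, hH.per_mul, hH.per_mul]
    have := h.2.1
    omega
  · have := h.2.2 (z - k * N) (by omega) (by omega)
    have h3 := hH.per_mul (z - k * N) k
    rw [sub_add_cancel] at h3
    rw [show x + k * N + 1 = x + 1 + k * N by ring, hH.per_mul, h3]
    omega

theorem outer_add_mul {x : ℤ} (h : Outer H x) (k : ℤ) : Outer H (x + k * N) := by
  intro z h2
  have := h (z - k * N) (by omega)
  have h3 := hH.per_mul (z - k * N) k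
  rw [sub_add_cancel] at h3
  rw [show x + k * N + 1 = x + 1 + k * N by ring, hH.per_mul, h3]
  omega

theorem opens_add {y x : ℤ} (h : Opens H y x) : Opens H (y + N) (x + N) := by
  simpa using hH.opens_add_mul h 1

theorem outer_add {x : ℤ} (h : Outer H x) : Outer H (x + N) := by
  simpa using hH.outer_add_mul h 1

theorem opens_add_two {y x : ℤ} (h : Opens H y x) : Opens H (y + 2 * N) (x + 2 * N) :=
  hH.opens_add_mul h 2

theorem opens_sub {y x : ℤ} (h : Opens H y x) : Opens H (y - N) (x - N) := by
  simpa [sub_eq_add_neg] using hH.opens_add_mul h (-1)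

theorem outer_sub {x : ℤ} (h : Outer H x) : Outer H (x - N) := by
  simpa [sub_eq_add_neg] using hH.outer_add_mul h (-1)

/-- A block which is opened somewhere is contained in a half-turn. -/
theorem lt_of_opens [NeZero N] {y x : ℤ} (h : Opens H y x) : x < y + N := by
  have h0 := NeZero.pos N
  by_contra hc
  have h1 := h.2.2 (y + N) (by omega) (by omega)
  have h2 := hH.per y
  have h3 := hH.nonpos
  have h4 := h.2.1
  omega

end IsHeight

open Classical in
/-- The point (modulo `2N`) where the block of `a` is opened, or `none` if there is no such point.
-/
noncomputable def label (H : ℤ → ℤ) (a : Pt N) : Option (Pt N) :=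
  if h : ∃ y, Opens H y (a.val : ℤ) then some (h.choose : Pt N) else none

/-- The partition of `ℤ/2Nℤ` defined by a height function. Points are in the same block if their
blocks are opened at the same point; all points without such a point form one block. -/
noncomputable def partition (N : ℕ) (H : ℤ → ℤ) : Setoid (Pt N) := Setoid.ker (label H)

theorem intCast_eq_intCast_iff {x y : ℤ} :
    (x : Pt N) = y ↔ ∃ k : ℤ, y = x + k * (2 * N) := by
  rw [ZMod.intCast_eq_intCast_iff_dvd_sub]
  constructor
  · rintro ⟨k, hk⟩
    exact ⟨k, by push_cast at hk; linarith⟩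
  · rintro ⟨k, hk⟩
    exact ⟨k, by push_cast; linarith⟩

theorem eq_of_intCast_eq {x y : ℤ} (h : (x : Pt N) = y) (h1 : x < y + 2 * N) (h2 : y < x + 2 * N) :
    x = y := by
  obtain ⟨k, rfl⟩ := intCast_eq_intCast_iff.1 h
  have hk : k = 0 := by
    rcases lt_trichotomy k 0 with hk | hk | hk
    · nlinarith
    · exact hk
    · nlinarith
  simp [hk]

theorem intCast_add_two (x : ℤ) : ((x + 2 * N : ℤ) : Pt N) = x := by
  have := ZMod.natCast_self (2 * N)
  push_cast at this ⊢
  rw [this, add_zero]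

theorem intCast_sub_two (x : ℤ) : ((x - 2 * N : ℤ) : Pt N) = x := by
  rw [← intCast_add_two, sub_add_cancel]

theorem eq_or_eq_of_intCast_eq {x y : ℤ} (h : (x : Pt N) = y) (h1 : x < y + 2 * N)
    (h2 : y < x + 4 * N) : y = x ∨ y = x + 2 * N := by
  rcases lt_or_ge y (x + 2 * N) with hl | hl
  · exact Or.inl (eq_of_intCast_eq h h1 hl).symm
  · have := eq_of_intCast_eq (x := x + 2 * N) (y := y) (by rw [intCast_add_two, h])
      (by omega) (by omega)
    omega

section

variable [NeZero N]

theorem intCast_val (a : Pt N) : ((a.val : ℤ) : Pt N) = a := by simp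

/-- Every point has a representative in a given window of length `2N`. -/
theorem exists_rep (a : Pt N) (l : ℤ) : ∃ x : ℤ, (x : Pt N) = a ∧ l ≤ x ∧ x < l + 2 * N := by
  obtain ⟨z, rfl⟩ := ZMod.intCast_surjective a
  have hN := NeZero.pos N
  refine ⟨l + (z - l) % (2 * N), ?_, ?_, ?_⟩
  · rw [intCast_eq_intCast_iff]
    refine ⟨(z - l) / (2 * N), ?_⟩
    have := Int.emod_add_mul_ediv (z - l) (2 * N)
    linarith
  · have := Int.emod_nonneg (z - l) (b := 2 * N) (by omega)
    omega
  · have := Int.emod_lt_of_pos (z - l) (b := 2 * N) (by omega)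
    omega

theorem exists_mul_add_val (x : ℤ) : ∃ k : ℤ, ((x : Pt N).val : ℤ) = x + (2 * k) * N := by
  obtain ⟨k, hk⟩ := intCast_eq_intCast_iff.1 (intCast_val (x : Pt N)).symm
  exact ⟨k, by rw [hk]; ring⟩

variable {H : ℤ → ℤ} (hH : IsHeight N H)
include hH

theorem label_of_opens {y x : ℤ} (h : Opens H y x) : label H (x : Pt N) = some (y : Pt N) := by
  obtain ⟨k, hk⟩ := exists_mul_add_val (N := N) x
  have h' := hH.opens_add_mul h (2 * k)
  rw [← hk] at h'
  have hex : ∃ y, Opens H y ((x : Pt N).val : ℤ) := ⟨_, h'⟩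
  rw [label, dif_pos hex, hex.choose_spec.unique h']
  congr 1
  exact (intCast_eq_intCast_iff.2 ⟨k, by ring⟩).symm

theorem label_of_outer {x : ℤ} (h : Outer H x) : label H (x : Pt N) = none := by
  obtain ⟨k, hk⟩ := exists_mul_add_val (N := N) x
  have h' := hH.outer_add_mul h (2 * k)
  rw [← hk] at h'
  rw [label, dif_neg]
  rintro ⟨y, hy⟩
  exact hy.not_outer h'

theorem rel_iff_of_opens {x y x' y' : ℤ} (h : Opens H y x) (h' : Opens H y' x') :
    partition N H (x : Pt N) (x' : Pt N) ↔ (y : Pt N) = y' := by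
  rw [partition, Setoid.ker_def, label_of_opens hH h, label_of_opens hH h', Option.some_inj]

theorem rel_of_opens {x x' y : ℤ} (h : Opens H y x) (h' : Opens H y x') :
    partition N H (x : Pt N) (x' : Pt N) := (rel_iff_of_opens hH h h').2 rfl

theorem rel_of_outer {x x' : ℤ} (h : Outer H x) (h' : Outer H x') :
    partition N H (x : Pt N) (x' : Pt N) := by
  rw [partition, Setoid.ker_def, label_of_outer hH h, label_of_outer hH h']

theorem not_rel_of_opens_of_outer {x x' y : ℤ} (h : Opens H y x) (h' : Outer H x') :
    ¬ partition N H (x : Pt N) (x' : Pt N) := by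
  rw [partition, Setoid.ker_def, label_of_outer hH h', label_of_opens hH h]
  simp

theorem exists_opens_of_rel {x x' y : ℤ} (h : Opens H y x)
    (h' : partition N H (x : Pt N) (x' : Pt N)) : ∃ y', Opens H y' x' ∧ (y : Pt N) = y' := by
  rcases opens_or_outer H x' with ⟨y', hy'⟩ | ho
  · exact ⟨y', hy', (rel_iff_of_opens hH h hy').1 h'⟩
  · exact absurd h' (not_rel_of_opens_of_outer hH h ho)

theorem outer_of_rel {x x' : ℤ} (h : Outer H x)
    (h' : partition N H (x : Pt N) (x' : Pt N)) : Outer H x' := by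
  rcases opens_or_outer H x' with ⟨y', hy'⟩ | ho
  · exact absurd (Setoid.symm' _ h') (not_rel_of_opens_of_outer hH hy' h)
  · exact ho

/-- For related points in a suitable window, the block is opened at the same integer, and not only
at congruent ones. -/
theorem opens_of_rel {x x' y : ℤ} (h : Opens H y x) (h' : partition N H (x : Pt N) (x' : Pt N))
    (h1 : y - N ≤ x') (h2 : x' < y + 2 * N) : Opens H y x' := by
  obtain ⟨y', hy', he⟩ := exists_opens_of_rel hH h h'
  have h3 := hH.lt_of_opens hy'
  have h4 := hy'.1
  rwa [eq_of_intCast_eq he (by omega) (by omega)]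

theorem partition_isSymmetric : IsSymmetric (partition N H) := by
  intro a b hab
  obtain ⟨x, rfl⟩ := ZMod.intCast_surjective a
  obtain ⟨x', rfl⟩ := ZMod.intCast_surjective b
  have e (z : ℤ) : bar (z : Pt N) = ((z + N : ℤ) : Pt N) := by simp [bar]
  rw [e, e]
  rcases opens_or_outer H x with ⟨y, hy⟩ | ho
  · obtain ⟨y', hy', he⟩ := exists_opens_of_rel hH hy hab
    rw [rel_iff_of_opens hH (hH.opens_add hy) (hH.opens_add hy')]
    push_cast
    rw [he]
  · exact rel_of_outer hH (hH.outer_add ho) (hH.outer_add (outer_of_rel hH ho hab))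

/-- The crossing condition on the circle, in a case where the first and the third point are in a
block opened before both of them. -/
theorem rel_of_cross_of_opens {a b c d y : ℤ} (hab : a < b) (hbc : b < c) (hcd : c < d)
    (hda : d < a + 2 * N) (ha : Opens H y a) (hc : Opens H y c)
    (hbd : partition N H (b : Pt N) (d : Pt N)) :
    partition N H (a : Pt N) (b : Pt N) := by
  rcases opens_or_outer H b with ⟨v, hv⟩ | ho
  · have hyv := ha.le_of_between hc hab hbc hv
    obtain ⟨v', hv', he⟩ := exists_opens_of_rel hH hv hbd
    have h1 := hv.1
    have h2 := hv'.1
    have h3 := hH.lt_of_opens hv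
    have h4 := hH.lt_of_opens hv'
    have h5 := hH.lt_of_opens ha
    have h6 := ha.1
    rcases eq_or_eq_of_intCast_eq he (by omega) (by omega) with rfl | rfl
    · obtain rfl := hv.eq_of_cross hc hv' hbc hcd hyv
      exact rel_of_opens hH ha hv
    · rcases hyv.eq_or_lt with rfl | hlt
      · exact rel_of_opens hH ha hv
      · have h7 := ha.2.2 v hlt (by omega)
        have h8 := hv.2.2 (a + 1) (by omega) (by omega)
        have h9 := hv.2.1
        omega
  · exact absurd ho (ha.not_outer_of_between hc hab hbc)

theorem partition_cross {a b c d : ℤ} (hab : a < b) (hbc : b < c) (hcd : c < d)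
    (hda : d < a + 2 * N) (hac : partition N H (a : Pt N) (c : Pt N))
    (hbd : partition N H (b : Pt N) (d : Pt N)) :
    partition N H (a : Pt N) (b : Pt N) := by
  -- it suffices to consider the case where `a` and `c` are opened
  have key : ∀ a b c d y : ℤ, a < b → b < c → c < d → d < a + 2 * N →
      partition N H (a : Pt N) (c : Pt N) → partition N H (b : Pt N) (d : Pt N) → Opens H y a →
      partition N H (a : Pt N) (b : Pt N) := by
    intro a b c d y hab hbc hcd hda hac hbd ha
    obtain ⟨y', hc, he⟩ := exists_opens_of_rel hH ha hac
    have h1 := hc.1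
    have h2 := hH.lt_of_opens hc
    have h3 := ha.1
    have h4 := hH.lt_of_opens ha
    rcases eq_or_eq_of_intCast_eq he (by omega) (by omega) with rfl | rfl
    · exact rel_of_cross_of_opens hH hab hbc hcd hda ha hc hbd
    · have h := rel_of_cross_of_opens hH (a := c) (b := d) (c := a + 2 * N) (d := b + 2 * N)
        (by omega) (by omega) (by omega) (by omega) hc (hH.opens_add_two ha)
        (by rw [intCast_add_two]; exact Setoid.symm' _ hbd)
      exact Setoid.trans' _ hac (Setoid.trans' _ h (Setoid.symm' _ hbd))
  rcases opens_or_outer H a with ⟨y, hy⟩ | ha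
  · exact key a b c d y hab hbc hcd hda hac hbd hy
  · rcases opens_or_outer H b with ⟨v, hv⟩ | hb
    · have h := key b c d (a + 2 * N) v hbc hcd hda (by omega) hbd
        (by rw [intCast_add_two]; exact Setoid.symm' _ hac) hv
      exact Setoid.trans' _ hac (Setoid.symm' _ h)
    · exact rel_of_outer hH ha hb

theorem partition_isNoncrossing : IsNoncrossing (partition N H) := by
  intro a b c d hab hbc hcd hac hbd
  have := partition_cross hH (a := a.val) (b := b.val) (c := c.val) (d := d.val) (by omega)
    (by omega) (by omega) (by have := ZMod.val_lt d; omega)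
  simp only [intCast_val] at this
  exact this hac hbd

end

end TypeB

/-! ### Block sizes -/

namespace TypeB

variable {N : ℕ}

/-- The point `a` is the first one, in clockwise direction, in its block, which is not a zero block:
the half-turn before `a` contains no other point of the block. -/
def IsOpener (π : Setoid (Pt N)) (a : Pt N) : Prop := ∀ i : ℕ, 0 < i → i ≤ N → ¬ π (a - i) a

open Classical in
/-- The size of the block with first element `a`, and `0` if `a` is not the first element of a
non-zero block. -/
noncomputable def openedSize (π : Setoid (Pt N)) (a : Pt N) : ℕ :=
  if IsOpener π a then {x | π x a}.ncard else 0

theorem isOpener_intCast {π : Setoid (Pt N)} {y : ℤ} :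
    IsOpener π (y : Pt N) ↔ ∀ z : ℤ, y - N ≤ z → z < y → ¬ π (z : Pt N) (y : Pt N) := by
  constructor
  · intro h z h1 h2
    have := h (y - z).toNat (by omega) (by omega)
    have e : ((y : Pt N) - ((y - z).toNat : ℕ)) = (z : Pt N) := by
      have : ((y - z).toNat : ℤ) = y - z := by omega
      rw [← Int.cast_natCast, this]
      push_cast
      ring
    rwa [e] at this
  · intro h i h1 h2
    have := h (y - i) (by omega) (by omega)
    push_cast at this
    exact this

variable {H : ℤ → ℤ}

theorem Opens.eq_of_height_eq {x x' y : ℤ} (h : Opens H y x) (h' : Opens H y x')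
    (he : H (x + 1) = H (x' + 1)) : x = x' := by
  rcases lt_trichotomy x x' with hl | hl | hl
  · have := h'.2.2 (x + 1) (by have := h.1; omega) (by omega)
    omega
  · exact hl
  · have := h.2.2 (x' + 1) (by have := h'.1; omega) (by omega)
    omega

theorem Opens.height_le {x y : ℤ} (h : Opens H y x) : H (x + 1) ≤ H (y + 1) := by
  rcases h.1.eq_or_lt with rfl | hl
  · exact le_rfl
  · exact (h.2.2 (y + 1) (by omega) (by omega)).le

/-- The elements of a block correspond to the heights at which they are found: the `i`-th last
element is the first point after which the height has fallen to `H y + i`. -/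
theorem IsHeight.exists_opens_height [NeZero N] (hH : IsHeight N H) {y h : ℤ} (h1 : H y ≤ h)
    (h2 : h ≤ H (y + 1)) : ∃ x, Opens H y x ∧ H (x + 1) = h := by
  have hN := NeZero.pos N
  obtain ⟨x, ⟨hx1, hx2⟩, hx3⟩ := Int.exists_least_of_bdd (P := fun x => y ≤ x ∧ H (x + 1) ≤ h)
    ⟨y, fun z hz => hz.1⟩ ⟨y + N - 1, by omega, by
      have := hH.per y
      have := hH.nonpos
      rw [sub_add_cancel]
      omega⟩
  have hmin : ∀ z, y < z → z ≤ x → h < H z := fun z hz1 hz2 => by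
    by_contra hc
    have := hx3 (z - 1) ⟨by omega, by rw [sub_add_cancel]; omega⟩
    omega
  have heq : H (x + 1) = h := by
    rcases hx1.eq_or_lt with rfl | hl
    · omega
    · have := hmin x hl le_rfl
      have := hH.step x
      omega
  exact ⟨x, ⟨hx1, by omega, fun z hz1 hz2 => by rw [heq]; exact hmin z hz1 hz2⟩, heq⟩

section

variable [NeZero N] (hH : IsHeight N H)
include hH

theorem ncard_rel_of_opens_self {y : ℤ} (hy : Opens H y y) :
    {a : Pt N | partition N H a (y : Pt N)}.ncard = (H (y + 1) - H y + 1).toNat := by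
  have hex : ∀ i : ℕ, ∃ x, i < (H (y + 1) - H y + 1).toNat → Opens H y x ∧ H (x + 1) = H y + i := by
    intro i
    by_cases hi : i < (H (y + 1) - H y + 1).toNat
    · obtain ⟨x, hx⟩ := hH.exists_opens_height (y := y) (h := H y + i) (by omega) (by omega)
      exact ⟨x, fun _ => hx⟩
    · exact ⟨0, fun h => absurd h hi⟩
  choose x hx using hex
  have himg : {a : Pt N | partition N H a (y : Pt N)} =
      (fun i => (x i : Pt N)) '' (Finset.range (H (y + 1) - H y + 1).toNat : Set ℕ) := by
    ext a
    simp only [Set.mem_ofPred_eq, Set.mem_image, Finset.coe_range, Set.mem_Iio]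
    constructor
    · intro ha
      obtain ⟨z, rfl, hz1, hz2⟩ := exists_rep a y
      have hz := opens_of_rel hH hy (Setoid.symm' _ ha) (by omega) hz2
      have h1 := hz.height_le
      have h2 := hz.2.1
      have hi : (H (z + 1) - H y).toNat < (H (y + 1) - H y + 1).toNat := by omega
      refine ⟨_, hi, ?_⟩
      rw [(hx _ hi).1.eq_of_height_eq hz (by rw [(hx _ hi).2]; omega)]
    · rintro ⟨i, hi, rfl⟩
      exact rel_of_opens hH (hx i hi).1 hy
  rw [himg, Set.InjOn.ncard_image, Set.ncard_coe_finset, Finset.card_range]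
  intro i hi j hj hij
  simp only [Finset.coe_range, Set.mem_Iio] at hi hj
  have h1 := hH.lt_of_opens (hx i hi).1
  have h2 := hH.lt_of_opens (hx j hj).1
  have h3 := (hx i hi).1.1
  have h4 := (hx j hj).1.1
  have h5 := eq_of_intCast_eq hij (by omega) (by omega)
  have h6 := (hx i hi).2
  have h7 := (hx j hj).2
  rw [h5] at h6
  omega

theorem isOpener_partition_iff {y : ℤ} :
    IsOpener (partition N H) (y : Pt N) ↔ H y ≤ H (y + 1) := by
  rw [isOpener_intCast, ← opens_self_iff]
  constructor
  · intro h
    have hN := NeZero.pos N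
    rcases opens_or_outer H y with ⟨v, hv⟩ | ho
    · rcases hv.1.eq_or_lt with rfl | hl
      · exact hv
      · have := hH.lt_of_opens hv
        exact absurd (rel_of_opens hH hv.self hv) (h v (by omega) hl)
    · exact absurd (rel_of_outer hH (hH.outer_sub ho) ho) (h _ (by omega) (by omega))
  · intro hy z h1 h2 hz
    have := (opens_of_rel hH hy (Setoid.symm' _ hz) (by omega) (by omega)).1
    omega

/-- The steps of a height function can be read off from the block sizes of its partition. -/
theorem openedSize_partition (y : ℤ) :
    openedSize (partition N H) (y : Pt N) = (H (y + 1) - H y + 1).toNat := by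
  have := hH.step y
  rw [openedSize]
  split_ifs with h
  · rw [isOpener_partition_iff hH, ← opens_self_iff] at h
    exact ncard_rel_of_opens_self hH h
  · rw [isOpener_partition_iff hH] at h
    omega

end

/-- The partition depends only on the steps of the height function. -/
theorem partition_congr {H' : ℤ → ℤ} (h : ∀ x, H (x + 1) - H x = H' (x + 1) - H' x) :
    partition N H = partition N H' := by
  obtain ⟨c, hc⟩ : ∃ c, ∀ x, H' x = H x + c := by
    refine ⟨H' 0 - H 0, fun x => ?_⟩
    induction x using Int.induction_on with
    | zero => ring
    | succ i ih => have := h i; linarith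
    | pred i ih => have := h (-i - 1); rw [sub_add_cancel] at this; linarith
  have ho (y x : ℤ) : Opens H' y x ↔ Opens H y x := by
    simp only [Opens, hc, add_le_add_iff_right, add_lt_add_iff_right]
  have hl : label (N := N) H = label H' := by
    funext a
    by_cases hex : ∃ y, Opens H y (a.val : ℤ)
    · have hex' : ∃ y, Opens H' y (a.val : ℤ) := hex.imp fun y => (ho y _).2
      rw [label, label, dif_pos hex, dif_pos hex',
        hex.choose_spec.unique ((ho _ _).1 hex'.choose_spec)]
    · rw [label, label, dif_neg hex, dif_neg fun h' => hex (h'.imp fun y => (ho y _).1)]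
  rw [partition, partition, hl]

/-- The height function with given block sizes `s x`, normalized by the value `0` at `0`. -/
def height (s : ℤ → ℕ) : ℤ → ℤ
  | Int.ofNat k => ∑ i ∈ Finset.range k, ((s i : ℤ) - 1)
  | Int.negSucc k => -∑ i ∈ Finset.range (k + 1), ((s (-(i + 1)) : ℤ) - 1)

theorem height_natCast (s : ℤ → ℕ) (k : ℕ) :
    height s k = ∑ i ∈ Finset.range k, ((s i : ℤ) - 1) := rfl

theorem height_succ (s : ℤ → ℕ) (x : ℤ) : height s (x + 1) = height s x + s x - 1 := by
  rcases x with k | k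
  · change height s ((k + 1 : ℕ) : ℤ) = height s (k : ℕ) + s k - 1
    rw [height_natCast, height_natCast, Finset.sum_range_succ]
    ring
  · cases k with
    | zero => simp [height]
    | succ k =>
      change height s (Int.negSucc k) = _
      simp only [height]
      rw [Finset.sum_range_succ _ (k + 1)]
      have : (Int.negSucc (k + 1)) = -(((k + 1 : ℕ) : ℤ) + 1) := by
        rw [Int.negSucc_eq]
      rw [this]
      ring

theorem isHeight_height {s : ℤ → ℕ} (hs : ∀ x, s (x + N) = s x)
    (hsum : ∑ i ∈ Finset.range N, s i ≤ N) : IsHeight N (height s) where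
  step x := by rw [height_succ]; omega
  per x := by
    have h0 : height s 0 = 0 := rfl
    rw [h0, sub_zero]
    induction x using Int.induction_on with
    | zero => simp [h0]
    | succ i ih =>
      rw [show (i : ℤ) + 1 + N = (i + N) + 1 by ring, height_succ, height_succ, ih, hs]
      ring
    | pred i ih =>
      have h1 := height_succ s (-i - 1)
      have h2 := height_succ s (-i - 1 + N)
      rw [sub_add_cancel] at h1
      rw [show -(i : ℤ) - 1 + N + 1 = -i + N by ring, hs] at h2
      linarith
  nonpos := by
    rw [height_natCast]
    have h0 : height s 0 = 0 := rfl
    rw [h0, Finset.sum_sub_distrib]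
    simp only [Finset.sum_const, Finset.card_range, nsmul_eq_mul, mul_one]
    have : (∑ i ∈ Finset.range N, (s i : ℤ)) = ((∑ i ∈ Finset.range N, s i : ℕ) : ℤ) := by
      push_cast; rfl
    rw [this]
    omega

end TypeB

/-! ### Symmetric non-crossing partitions are given by height functions -/

namespace TypeB

variable {N : ℕ}

theorem bar_intCast (x : ℤ) : bar (x : Pt N) = ((x + N : ℤ) : Pt N) := by simp [bar]

theorem IsSymmetric.add {π : Setoid (Pt N)} (h : IsSymmetric π) {x y : ℤ}
    (hxy : π (x : Pt N) (y : Pt N)) : π ((x + N : ℤ) : Pt N) ((y + N : ℤ) : Pt N) := by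
  rw [← bar_intCast, ← bar_intCast]
  exact h _ _ hxy

theorem IsSymmetric.sub {π : Setoid (Pt N)} (h : IsSymmetric π) {x y : ℤ}
    (hxy : π (x : Pt N) (y : Pt N)) : π ((x - N : ℤ) : Pt N) ((y - N : ℤ) : Pt N) := by
  have e (z : ℤ) : ((z - N : ℤ) : Pt N) = ((z + N : ℤ) : Pt N) := by
    rw [← intCast_add_two (z - N)]
    congr 1
    ring
  rw [e, e]
  exact h.add hxy

theorem val_intCast [NeZero N] {x : ℤ} (h0 : 0 ≤ x) (h1 : x < 2 * N) :
    ((x : Pt N).val : ℤ) = x := by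
  rw [ZMod.val_intCast]
  exact Int.emod_eq_of_lt h0 (by push_cast; exact h1)

/-- The non-crossing condition for four integers in cyclic order within one turn. -/
theorem IsNoncrossing.cross [NeZero N] {π : Setoid (Pt N)} (h : IsNoncrossing π) {a b c d : ℤ}
    (hab : a < b) (hbc : b < c) (hcd : c < d) (hda : d < a + 2 * N)
    (hac : π (a : Pt N) (c : Pt N)) (hbd : π (b : Pt N) (d : Pt N)) :
    π (a : Pt N) (b : Pt N) := by
  have h' : ∀ a b c d : ℤ, 0 ≤ a → a < b → b < c → c < d → d < 2 * N →
      π (a : Pt N) (c : Pt N) → π (b : Pt N) (d : Pt N) → π (a : Pt N) (b : Pt N) := by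
    intro a b c d h0 hab hbc hcd hd
    refine h _ _ _ _ ?_ ?_ ?_ <;>
    · zify
      rw [val_intCast (by omega) (by omega), val_intCast (by omega) (by omega)]
      assumption
  have key : ∀ a b c d : ℤ, 0 ≤ a → a < 2 * N → a < b → b < c → c < d → d < a + 2 * N →
      π (a : Pt N) (c : Pt N) → π (b : Pt N) (d : Pt N) → π (a : Pt N) (b : Pt N) := by
    intro a b c d h0 ha hab hbc hcd hda hac hbd
    rcases lt_or_ge d (2 * N) with hd | hd
    · exact h' a b c d h0 hab hbc hcd hd hac hbd
    · rw [← intCast_sub_two d] at hbd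
      rcases lt_or_ge c (2 * N) with hc | hc
      · exact Setoid.symm' _ (Setoid.trans' _ hbd (h' (d - 2 * N) a b c (by omega) (by omega)
          hab hbc hc (Setoid.symm' _ hbd) hac))
      · rw [← intCast_sub_two c] at hac
        rcases lt_or_ge b (2 * N) with hb | hb
        · exact Setoid.trans' _ (Setoid.trans' _ hac (h' (c - 2 * N) (d - 2 * N) a b (by omega)
            (by omega) (by omega) hab hb (Setoid.symm' _ hac) (Setoid.symm' _ hbd)))
            (Setoid.symm' _ hbd)
        · rw [← intCast_sub_two b] at hbd ⊢
          exact Setoid.trans' _ hac (Setoid.symm' _ (h' (b - 2 * N) (c - 2 * N) (d - 2 * N) a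
            (by omega) (by omega) (by omega) (by omega) ha hbd (Setoid.symm' _ hac)))
  obtain ⟨a', ha', h0, h1⟩ := exists_rep (a : Pt N) 0
  obtain ⟨k, hk⟩ := intCast_eq_intCast_iff.1 ha'
  have e (x : ℤ) : (x : Pt N) = ((x - k * (2 * N) : ℤ) : Pt N) :=
    intCast_eq_intCast_iff.2 ⟨-k, by ring⟩
  rw [e] at hac hbd ⊢
  rw [e b]
  rw [e c] at hac
  rw [e d] at hbd
  refine key _ _ _ _ ?_ ?_ ?_ ?_ ?_ ?_ hac hbd <;> linarith

/-- The block of `x` in `π` is a non-zero block with first element `y`, where the integer `y` is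
chosen in the half-turn that ends at `x`. -/
def FirstOf (π : Setoid (Pt N)) (y x : ℤ) : Prop :=
  IsOpener π (y : Pt N) ∧ y ≤ x ∧ x < y + N ∧ π (y : Pt N) (x : Pt N)

theorem FirstOf.unique {π : Setoid (Pt N)} {x y z : ℤ} (h : FirstOf π y x) (h' : FirstOf π z x) :
    y = z := by
  obtain ⟨h1, h2, h3, h4⟩ := h
  obtain ⟨h1', h2', h3', h4'⟩ := h'
  rw [isOpener_intCast] at h1 h1'
  have := Setoid.trans' _ h4 (Setoid.symm' _ h4')
  rcases lt_trichotomy y z with hl | hl | hl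
  · exact absurd this (h1' y (by omega) hl)
  · exact hl
  · exact absurd (Setoid.symm' _ this) (h1 z (by omega) hl)

theorem IsOpener.eq_of_rel [NeZero N] {π : Setoid (Pt N)} {a b : Pt N} (ha : IsOpener π a)
    (hb : IsOpener π b) (hab : π a b) : a = b := by
  obtain ⟨y, rfl⟩ := ZMod.intCast_surjective a
  obtain ⟨z, rfl, h1, h2⟩ := exists_rep b (y - N)
  rw [isOpener_intCast] at ha hb
  rcases lt_trichotomy y z with hl | hl | hl
  · exact absurd hab (hb y (by omega) hl)
  · rw [hl]
  · exact absurd (Setoid.symm' _ hab) (ha z (by omega) hl)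

section

variable {π : Setoid (Pt N)} (hn : IsNoncrossing π) (hs : IsSymmetric π)

include hs in
theorem not_rel_half_of_rel {x y : ℤ} (h : π (x : Pt N) (y : Pt N))
    (hx : ¬ π ((x - N : ℤ) : Pt N) (x : Pt N)) : ¬ π ((y - N : ℤ) : Pt N) (y : Pt N) := fun hy =>
  hx (Setoid.trans' _ (Setoid.trans' _ (hs.sub h) hy) (Setoid.symm' _ h))

variable [NeZero N]

include hn in
/-- A block which starts strictly between two elements of another block ends between them. -/
theorem FirstOf.lt_of_lt {x y t u : ℤ} (h : FirstOf π y x) (h1 : y < t) (h2 : t ≤ x)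
    (hu : FirstOf π t u) : u < x := by
  by_contra hc
  rcases (not_lt.1 hc).eq_or_lt with rfl | hl
  · exact h1.ne (h.unique hu)
  · obtain ⟨-, -, h5, h6⟩ := h
    obtain ⟨h7, h8, h9, h10⟩ := hu
    rw [isOpener_intCast] at h7
    refine h7 y (by omega) h1 ?_
    rcases h2.eq_or_lt with rfl | h2
    · exact h6
    · exact hn.cross h1 h2 hl (by omega) h6 h10

include hn hs

/-- A block which does not contain `x - N` together with `x` has a first element. -/
theorem exists_firstOf {x : ℤ} (hx : ¬ π ((x - N : ℤ) : Pt N) (x : Pt N)) :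
    ∃ y, FirstOf π y x := by
  have hN := NeZero.pos N
  obtain ⟨y, ⟨h1, h2, h3⟩, h4⟩ := Int.exists_least_of_bdd
    (P := fun z : ℤ => x - N < z ∧ z ≤ x ∧ π (z : Pt N) (x : Pt N))
    ⟨x - N, fun z hz => hz.1.le⟩ ⟨x, by omega, le_rfl, Setoid.refl' _ _⟩
  refine ⟨y, isOpener_intCast.2 fun z hz1 hz2 hz => ?_, h2, by omega, h3⟩
  have hzx := Setoid.trans' _ hz h3
  rcases lt_trichotomy z (x - N) with hl | rfl | hl
  · rcases hz1.eq_or_lt with rfl | hz1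
    · exact not_rel_half_of_rel hs (Setoid.symm' _ h3) hx hz
    · -- otherwise `z < x - N < y < z + N` are two pairs of related points which cross
      have h5 := hs.add (hs.add (hs.sub hzx))
      rw [sub_add_cancel, show x - N + N + N = x - N + 2 * N by ring, intCast_add_two] at h5
      have h6 := hn.cross (a := z) (b := x - N) (c := y) (d := z + N) hl h1 (by omega) (by omega) hz
        (Setoid.symm' _ h5)
      exact hx (Setoid.trans' _ (Setoid.symm' _ h6) hzx)
  · exact hx hzx
  · have := h4 z ⟨hl, by omega, hzx⟩
    omega

/-- The points under a non-zero block are in non-zero blocks which start under this block. -/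
theorem FirstOf.of_between {x y u : ℤ} (h : FirstOf π y x) (h1 : y ≤ u) (h2 : u ≤ x) :
    ∃ t, y ≤ t ∧ t ≤ u ∧ FirstOf π t u := by
  have hN := NeZero.pos N
  rcases h1.eq_or_lt with rfl | h1
  · exact ⟨y, le_rfl, le_rfl, h.1, le_rfl, by omega, Setoid.refl' _ _⟩
  rcases h2.eq_or_lt with rfl | h2
  · exact ⟨y, le_rfl, h1.le, h⟩
  obtain ⟨h3, h4, h5, h6⟩ := h
  rw [isOpener_intCast] at h3
  obtain ⟨t, ht⟩ := exists_firstOf hn hs (x := u) fun hu => by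
    have hu' := hs.add hu
    rw [sub_add_cancel] at hu'
    have := hn.cross (a := y) (b := u) (c := x) (d := u + N) h1 h2 (by omega) (by omega) h6 hu'
    exact not_rel_half_of_rel hs this (h3 (y - N) le_rfl (by omega)) hu
  refine ⟨t, ?_, ht.2.1, ht⟩
  by_contra hc
  have h7 := ht.2.2.1
  exact h3 t (by omega) (by omega) (hn.cross (a := t) (b := y) (c := u) (d := x) (by omega) h1 h2
    (by omega) ht.2.2.2 h6)

/-- A non-zero block which starts before a point of the zero block ends before this point. -/
theorem FirstOf.lt_of_zero {x t u : ℤ} (hx : π ((x - N : ℤ) : Pt N) (x : Pt N)) (h2 : t ≤ x)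
    (hu : FirstOf π t u) : u < x := by
  have hN := NeZero.pos N
  by_contra hc
  obtain ⟨h7, h8, h9, h10⟩ := hu
  rw [isOpener_intCast] at h7
  have h11 := h7 (t - N) le_rfl (by omega)
  have hx' := hs.add hx
  rw [sub_add_cancel] at hx'
  refine not_rel_half_of_rel hs (x := t) (y := x) ?_ h11 hx
  rcases (not_lt.1 hc).eq_or_lt with rfl | hl
  · exact h10
  rcases h2.eq_or_lt with rfl | h2
  · exact Setoid.refl' _ _
  · exact hn.cross h2 hl (by omega : u < x + N) (by omega) h10 hx'

/-- There is at most one zero block. -/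
theorem rel_of_zero {x y : ℤ} (hx : π ((x - N : ℤ) : Pt N) (x : Pt N))
    (hy : π ((y - N : ℤ) : Pt N) (y : Pt N)) : π (x : Pt N) (y : Pt N) := by
  have key : ∀ y : ℤ, x ≤ y → y < x + 2 * N → π ((y - N : ℤ) : Pt N) (y : Pt N) →
      π (x : Pt N) (y : Pt N) := by
    intro y h1 h2 hy
    have hx := hs.add hx
    have hy := hs.add hy
    rw [sub_add_cancel] at hx hy
    rcases h1.eq_or_lt with rfl | h1
    · exact Setoid.refl' _ _
    rcases lt_trichotomy y (x + N) with hl | rfl | hl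
    · exact hn.cross h1 hl (by omega : x + N < y + N) (by omega) hx hy
    · exact hx
    · refine Setoid.trans' _ hx (hn.cross (c := x + 2 * N) (d := y + N) hl h2 (by omega) (by omega)
        ?_ hy)
      rw [intCast_add_two]
      exact Setoid.symm' _ hx
  obtain ⟨y', hy', h1, h2⟩ := exists_rep (y : Pt N) x
  rw [← hy']
  refine key y' h1 h2 ?_
  rw [hy']
  have := hs.sub (x := y') (y := y) (by rw [hy'])
  exact Setoid.trans' _ this hy

end

/-! The height function of a partition is found by counting, in an interval, the elements of the
blocks which are opened there. -/

theorem height_sub_height (s : ℤ → ℕ) {x z : ℤ} (h : z ≤ x) :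
    height s x - height s z = ((∑ t ∈ Finset.Ico z x, s t : ℕ) : ℤ) - (x - z) := by
  induction x, h using Int.leInduction with
  | base => simp
  | succ x hx ih =>
    have : Finset.Ico z (x + 1) = insert x (Finset.Ico z x) := by
      ext t
      simp only [Finset.mem_Ico, Finset.mem_insert]
      omega
    rw [this, Finset.sum_insert (by simp), height_succ]
    push_cast at ih ⊢
    linarith

section

variable [NeZero N] {π : Setoid (Pt N)}

open Classical in
theorem openedSize_eq_card {t : ℤ} (ht : IsOpener π (t : Pt N)) :
    openedSize π (t : Pt N) = ((Finset.Ico t (t + N)).filter (FirstOf π t)).card := by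
  have hinj : Set.InjOn (fun u : ℤ => (u : Pt N))
      ((Finset.Ico t (t + N)).filter (FirstOf π t) : Set ℤ) := by
    intro u hu v hv huv
    simp only [Finset.coe_filter, Finset.mem_Ico, Set.mem_ofPred_eq] at hu hv
    exact eq_of_intCast_eq huv (by omega) (by omega)
  rw [openedSize, if_pos ht, ← Set.ncard_coe_finset, ← Set.InjOn.ncard_image hinj]
  congr 1
  ext a
  simp only [Finset.coe_filter, Finset.mem_Ico, Set.mem_ofPred_eq, Set.mem_image]
  constructor
  · intro ha
    obtain ⟨u, rfl, h1, h2⟩ := exists_rep a t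
    have hu : u < t + N := by
      by_contra hc
      refine isOpener_intCast.1 ht (u - 2 * N) (by omega) (by omega) ?_
      rw [intCast_sub_two]
      exact ha
    exact ⟨u, ⟨⟨h1, hu⟩, ht, h1, hu, Setoid.symm' _ ha⟩, rfl⟩
  · rintro ⟨u, ⟨-, -, -, -, hu⟩, rfl⟩
    exact Setoid.symm' _ hu

theorem sum_openedSize_le {z x : ℤ}
    (h : ∀ t u, z ≤ t → t ≤ x → FirstOf π t u → u < x) (hzx : z ≤ x) :
    ((∑ t ∈ Finset.Ico z (x + 1), openedSize π (t : Pt N) : ℕ) : ℤ) ≤ x - z := by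
  classical
  have h1 : ∀ t ∈ Finset.Ico z (x + 1), openedSize π (t : Pt N) ≤
      ((Finset.Ico z x).filter (FirstOf π t)).card := by
    intro t ht
    rw [Finset.mem_Ico] at ht
    by_cases hop : IsOpener π (t : Pt N)
    · rw [openedSize_eq_card hop]
      refine Finset.card_le_card fun u hu => ?_
      rw [Finset.mem_filter, Finset.mem_Ico] at hu ⊢
      exact ⟨⟨by omega, h t u ht.1 (by omega) hu.2⟩, hu.2⟩
    · rw [openedSize, if_neg hop]
      exact Nat.zero_le _
  have h2 := Finset.sum_le_sum h1
  rw [← Finset.card_biUnion fun t _ t' _ hne => Finset.disjoint_left.2 fun u hu hu' =>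
    hne ((Finset.mem_filter.1 hu).2.unique (Finset.mem_filter.1 hu').2)] at h2
  have h3 : ((Finset.Ico z (x + 1)).biUnion fun t => (Finset.Ico z x).filter (FirstOf π t)).card ≤
      (Finset.Ico z x).card :=
    Finset.card_le_card (Finset.biUnion_subset.2 fun t _ => Finset.filter_subset _ _)
  rw [Int.card_Ico] at h3
  omega

theorem le_sum_openedSize {z x : ℤ}
    (h : ∀ u, z ≤ u → u ≤ x → ∃ t, z ≤ t ∧ t ≤ u ∧ FirstOf π t u) (hzx : z ≤ x) :
    x + 1 - z ≤ ((∑ t ∈ Finset.Ico z (x + 1), openedSize π (t : Pt N) : ℕ) : ℤ) := by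
  classical
  have h1 : ∀ t ∈ Finset.Ico z (x + 1),
      ((Finset.Ico z (x + 1)).filter (FirstOf π t)).card ≤ openedSize π (t : Pt N) := by
    intro t ht
    by_cases hop : IsOpener π (t : Pt N)
    · rw [openedSize_eq_card hop]
      refine Finset.card_le_card fun u hu => ?_
      rw [Finset.mem_filter, Finset.mem_Ico] at hu ⊢
      exact ⟨⟨hu.2.2.1, hu.2.2.2.1⟩, hu.2⟩
    · rw [Finset.filter_false_of_mem fun u _ hu => hop hu.1]
      exact Nat.zero_le _
  have h2 := Finset.card_biUnion_le.trans (Finset.sum_le_sum h1)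
  have h3 : (Finset.Ico z (x + 1)).card ≤
      ((Finset.Ico z (x + 1)).biUnion fun t =>
        (Finset.Ico z (x + 1)).filter (FirstOf π t)).card := by
    refine Finset.card_le_card fun u hu => ?_
    have hu' := Finset.mem_Ico.1 hu
    obtain ⟨t, h4, h5, h6⟩ := h u hu'.1 (by omega)
    exact Finset.mem_biUnion.2 ⟨t, Finset.mem_Ico.2 ⟨h4, by omega⟩, Finset.mem_filter.2 ⟨hu, h6⟩⟩
  rw [Int.card_Ico] at h3
  omega

end

theorem sum_zmod {l : ℕ} [NeZero l] (f : ZMod l → ℕ) {k : ℕ} (hk : k = l) :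
    ∑ a, f a = ∑ i ∈ Finset.range k, f i := by
  subst hk
  refine Finset.sum_nbij' (fun a => a.val) (fun i => (i : ZMod k)) ?_ ?_ ?_ ?_ ?_
  · intro a _; exact Finset.mem_range.2 (ZMod.val_lt a)
  · simp
  · intro a _; simp
  · intro i hi; exact ZMod.val_cast_of_lt (Finset.mem_range.1 hi)
  · intro a _; simp

/-- Sums of functions which are invariant under `i ↦ -i`. -/
theorem sum_pt_of_bar [NeZero N] (f : Pt N → ℕ) (hf : ∀ a, f (bar a) = f a) :
    ∑ a, f a = 2 * ∑ i ∈ Finset.range N, f i := by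
  rw [sum_zmod f (two_mul N).symm, Finset.sum_range_add, two_mul (Finset.sum _ _)]
  congr 1
  refine Finset.sum_congr rfl fun i _ => ?_
  rw [← hf i, bar]
  push_cast
  rw [add_comm]

theorem bar_bar (a : Pt N) : bar (bar a) = a := by
  have := ZMod.natCast_self (2 * N)
  push_cast at this
  rw [bar, bar, add_assoc, ← two_mul, this, add_zero]

theorem IsSymmetric.bar_iff {π : Setoid (Pt N)} (hs : IsSymmetric π) {a b : Pt N} :
    π (bar a) (bar b) ↔ π a b := by
  refine ⟨fun h => ?_, hs a b⟩
  simpa only [bar_bar] using hs _ _ h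

theorem IsSymmetric.isOpener_bar_iff {π : Setoid (Pt N)} (hs : IsSymmetric π) (a : Pt N) :
    IsOpener π (bar a) ↔ IsOpener π a := by
  refine forall_congr' fun i => ?_
  have : bar a - (i : Pt N) = bar (a - (i : Pt N)) := by simp only [bar]; ring
  rw [this, hs.bar_iff]

theorem bar_injective : Function.Injective (bar (N := N)) := Function.LeftInverse.injective bar_bar

theorem IsSymmetric.bar_image {π : Setoid (Pt N)} (hs : IsSymmetric π) (a : Pt N) :
    bar '' {x | π x a} = {x | π x (bar a)} := by
  ext x
  simp only [Set.mem_ofPred_eq, Set.mem_image]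
  constructor
  · rintro ⟨y, hy, rfl⟩
    exact hs.bar_iff.2 hy
  · intro h
    exact ⟨bar x, by rwa [← hs.bar_iff, bar_bar], bar_bar x⟩

theorem IsSymmetric.openedSize_bar {π : Setoid (Pt N)} (hs : IsSymmetric π) (a : Pt N) :
    openedSize π (bar a) = openedSize π a := by
  by_cases h : IsOpener π a
  · rw [openedSize, openedSize, if_pos h, if_pos ((hs.isOpener_bar_iff a).2 h),
      ← hs.bar_image, Set.ncard_image_of_injective _ bar_injective]
  · rw [openedSize, openedSize, if_neg h, if_neg (mt (hs.isOpener_bar_iff a).1 h)]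

theorem sum_openedSize_univ_le [NeZero N] (π : Setoid (Pt N)) :
    ∑ a, openedSize π a ≤ 2 * N := by
  classical
  have h : ∀ a ∈ (Finset.univ : Finset (Pt N)), openedSize π a =
      (Finset.univ.filter fun x => π x a ∧ IsOpener π a).card := by
    intro a _
    rw [openedSize]
    split_ifs with ho
    · rw [← Set.ncard_coe_finset]
      congr 1
      ext x
      simp [ho]
    · simp [ho]
  rw [Finset.sum_congr rfl h, ← Finset.card_biUnion]
  · refine (Finset.card_le_univ _).trans ?_
    rw [ZMod.card]
  · intro a _ b _ hne
    refine Finset.disjoint_left.2 fun x hx hx' => hne ?_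
    simp only [Finset.mem_filter] at hx hx'
    exact hx.2.2.eq_of_rel hx'.2.2 (Setoid.trans' _ (Setoid.symm' _ hx.2.1) hx'.2.1)

/-- The height function of a partition. -/
noncomputable def heightOf (π : Setoid (Pt N)) : ℤ → ℤ := height fun x => openedSize π (x : Pt N)

section

variable [NeZero N] {π : Setoid (Pt N)} (hn : IsNoncrossing π) (hs : IsSymmetric π)

include hs in
theorem isHeight_heightOf : IsHeight N (heightOf π) := by
  refine isHeight_height (fun x => ?_) ?_
  · rw [← bar_intCast, hs.openedSize_bar]
  · have h1 := sum_openedSize_univ_le π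
    rw [sum_pt_of_bar _ hs.openedSize_bar] at h1
    simp only [Int.cast_natCast]
    omega

include hn hs

theorem FirstOf.opens {x y : ℤ} (h : FirstOf π y x) : Opens (heightOf π) y x := by
  have h0 := h.2.1
  refine ⟨h0, ?_, fun z h1 h2 => ?_⟩
  · have h1 := height_sub_height (fun x => openedSize π (x : Pt N)) (x := x + 1) (z := y) (by omega)
    have h2 := le_sum_openedSize (π := π) (z := y) (x := x)
      (fun u hu1 hu2 => FirstOf.of_between hn hs h hu1 hu2) h0
    rw [heightOf]
    linarith
  · have h3 := height_sub_height (fun x => openedSize π (x : Pt N)) (x := x + 1) (z := z) (by omega)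
    have h4 := sum_openedSize_le (π := π) (z := z) (x := x)
      (fun t u ht1 ht2 hu => FirstOf.lt_of_lt hn h (by omega) ht2 hu) h2
    rw [heightOf]
    linarith

theorem outer_heightOf {x : ℤ} (h : π ((x - N : ℤ) : Pt N) (x : Pt N)) :
    Outer (heightOf π) x := by
  intro z h2
  have h3 := height_sub_height (fun x => openedSize π (x : Pt N)) (x := x + 1) (z := z) (by omega)
  have h4 := sum_openedSize_le (π := π) (z := z) (x := x)
    (fun t u ht1 ht2 hu => FirstOf.lt_of_zero hn hs h ht2 hu) h2
  rw [heightOf]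
  linarith

/-- A symmetric non-crossing partition can be recovered from the sizes of its non-zero blocks and
their first elements. -/
theorem partition_heightOf : partition N (heightOf π) = π := by
  have hH := isHeight_heightOf hs
  have hzero : ∀ {x y : ℤ}, FirstOf π y x → ¬ π ((x - N : ℤ) : Pt N) (x : Pt N) := fun h hx =>
    (FirstOf.opens hn hs h).not_outer (outer_heightOf hn hs hx)
  ext a b
  obtain ⟨x, rfl⟩ := ZMod.intCast_surjective a
  obtain ⟨x', rfl⟩ := ZMod.intCast_surjective b
  by_cases hx : π ((x - N : ℤ) : Pt N) (x : Pt N)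
  · by_cases hx' : π ((x' - N : ℤ) : Pt N) (x' : Pt N)
    · exact iff_of_true (rel_of_outer hH (outer_heightOf hn hs hx) (outer_heightOf hn hs hx'))
        (rel_of_zero hn hs hx hx')
    · obtain ⟨y', hy'⟩ := exists_firstOf hn hs hx'
      refine iff_of_false (fun h => not_rel_of_opens_of_outer hH (FirstOf.opens hn hs hy')
        (outer_heightOf hn hs hx) (Setoid.symm' _ h)) fun h => ?_
      exact not_rel_half_of_rel hs (Setoid.symm' _ h) hx' hx
  · obtain ⟨y, hy⟩ := exists_firstOf hn hs hx
    by_cases hx' : π ((x' - N : ℤ) : Pt N) (x' : Pt N)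
    · refine iff_of_false (not_rel_of_opens_of_outer hH (FirstOf.opens hn hs hy)
        (outer_heightOf hn hs hx')) fun h => ?_
      exact not_rel_half_of_rel hs h hx hx'
    · obtain ⟨y', hy'⟩ := exists_firstOf hn hs hx'
      rw [rel_iff_of_opens hH (FirstOf.opens hn hs hy) (FirstOf.opens hn hs hy')]
      constructor
      · intro h
        have h1 := hy.2.2.2
        rw [h] at h1
        exact Setoid.trans' _ (Setoid.symm' _ h1) hy'.2.2.2
      · intro h
        exact hy.1.eq_of_rel hy'.1 (Setoid.trans' _ hy.2.2.2
          (Setoid.trans' _ h (Setoid.symm' _ hy'.2.2.2)))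

end

end TypeB

/-! ### Moving an opener across its predecessor -/

namespace TypeB

variable {N : ℕ}

/-- The rotation of a height function corresponds to the rotation of the partition. -/
theorem partition_comp_sub_one [NeZero N] {H : ℤ → ℤ} (hH : IsHeight N H)
    (hH' : IsHeight N fun x => H (x - 1)) :
    partition N (fun x => H (x - 1)) = Setoid.comap (fun a => a - 1) (partition N H) := by
  have ho {x y : ℤ} (h : Opens H y (x - 1)) : Opens (fun x => H (x - 1)) (y + 1) x := by
    refine ⟨by have := h.1; omega, ?_, fun z h1 h2 => ?_⟩
    · have := h.2.1
      simpa using this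
    · have := h.2.2 (z - 1) (by omega) (by omega)
      simpa using this
  have hz {x : ℤ} (h : Outer H (x - 1)) : Outer (fun x => H (x - 1)) x := by
    intro y hy
    have := h (y - 1) (by omega)
    simpa using this
  have e (x : ℤ) : (x : Pt N) - 1 = ((x - 1 : ℤ) : Pt N) := by push_cast; rfl
  have hl (a : Pt N) : label (fun x => H (x - 1)) a = (label H (a - 1)).map (· + 1) := by
    obtain ⟨x, rfl⟩ := ZMod.intCast_surjective a
    rw [e]
    rcases opens_or_outer H (x - 1) with ⟨y, hy⟩ | hx
    · rw [label_of_opens hH hy, label_of_opens hH' (ho hy)]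
      simp
    · rw [label_of_outer hH hx, label_of_outer hH' (hz hx)]
      simp
  ext a b
  rw [Setoid.comap_rel, partition, partition, Setoid.ker_def, Setoid.ker_def, hl, hl]
  exact (Option.map_injective (add_left_injective 1)).eq_iff

/-- The height function in which the opener at the point `-1` is moved to the point `0`, if no block
is opened at `0` by `H`, and likewise for the `N`-periodic translates of these points. -/
def moveOpener (N : ℕ) (H : ℤ → ℤ) (x : ℤ) : ℤ := if (N : ℤ) ∣ x then H (x - 1) - 1 else H x

theorem moveOpener_of_dvd {H : ℤ → ℤ} {x : ℤ} (h : (N : ℤ) ∣ x) :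
    moveOpener N H x = H (x - 1) - 1 := if_pos h

theorem moveOpener_zero {H : ℤ → ℤ} : moveOpener N H 0 = H (-1) - 1 := if_pos (dvd_zero _)

theorem moveOpener_of_not_dvd {H : ℤ → ℤ} {x : ℤ} (h : ¬ (N : ℤ) ∣ x) :
    moveOpener N H x = H x := if_neg h

theorem not_dvd_of_pos_of_lt {x : ℤ} (h0 : 0 < x) (h1 : x < N) : ¬ (N : ℤ) ∣ x := fun h => by
  have := Int.le_of_dvd h0 h
  omega

theorem not_dvd_of_neg_of_lt {x : ℤ} (h0 : x < 0) (h1 : -N < x) : ¬ (N : ℤ) ∣ x := fun h =>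
  not_dvd_of_pos_of_lt (N := N) (x := -x) (by omega) (by omega) ((dvd_neg).2 h)

section

variable {H : ℤ → ℤ} (hH : IsHeight N H) (hN : 2 ≤ N) (h0 : H 1 = H 0 - 1)
include hH hN h0

theorem isHeight_moveOpener : IsHeight N (moveOpener N H) := by
  have hdvd (x : ℤ) (h : (N : ℤ) ∣ x) : H (x + 1) = H x - 1 := by
    obtain ⟨k, rfl⟩ := h
    have h1 := hH.per_mul 0 k
    have h2 := hH.per_mul 1 k
    rw [mul_comm, add_comm (k * (N : ℤ)) 1]
    rw [zero_add] at h1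
    linarith
  have hper (x : ℤ) : moveOpener N H (x + N) = moveOpener N H x + (H N - H 0) := by
    by_cases h : (N : ℤ) ∣ x
    · rw [moveOpener_of_dvd h, moveOpener_of_dvd (dvd_add h dvd_rfl),
        show x + N - 1 = x - 1 + N by ring, hH.per]
      ring
    · rw [moveOpener_of_not_dvd h, moveOpener_of_not_dvd (by rwa [dvd_add_left dvd_rfl]), hH.per]
  have hNN : moveOpener N H N = moveOpener N H 0 + (H N - H 0) := by
    have := hper 0
    rwa [zero_add] at this
  refine ⟨fun x => ?_, fun x => by rw [hper, hNN]; ring, by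
    rw [hNN]; have := hH.nonpos; omega⟩
  by_cases h : (N : ℤ) ∣ x
  · have h1 : ¬ (N : ℤ) ∣ x + 1 := fun h' => by
      have := Int.le_of_dvd one_pos ((dvd_add_right h).1 h')
      omega
    rw [moveOpener_of_dvd h, moveOpener_of_not_dvd h1]
    have h2 := hH.step (x - 1)
    rw [sub_add_cancel] at h2
    have := hdvd x h
    omega
  · by_cases h1 : (N : ℤ) ∣ x + 1
    · rw [moveOpener_of_dvd h1, moveOpener_of_not_dvd h, add_sub_cancel_right]
      omega
    · rw [moveOpener_of_not_dvd h, moveOpener_of_not_dvd h1]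
      exact hH.step x

end

/-- The point `b` is the first one from `0` on which is not in a block opened at one of the points
`-1, 0, …, b`; if there is none before `N - 1`, then `b = N - 1`. In the latter case there is no
zero block. -/
structure IsTurn (N : ℕ) (H : ℤ → ℤ) (b : ℤ) : Prop where
  nonneg : 0 ≤ b
  lt : b < N
  le : ∀ z, -1 ≤ z → z ≤ b → H (-1) ≤ H z
  eq : b < N - 1 → H (b + 1) = H (-1) - 1
  per : b = N - 1 → H N = H 0

theorem exists_isTurn [NeZero N] {H : ℤ → ℤ} (hH : IsHeight N H) (h : H (-1) ≤ H 0) :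
    ∃ b, IsTurn N H b := by
  have hN := NeZero.pos N
  obtain ⟨b, ⟨h1, h2⟩, h3⟩ := Int.exists_least_of_bdd
    (P := fun x : ℤ => 0 ≤ x ∧ (H (x + 1) < H (-1) ∨ x = N - 1))
    ⟨0, fun z hz => hz.1⟩ ⟨N - 1, by omega, Or.inr rfl⟩
  have hlt : b < N := by
    have := h3 (N - 1) ⟨by omega, Or.inr rfl⟩
    omega
  have hle : ∀ z, -1 ≤ z → z ≤ b → H (-1) ≤ H z := by
    intro z hz1 hz2
    rcases lt_trichotomy z 0 with hz | rfl | hz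
    · rw [show z = -1 by omega]
    · exact h
    · by_contra hc
      have := h3 (z - 1) ⟨by omega, Or.inl (by rw [sub_add_cancel]; omega)⟩
      omega
  refine ⟨b, h1, hlt, hle, fun hb => ?_, fun hb => ?_⟩
  · have := hle b (by omega) le_rfl
    have := hH.step b
    omega
  · have h4 := hle b (by omega) le_rfl
    have h5 := hH.per (-1)
    rw [hb, sub_eq_add_neg, add_comm] at h4
    have := hH.nonpos
    omega

/-- The exchange of `A` with `b`, and of their antipodes. -/
def exchange (A b z : Pt N) : Pt N :=
  if z = A then b else if z = b then A else if z = bar A then bar b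
  else if z = bar b then bar A else z

theorem bar_ne [NeZero N] (a : Pt N) : bar a ≠ a := by
  obtain ⟨x, rfl⟩ := ZMod.intCast_surjective a
  have := NeZero.pos N
  rw [bar_intCast]
  intro h
  have := eq_of_intCast_eq h (by omega) (by omega)
  omega

theorem eq_bar_iff {a b : Pt N} : a = bar b ↔ bar a = b :=
  ⟨fun h => by rw [h, bar_bar], fun h => by rw [← h, bar_bar]⟩

theorem intCast_ne {x y : ℤ} (h : x ≠ y) (h1 : x < y + 2 * N) (h2 : y < x + 2 * N) :
    (x : Pt N) ≠ y := fun he => h (eq_of_intCast_eq he h1 h2)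

theorem intCast_ne_bar {x y : ℤ} (h1 : x < y + N) (h2 : y < x + N) :
    (x : Pt N) ≠ bar (y : Pt N) := by
  rw [bar_intCast]
  exact intCast_ne (by omega) (by omega) (by omega)

theorem exchange_bar [NeZero N] {A b : Pt N} (h : A ≠ b) (z : Pt N) :
    exchange A b (bar z) = bar (exchange A b z) := by
  have e2 := bar_ne b
  have e3 := bar_ne A
  have e4 := @bar_bar N
  have e5 := @bar_injective N
  unfold exchange
  by_cases hb : bar b = A
  · grind
  · grind

theorem exchange_exchange [NeZero N] {A b : Pt N} (h : A ≠ b) (z : Pt N) :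
    exchange A b (exchange A b z) = z := by
  have e2 := bar_ne b
  have e3 := bar_ne A
  have e4 := @bar_bar N
  have e5 := @bar_injective N
  unfold exchange
  grind

theorem label_bar [NeZero N] {H : ℤ → ℤ} (hH : IsHeight N H) (a : Pt N) :
    label H (bar a) = (label H a).map bar := by
  obtain ⟨x, rfl⟩ := ZMod.intCast_surjective a
  rw [bar_intCast]
  rcases opens_or_outer H x with ⟨y, hy⟩ | hx
  · rw [label_of_opens hH hy, label_of_opens hH (hH.opens_add hy), Option.map_some, bar_intCast]
  · rw [label_of_outer hH hx, label_of_outer hH (hH.outer_add hx), Option.map_none]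

/-- The effect of `moveOpener` on the first elements of the blocks. -/
def moveLabel (N : ℕ) (y : Pt N) : Pt N :=
  if y = ((-1 : ℤ) : Pt N) ∨ y = bar ((-1 : ℤ) : Pt N) then y + 1 else y

theorem moveLabel_bar (y : Pt N) : moveLabel N (bar y) = bar (moveLabel N y) := by
  have e4 := @bar_bar N
  have e : bar y + 1 = bar (y + 1) := by simp only [bar]; ring
  unfold moveLabel
  grind

theorem label_ne_zero [NeZero N] {H : ℤ → ℤ} (hH : IsHeight N H) (h0 : H 1 = H 0 - 1) (a : Pt N) :
    label H a ≠ some ((0 : ℤ) : Pt N) ∧ label H a ≠ some (bar ((0 : ℤ) : Pt N)) := by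
  obtain ⟨x, rfl⟩ := ZMod.intCast_surjective a
  rcases opens_or_outer H x with ⟨y, hy⟩ | ho
  · rw [label_of_opens hH hy]
    have key : ∀ k : ℤ, y ≠ k * N := by
      rintro k rfl
      have h1 := hy.self.2.1
      have h2 := hH.per_mul 0 k
      have h3 := hH.per_mul 1 k
      rw [add_comm] at h3
      rw [zero_add] at h2
      omega
    constructor <;> intro h <;> rw [Option.some_inj] at h
    · obtain ⟨k, hk⟩ := intCast_eq_intCast_iff.1 h.symm
      exact key (2 * k) (by rw [hk]; ring)
    · rw [bar_intCast] at h
      obtain ⟨k, hk⟩ := intCast_eq_intCast_iff.1 h.symm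
      exact key (2 * k + 1) (by rw [hk]; ring)
  · rw [label_of_outer hH ho]
    simp

section

variable [NeZero N] {H : ℤ → ℤ} (hH : IsHeight N H) (hN : 2 ≤ N) (h0 : H 1 = H 0 - 1)
  {b : ℤ} (hb : IsTurn N H b)
include hH hN h0 hb

/-- Only the two points `-1` and `b` change their blocks: in the modified height function, the
point `-1` is found where `b` was, and `b` is the last element of the block opened at `0`. -/
theorem label_moveOpener_of_lt {x : ℤ} (hx1 : -1 ≤ x) (hx2 : x < N - 1) :
    label (moveOpener N H) (x : Pt N) =
      (label H (exchange ((-1 : ℤ) : Pt N) (b : Pt N) (x : Pt N))).map (moveLabel N) := by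
  have hH0 := isHeight_moveOpener hH hN h0
  obtain ⟨hb1, hb2, hb3, hb4, hb5⟩ := hb
  have ml1 : moveLabel N ((-1 : ℤ) : Pt N) = ((0 : ℤ) : Pt N) := by simp [moveLabel]
  have ml2 : ∀ y : ℤ, -N - 1 < y → y < N - 1 → y ≠ -1 → moveLabel N (y : Pt N) = y := by
    intro y h1 h2 h3
    refine if_neg ?_
    rintro (h | h)
    · exact h3 (eq_of_intCast_eq h (by omega) (by omega))
    · rw [bar_intCast] at h
      have := eq_of_intCast_eq h (by omega) (by omega)
      omega
  have mv : ∀ z : ℤ, -N < z → z < N → z ≠ 0 → moveOpener N H z = H z := by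
    intro z h1 h2 h3
    refine moveOpener_of_not_dvd ?_
    rcases lt_or_gt_of_ne h3 with h | h
    · exact not_dvd_of_neg_of_lt h h1
    · exact not_dvd_of_pos_of_lt h h2
  have hop : H (-1) ≤ H 0 := hb3 0 (by omega) hb1
  have hop1 : Opens H (-1) (-1) := opens_self_iff.2 hop
  have hnd (j : ℤ) (hj : j ≤ 0) : H (-1) ≤ H (j * N - 1) := by
    have h1 := hH.per_mul (-1) j
    have := hH.nonpos
    rw [show j * (N : ℤ) - 1 = -1 + j * N by ring, h1]
    nlinarith
  rcases hx1.eq_or_lt with rfl | hx1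
  · -- the point `-1` takes the place of `b`
    have he : exchange ((-1 : ℤ) : Pt N) (b : Pt N) ((-1 : ℤ) : Pt N) = (b : Pt N) := if_pos rfl
    rw [he]
    rcases lt_or_ge b (N - 1) with hbN | hbN
    · have hb4 := hb4 hbN
      rcases opens_or_outer H b with ⟨y, hy⟩ | ho
      · have hyb := hH.lt_of_opens hy
        have hy1 : y < -1 := by
          by_contra hc
          have := hb3 y (by omega) hy.1
          have := hy.2.1
          omega
        have : Opens (moveOpener N H) y (-1) := by
          refine ⟨by omega, ?_, fun z h1 h2 => ?_⟩
          · rw [mv y (by omega) (by omega) (by omega), neg_add_cancel, moveOpener_zero]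
            have := hy.2.1
            omega
          · rw [mv z (by omega) (by omega) (by omega), neg_add_cancel, moveOpener_zero]
            have := hy.2.2 z h1 (by omega)
            omega
        rw [label_of_opens hH hy, label_of_opens hH0 this, Option.map_some,
          ml2 y (by omega) (by omega) (by omega)]
      · have : Outer (moveOpener N H) (-1) := by
          intro y hy
          rw [neg_add_cancel, moveOpener_zero]
          by_cases hd : (N : ℤ) ∣ y
          · rw [moveOpener_of_dvd hd]
            obtain ⟨j, rfl⟩ := hd
            have hj : j < 0 := by nlinarith
            have h1 := hH.per_mul (-1) j
            have h2 := hH.per_mul (b + 1) j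
            have h3 := ho (b + 1 + j * N) (by nlinarith)
            rw [show (N : ℤ) * j - 1 = -1 + j * N by ring]
            omega
          · rw [moveOpener_of_not_dvd hd]
            have := ho y (by omega)
            omega
        rw [label_of_outer hH ho, label_of_outer hH0 this, Option.map_none]
    · -- the block opened at `N - 1` in `H` contains the point `-1` afterwards
      obtain rfl : b = N - 1 := by omega
      have hD := hb5 rfl
      have hperiod (z : ℤ) : H (z + N) = H z := by rw [hH.per, hD]; ring
      have h1 : Opens H (N - 1) (N - 1) := by
        have := hH.opens_add hop1
        rwa [show (-1 : ℤ) + N = N - 1 by ring] at this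
      have h2 : Opens (moveOpener N H) (-N) (-1) := by
        refine ⟨by omega, ?_, fun z h3 h4 => ?_⟩
        · rw [neg_add_cancel, moveOpener_zero, moveOpener_of_dvd (by simp), ← hperiod (-N - 1)]
          rw [show -(N : ℤ) - 1 + N = -1 by ring]
        · rw [mv z (by omega) (by omega) (by omega), neg_add_cancel, moveOpener_zero, ← hperiod z]
          have := hb3 (z + N) (by omega) (by omega)
          omega
      rw [label_of_opens hH h1, label_of_opens hH0 h2, Option.map_some]
      have : moveLabel N ((N - 1 : ℤ) : Pt N) = ((N - 1 : ℤ) : Pt N) + 1 := by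
        refine if_pos (Or.inr ?_)
        rw [bar_intCast]
        congr 1
      rw [this, ← intCast_add_two (-N)]
      congr 1
      push_cast
      ring
  · rcases eq_or_ne x b with rfl | hxb
    · -- the point `b` takes the place of `-1`
      have he : exchange ((-1 : ℤ) : Pt N) (x : Pt N) (x : Pt N) = ((-1 : ℤ) : Pt N) := by
        rw [exchange, if_neg (intCast_ne (by omega) (by omega) (by omega)), if_pos rfl]
      have h1 : Opens (moveOpener N H) 0 x := by
        refine ⟨by omega, ?_, fun z h1 h2 => ?_⟩
        · rw [moveOpener_zero, mv (x + 1) (by omega) (by omega) (by omega), hb4 hx2]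
        · rw [mv z (by omega) (by omega) (by omega), mv (x + 1) (by omega) (by omega) (by omega),
            hb4 hx2]
          have := hb3 z (by omega) h2
          omega
      rw [he, label_of_opens hH hop1, label_of_opens hH0 h1, Option.map_some, ml1]
    · have he : exchange ((-1 : ℤ) : Pt N) (b : Pt N) (x : Pt N) = (x : Pt N) := by
        rw [exchange, if_neg (intCast_ne (by omega) (by omega) (by omega)),
          if_neg (intCast_ne (by omega) (by omega) (by omega)), if_neg, if_neg]
        · exact intCast_ne_bar (by omega) (by omega)
        · rw [bar_intCast]
          exact intCast_ne (by omega) (by omega) (by omega)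
      rw [he]
      rcases opens_or_outer H x with ⟨y, hy⟩ | ho
      · have hy1 := hH.lt_of_opens hy
        have hy2 := hy.1
        rcases eq_or_ne y (-1) with rfl | hne
        · have h1 : Opens (moveOpener N H) 0 x := by
            refine ⟨by omega, ?_, fun z h1 h2 => ?_⟩
            · rw [moveOpener_zero, mv (x + 1) (by omega) (by omega) (by omega)]
              have := hy.2.1
              omega
            · rw [mv z (by omega) (by omega) (by omega),
                mv (x + 1) (by omega) (by omega) (by omega)]
              exact hy.2.2 z (by omega) h2
          rw [label_of_opens hH hy, label_of_opens hH0 h1, Option.map_some, ml1]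
        · have hy3 : y ≠ 0 := by
            rintro rfl
            have := hy.self.2.1
            rw [zero_add] at this
            omega
          have h1 : Opens (moveOpener N H) y x := by
            refine ⟨hy.1, ?_, fun z h1 h2 => ?_⟩
            · rw [mv y (by omega) (by omega) hy3, mv (x + 1) (by omega) (by omega) (by omega)]
              exact hy.2.1
            · rw [mv (x + 1) (by omega) (by omega) (by omega)]
              have h3 := hy.2.2 z h1 h2
              rcases eq_or_ne z 0 with rfl | hz
              · -- here `x` is not the first point below the height of `-1`
                rw [moveOpener_zero]
                have h4 := hy.2.2 (-1) (by omega) (by omega)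
                rcases lt_or_gt_of_ne hxb with hl | hl
                · have := hb3 (x + 1) (by omega) (by omega)
                  omega
                · have h5 := hy.2.2 (b + 1) (by omega) (by omega)
                  have := hb4 (by omega)
                  omega
              · rw [mv z (by omega) (by omega) hz]
                exact h3
          rw [label_of_opens hH hy, label_of_opens hH0 h1, Option.map_some,
            ml2 y (by omega) (by omega) hne]
      · have h1 : Outer (moveOpener N H) x := by
          intro y hy
          rw [mv (x + 1) (by omega) (by omega) (by omega)]
          by_cases hd : (N : ℤ) ∣ y
          · rw [moveOpener_of_dvd hd]
            obtain ⟨j, rfl⟩ := hd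
            have hj : j ≤ 0 := by nlinarith
            have h2 := hnd j hj
            rw [mul_comm j] at h2
            have h3 := ho (-1) (by omega)
            rcases lt_or_gt_of_ne hxb with hl | hl
            · have := hb3 (x + 1) (by omega) (by omega)
              omega
            · have h5 := ho (b + 1) (by omega)
              have := hb4 (by omega)
              omega
          · rw [moveOpener_of_not_dvd hd]
            exact ho y hy
        rw [label_of_outer hH ho, label_of_outer hH0 h1, Option.map_none]

theorem label_moveOpener (a : Pt N) :
    label (moveOpener N H) a =
      (label H (exchange ((-1 : ℤ) : Pt N) (b : Pt N) a)).map (moveLabel N) := by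
  obtain ⟨x, rfl, h1, h2⟩ := exists_rep a (-1)
  rcases lt_or_ge x (N - 1) with h | h
  · exact label_moveOpener_of_lt hH hN h0 hb h1 h
  · have h3 := label_moveOpener_of_lt hH hN h0 hb (x := x - N) (by omega) (by omega)
    have e : (x : Pt N) = bar ((x - N : ℤ) : Pt N) := by rw [bar_intCast, sub_add_cancel]
    have hAb : ((-1 : ℤ) : Pt N) ≠ b := by
      have := hb.nonneg
      have := hb.lt
      exact intCast_ne (by omega) (by omega) (by omega)
    rw [e, label_bar (isHeight_moveOpener hH hN h0), h3, exchange_bar hAb,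
      label_bar hH, Option.map_map, Option.map_map]
    congr 1
    funext y
    exact (moveLabel_bar y).symm

/-- Moving an opener from `-1` to `0` amounts to exchanging two points and their antipodes. -/
theorem partition_moveOpener :
    partition N (moveOpener N H) =
      Setoid.comap (exchange ((-1 : ℤ) : Pt N) (b : Pt N)) (partition N H) := by
  ext a c
  rw [Setoid.comap_rel, partition, partition, Setoid.ker_def, Setoid.ker_def,
    label_moveOpener hH hN h0 hb, label_moveOpener hH hN h0 hb]
  have h1 := label_ne_zero hH h0 (exchange ((-1 : ℤ) : Pt N) (b : Pt N) a)
  have h2 := label_ne_zero hH h0 (exchange ((-1 : ℤ) : Pt N) (b : Pt N) c)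
  have e1 : ((-1 : ℤ) : Pt N) + 1 = ((0 : ℤ) : Pt N) := by simp
  have e2 : bar ((-1 : ℤ) : Pt N) + 1 = bar ((0 : ℤ) : Pt N) := by simp [bar]
  have e3 := bar_ne ((-1 : ℤ) : Pt N)
  generalize label H (exchange ((-1 : ℤ) : Pt N) (b : Pt N) a) = u at *
  generalize label H (exchange ((-1 : ℤ) : Pt N) (b : Pt N) c) = v at *
  cases u with
  | none => cases v <;> simp
  | some u =>
    cases v with
    | none => simp
    | some v =>
      simp only [Option.map_some, Option.some_inj, ne_eq] at *
      refine ⟨fun h => ?_, fun h => by rw [h]⟩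
      unfold moveLabel at h
      have := add_left_injective (1 : Pt N)
      grind

end

end TypeB

/-! ### Successors and predecessors in a block -/

namespace TypeB

variable {N : ℕ}

theorem natCast_two_mul_self : ((2 * N : ℕ) : Pt N) = 0 := ZMod.natCast_self (2 * N)

theorem link_apply (u v : Pt N) (f : Pt N → Pt N) (x : Pt N) :
    link u v f x = if x = bar u then bar v else if x = u then v else f x := by
  simp only [link, Function.update_apply]

section

variable [NeZero N] (π : Setoid (Pt N))

theorem next_set_nonempty (x : Pt N) : {k : ℕ | 0 < k ∧ π x (x + (k : Pt N))}.Nonempty :=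
  ⟨2 * N, by have := NeZero.pos N; omega, by
    rw [natCast_two_mul_self, add_zero]⟩

theorem prev_set_nonempty (x : Pt N) : {k : ℕ | 0 < k ∧ π x (x - (k : Pt N))}.Nonempty :=
  ⟨2 * N, by have := NeZero.pos N; omega, by
    rw [natCast_two_mul_self, sub_zero]⟩

theorem rel_next (x : Pt N) : π x (next π x) := (Nat.sInf_mem (next_set_nonempty π x)).2

theorem rel_prev (x : Pt N) : π x (prev π x) := (Nat.sInf_mem (prev_set_nonempty π x)).2

theorem prev_next (x : Pt N) : prev π (next π x) = x := by
  have h1 := Nat.sInf_mem (next_set_nonempty π x)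
  have h2 : sInf {k : ℕ | 0 < k ∧ π (next π x) (next π x - (k : Pt N))} =
      sInf {k : ℕ | 0 < k ∧ π x (x + (k : Pt N))} := by
    apply le_antisymm
    · refine Nat.sInf_le ⟨h1.1, ?_⟩
      rw [next, add_sub_cancel_right]
      exact Setoid.symm' _ h1.2
    · refine le_csInf (prev_set_nonempty π _) fun j hj => ?_
      by_contra hc
      have hlt := not_le.1 hc
      have h0 := hj.1
      refine absurd (Nat.sInf_le (s := {k : ℕ | 0 < k ∧ π x (x + (k : Pt N))})
        (m := sInf {k : ℕ | 0 < k ∧ π x (x + (k : Pt N))} - j) ⟨by omega, ?_⟩) (by omega)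
      rw [Nat.cast_sub hlt.le, add_sub]
      exact Setoid.trans' _ (rel_next π x) hj.2
  rw [prev, h2, next, add_sub_cancel_right]

theorem next_prev (x : Pt N) : next π (prev π x) = x := by
  have h1 := Nat.sInf_mem (prev_set_nonempty π x)
  have h2 : sInf {k : ℕ | 0 < k ∧ π (prev π x) (prev π x + (k : Pt N))} =
      sInf {k : ℕ | 0 < k ∧ π x (x - (k : Pt N))} := by
    apply le_antisymm
    · refine Nat.sInf_le ⟨h1.1, ?_⟩
      rw [prev, sub_add_cancel]
      exact Setoid.symm' _ h1.2
    · refine le_csInf (next_set_nonempty π _) fun j hj => ?_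
      by_contra hc
      have hlt := not_le.1 hc
      have h0 := hj.1
      refine absurd (Nat.sInf_le (s := {k : ℕ | 0 < k ∧ π x (x - (k : Pt N))})
        (m := sInf {k : ℕ | 0 < k ∧ π x (x - (k : Pt N))} - j) ⟨by omega, ?_⟩) (by omega)
      rw [Nat.cast_sub hlt.le, sub_sub_eq_add_sub, add_sub_right_comm]
      exact Setoid.trans' _ (rel_prev π x) hj.2
  rw [next, h2, prev, sub_add_cancel]

theorem next_injective : Function.Injective (next π) :=
  Function.LeftInverse.injective (prev_next π)

variable {π}

omit [NeZero N] in
theorem next_bar (hs : IsSymmetric π) (x : Pt N) : next π (bar x) = bar (next π x) := by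
  have h : {k : ℕ | 0 < k ∧ π (bar x) (bar x + (k : Pt N))} =
      {k : ℕ | 0 < k ∧ π x (x + (k : Pt N))} := by
    ext k
    have : bar x + (k : Pt N) = bar (x + (k : Pt N)) := by simp only [bar]; ring
    simp only [Set.mem_ofPred_eq, this, hs.bar_iff]
  rw [next, h, next]
  simp only [bar]
  ring

/-- The predecessor of an integer point. -/
theorem exists_prev (x : ℤ) : ∃ z : ℤ, z < x ∧ x - 2 * N ≤ z ∧ prev π (x : Pt N) = z ∧
    ∀ t : ℤ, z < t → t < x → ¬ π (x : Pt N) (t : Pt N) := by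
  have h1 := Nat.sInf_mem (prev_set_nonempty π (x : Pt N))
  refine ⟨x - sInf {k : ℕ | 0 < k ∧ π (x : Pt N) (x - (k : Pt N))}, ?_, ?_, ?_,
    fun t ht1 ht2 ht => ?_⟩
  · have := h1.1
    omega
  · have : sInf {k : ℕ | 0 < k ∧ π (x : Pt N) (x - (k : Pt N))} ≤ 2 * N :=
      Nat.sInf_le ⟨by have := NeZero.pos N; omega, by
        rw [natCast_two_mul_self, sub_zero]⟩
    omega
  · rw [prev]
    push_cast
    rfl
  · refine absurd (Nat.sInf_le (s := {k : ℕ | 0 < k ∧ π (x : Pt N) (x - (k : Pt N))})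
      (m := (x - t).toNat) ⟨by omega, ?_⟩) (by omega)
    have e : ((x : Pt N) - ((x - t).toNat : ℕ)) = (t : Pt N) := by
      have : ((x - t).toNat : ℤ) = x - t := by omega
      rw [← Int.cast_natCast, this]
      push_cast
      ring
    rwa [e]

variable (π) in
/-- A partition can be recovered from the successors in the blocks. -/
theorem ofNext_next : ofNext (next π) = π := by
  apply le_antisymm
  · refine Setoid.eqvGen_le fun x y hxy => ?_
    rw [← hxy]
    exact rel_next π x
  · have key : ∀ j : ℕ, ∀ x : Pt N, π x (x + (j : Pt N)) → ofNext (next π) x (x + (j : Pt N)) := by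
      intro j
      induction j using Nat.strong_induction_on with
      | _ j ih =>
        intro x hx
        rcases Nat.eq_zero_or_pos j with rfl | hj
        · rw [Nat.cast_zero, add_zero]
        · have h1 := Nat.sInf_mem (next_set_nonempty π x)
          have h2 : sInf {k : ℕ | 0 < k ∧ π x (x + (k : Pt N))} ≤ j := Nat.sInf_le ⟨hj, hx⟩
          have e : x + (j : Pt N) =
              next π x + ((j - sInf {k : ℕ | 0 < k ∧ π x (x + (k : Pt N))} : ℕ) : Pt N) := by
            rw [Nat.cast_sub h2, next]
            ring
          rw [e] at hx ⊢
          exact Setoid.trans' _ (Relation.EqvGen.rel _ _ rfl)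
            (ih _ (by have := h1.1; omega) _ (Setoid.trans' _ (Setoid.symm' _ (rel_next π x)) hx))
    intro x y hxy
    have e : y = x + (((y - x).val : ℕ) : Pt N) := by simp
    rw [e] at hxy ⊢
    exact key _ _ hxy

omit [NeZero N] in
theorem link_add_one (u v : Pt N) (f : Pt N → Pt N) :
    link (u + 1) (v + 1) (fun x => f (x - 1) + 1) = fun x => link u v f (x - 1) + 1 := by
  funext x
  have e (u : Pt N) : bar (u + 1) = bar u + 1 := by simp only [bar]; ring
  simp only [link_apply, e, sub_eq_iff_eq_add]
  split_ifs <;> rfl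

/-- Partitions with conjugate successor maps, up to the rotation by one unit. -/
theorem ofNext_conj {θ F : Pt N → Pt N} (hθ : ∀ z, θ (θ z) = z)
    (hF : ∀ u, θ (F u) = next π (θ u)) :
    ofNext (fun x => F (x - 1) + 1) = Setoid.comap (fun x => θ (x - 1)) π := by
  apply le_antisymm
  · refine Setoid.eqvGen_le fun x y hxy => ?_
    rw [Setoid.comap_rel, ← hxy, add_sub_cancel_right, hF]
    exact rel_next π _
  · have h : ofNext (next π) ≤ Setoid.comap (fun z => θ z + 1) (ofNext fun x => F (x - 1) + 1) := by
      refine Setoid.eqvGen_le fun p q hpq => ?_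
      rw [Setoid.comap_rel]
      refine Relation.EqvGen.rel _ _ ?_
      change F (θ p + 1 - 1) + 1 = θ q + 1
      rw [add_sub_cancel_right, add_left_inj, ← hθ (F (θ p)), hF, hθ, hpq]
    rw [ofNext_next] at h
    intro x y hxy
    have := h hxy
    rw [Setoid.comap_rel, hθ, hθ, sub_add_cancel, sub_add_cancel] at this
    exact this

end

/-! The successor maps which occur in the definition of the pseudo-rotation are conjugate to the
successor map of the given partition, by an exchange of two pairs of antipodes. -/

theorem exchange_of_ne {A b z : Pt N} (h : z ≠ A ∧ z ≠ b ∧ z ≠ bar A ∧ z ≠ bar b) :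
    exchange A b z = z := by
  rw [exchange, if_neg h.1, if_neg h.2.1, if_neg h.2.2.1, if_neg h.2.2.2]

theorem exchange_left {A b : Pt N} : exchange A b A = b := if_pos rfl

theorem exchange_right {A b : Pt N} (h : A ≠ b) : exchange A b b = A := by
  rw [exchange, if_neg h.symm, if_pos rfl]

theorem link_of_ne {u v x : Pt N} {f : Pt N → Pt N} (h : x ≠ u) (h' : x ≠ bar u) :
    link u v f x = f x := by
  rw [link_apply, if_neg h', if_neg h]

section

variable [NeZero N]

theorem link_self (u v : Pt N) (f : Pt N → Pt N) : link u v f u = v := by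
  rw [link_apply, if_neg (bar_ne u).symm, if_pos rfl]

theorem link_bar {u v : Pt N} {f : Pt N → Pt N} (hf : ∀ x, f (bar x) = bar (f x)) (x : Pt N) :
    link u v f (bar x) = bar (link u v f x) := by
  have e4 := @bar_bar N
  have e5 := @bar_injective N
  have e2 := bar_ne u
  rw [link_apply, link_apply]
  grind

variable {g : Pt N → Pt N} (hg : Function.Injective g) (hgb : ∀ x, g (bar x) = bar (g x))
  {A b o a d e : Pt N} (ha : g a = A) (hA : g A = o)

include hg hgb ha

/-- A map `F` which commutes with `i ↦ -i` is conjugate to `g` under the exchange of `A` and `b`,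
if this holds at some points and if `F` and `g` agree at all other points. -/
theorem exchange_eq_of_agree (hAb : A ≠ b) {d : Pt N} (hd : g d = b) {F : Pt N → Pt N}
    (hF : ∀ x, F (bar x) = bar (F x)) {T : Pt N → Prop}
    (hT : ∀ u, T u → exchange A b (F u) = g (exchange A b u))
    (hagree : ∀ u, ¬ T u → ¬ T (bar u) → F u = g u)
    (hmem : ∀ u, ¬ T u → ¬ T (bar u) → u ≠ A ∧ u ≠ b ∧ u ≠ bar A ∧ u ≠ bar b)
    (hmem' : ∀ u, ¬ T u → ¬ T (bar u) → u ≠ a ∧ u ≠ d ∧ u ≠ bar a ∧ u ≠ bar d) (u : Pt N) :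
    exchange A b (F u) = g (exchange A b u) := by
  by_cases hu : T u
  · exact hT u hu
  by_cases hu' : T (bar u)
  · have h := hT _ hu'
    rw [hF, exchange_bar hAb, exchange_bar hAb, hgb] at h
    exact bar_injective h
  obtain ⟨h1, h2, h3, h4⟩ := hmem' u hu hu'
  rw [hagree u hu hu', exchange_of_ne (hmem u hu hu'), exchange_of_ne]
  refine ⟨fun h => h1 (hg ?_), fun h => h2 (hg ?_), fun h => h3 (hg ?_), fun h => h4 (hg ?_)⟩
  · rw [h, ha]
  · rw [h, hd]
  · rw [h, hgb, ha]
  · rw [h, hgb, hd]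

include hA

/-- The case in which `d`, `b`, `e` are successive elements of a non-zero block, or of a zero
block with more than two elements. -/
theorem exchange_link_of_ne (hd : g d = b) (he : g b = e) (h1 : A ≠ b) (h2 : A ≠ bar b)
    (ha' : a ≠ A ∧ a ≠ b ∧ a ≠ bar A ∧ a ≠ bar b) (ho' : o ≠ A ∧ o ≠ b ∧ o ≠ bar A ∧ o ≠ bar b)
    (hd' : d ≠ A ∧ d ≠ b ∧ d ≠ bar A ∧ d ≠ bar b) (he' : e ≠ A ∧ e ≠ b ∧ e ≠ bar A ∧ e ≠ bar b)
    (hda : a ≠ d ∧ a ≠ bar d) (u : Pt N) :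
    exchange A b (link d A (link A e (link a b (link b o g))) u) = g (exchange A b u) := by
  have hbA : bar A ≠ b := fun h => h2 (by rw [← h, bar_bar])
  refine exchange_eq_of_agree (T := fun u => u = d ∨ u = A ∨ u = a ∨ u = b) hg hgb ha h1 hd
    (link_bar (link_bar (link_bar (link_bar hgb)))) ?_ ?_ ?_ ?_ u
  · rintro u (rfl | rfl | rfl | rfl)
    · rw [link_self, exchange_left, exchange_of_ne hd', hd]
    · rw [link_of_ne hd'.1.symm (by rw [ne_eq, eq_bar_iff]; exact hd'.2.2.1.symm), link_self,
        exchange_of_ne he', exchange_left, he]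
    · rw [link_of_ne hda.1 hda.2, link_of_ne ha'.1 ha'.2.2.1, link_self, exchange_right h1,
        exchange_of_ne ha', ha]
    · rw [link_of_ne hd'.2.1.symm (by rw [ne_eq, eq_bar_iff]; exact hd'.2.2.2.symm),
        link_of_ne h1.symm hbA.symm, link_of_ne ha'.2.1.symm
        (by rw [ne_eq, eq_bar_iff]; exact ha'.2.2.2.symm), link_self, exchange_of_ne ho',
        exchange_right h1, hA]
  all_goals
    intro u hu hu'
    simp only [not_or, ← eq_bar_iff] at hu hu'
  · rw [link_of_ne hu.1 hu'.1, link_of_ne hu.2.1 hu'.2.1, link_of_ne hu.2.2.1 hu'.2.2.1,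
      link_of_ne hu.2.2.2 hu'.2.2.2]
  · exact ⟨hu.2.1, hu.2.2.2, hu'.2.1, hu'.2.2.2⟩
  · exact ⟨hu.2.2.1, hu.1, hu'.2.2.1, hu'.1⟩

/-- The case in which `b` and its antipode form a zero block. -/
theorem exchange_link_of_bar (hd : g (bar b) = b) (h1 : A ≠ b) (h2 : A ≠ bar b)
    (ha' : a ≠ A ∧ a ≠ b ∧ a ≠ bar A ∧ a ≠ bar b) (ho' : o ≠ A ∧ o ≠ b ∧ o ≠ bar A ∧ o ≠ bar b)
    (u : Pt N) :
    exchange A b (link A (bar A) (link a b (link b o g)) u) = g (exchange A b u) := by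
  have hbA : bar A ≠ b := fun h => h2 (by rw [← h, bar_bar])
  refine exchange_eq_of_agree (T := fun u => u = A ∨ u = a ∨ u = b) hg hgb ha h1 hd
    (link_bar (link_bar (link_bar hgb))) ?_ ?_ ?_ ?_ u
  · rintro u (rfl | rfl | rfl)
    · rw [link_self, exchange_bar h1, exchange_left, ← hd, ← hgb, bar_bar, hd]
    · rw [link_of_ne ha'.1 ha'.2.2.1, link_self, exchange_right h1, exchange_of_ne ha', ha]
    · rw [link_of_ne h1.symm hbA.symm, link_of_ne ha'.2.1.symm
        (by rw [ne_eq, eq_bar_iff]; exact ha'.2.2.2.symm), link_self, exchange_of_ne ho',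
        exchange_right h1, hA]
  all_goals
    intro u hu hu'
    simp only [not_or, ← eq_bar_iff] at hu hu'
  · rw [link_of_ne hu.1 hu'.1, link_of_ne hu.2.1 hu'.2.1, link_of_ne hu.2.2 hu'.2.2]
  · exact ⟨hu.1, hu.2.2, hu'.1, hu'.2.2⟩
  · exact ⟨hu.2.1, hu'.2.2, hu'.2.1, by rw [bar_bar]; exact hu.2.2⟩

/-- The case in which `A` is exchanged with its own antipode. -/
theorem exchange_link_bar (ha' : a ≠ A ∧ a ≠ bar A) (ho' : o ≠ A ∧ o ≠ bar A) (u : Pt N) :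
    exchange A (bar A) (link (bar a) A (link A (bar o) g) u) = g (exchange A (bar A) u) := by
  have h1 := (bar_ne A).symm
  have hbb : ∀ {z w : Pt N}, z ≠ w → bar z ≠ bar w := fun h h' => h (bar_injective h')
  have hb : ∀ {z w : Pt N}, z ≠ bar w → bar z ≠ w := fun h h' => h (by rw [← h', bar_bar])
  refine exchange_eq_of_agree (T := fun u => u = bar a ∨ u = A) hg hgb ha h1
    (d := bar a) (by rw [hgb, ha]) (link_bar (link_bar hgb)) ?_ ?_ ?_ ?_ u
  · rintro u (rfl | rfl)
    · rw [link_self, exchange_left, exchange_of_ne, hgb, ha]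
      rw [bar_bar]
      exact ⟨hb ha'.2, hbb ha'.1, hbb ha'.1, hb ha'.2⟩
    · rw [link_of_ne (hb ha'.2).symm (by rw [bar_bar]; exact ha'.1.symm), link_self,
        exchange_of_ne, exchange_left, hgb, hA]
      rw [bar_bar]
      exact ⟨hb ho'.2, hbb ho'.1, hbb ho'.1, hb ho'.2⟩
  all_goals
    intro u hu hu'
    simp only [not_or, ← eq_bar_iff] at hu hu'
  · rw [link_of_ne hu.1 hu'.1, link_of_ne hu.2 hu'.2]
  · rw [bar_bar]
    exact ⟨hu.2, hu'.2, hu'.2, hu.2⟩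
  · rw [bar_bar] at hu' ⊢
    exact ⟨hu'.1, hu.1, hu.1, hu'.1⟩

end

end TypeB

/-! ### The pseudo-rotation in terms of height functions -/

namespace TypeB

variable {N : ℕ}

theorem pos_eq_intCast (i : ℕ) : pos N i = ((i - 1 : ℤ) : Pt N) := by simp [pos]

theorem pos_one : pos N 1 = ((0 : ℤ) : Pt N) := by simp [pos]

theorem pos_two : pos N 2 = ((1 : ℤ) : Pt N) := by
  rw [pos_eq_intCast]
  norm_num

theorem bar_pos_self : bar (pos N N) = ((-1 : ℤ) : Pt N) := by
  rw [pos_eq_intCast, bar_intCast, ← intCast_sub_two]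
  congr 1
  ring

theorem isNeg_intCast [NeZero N] {x : ℤ} (h1 : -N ≤ x) (h2 : x < 0) : IsNeg (x : Pt N) := by
  have h := val_intCast (N := N) (x := x + 2 * N) (by omega) (by omega)
  rw [intCast_add_two] at h
  rw [IsNeg]
  omega

theorem not_isNeg_intCast [NeZero N] {x : ℤ} (h1 : 0 ≤ x) (h2 : x < N) : ¬ IsNeg (x : Pt N) := by
  have h := val_intCast (N := N) (x := x) (by omega) (by omega)
  rw [IsNeg]
  omega

theorem IsNeg.exists_rep [NeZero N] {a : Pt N} (h : IsNeg a) :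
    ∃ x : ℤ, (x : Pt N) = a ∧ -N ≤ x ∧ x < 0 := by
  obtain ⟨x, rfl, h1, h2⟩ := TypeB.exists_rep a (-N)
  refine ⟨x, rfl, h1, ?_⟩
  by_contra hc
  exact not_isNeg_intCast (by omega) (by omega) h

theorem exists_rep_of_not_isNeg [NeZero N] {a : Pt N} (h : ¬ IsNeg a) :
    ∃ x : ℤ, (x : Pt N) = a ∧ 0 ≤ x ∧ x < N := by
  obtain ⟨x, rfl, h1, h2⟩ := TypeB.exists_rep a (-N)
  refine ⟨x, rfl, ?_, by omega⟩
  by_contra hc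
  exact h (isNeg_intCast (by omega) (by omega))

section

variable [NeZero N] {H : ℤ → ℤ} (hH : IsHeight N H) (hN : 2 ≤ N) (h0 : H 1 = H 0 - 1)

include hH in
/-- If the block of `-N` contains another negative element, then no block is opened at `-N`. -/
theorem descends_of_exists_neg (h : ∃ x : Pt N, IsNeg x ∧ x ≠ bar (pos N N) ∧
    partition N H (bar (pos N N)) x) : H 0 = H (-1) - 1 := by
  obtain ⟨a, ha, hne, hrel⟩ := h
  rw [bar_pos_self] at hne hrel
  obtain ⟨x, rfl, h1, h2⟩ := ha.exists_rep
  by_contra hc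
  have hop : Opens H (-1) (-1) := opens_self_iff.2 (by
    have := hH.step (-1)
    rw [neg_add_cancel] at this ⊢
    omega)
  have := (opens_of_rel hH hop hrel (by omega) (by omega)).1
  exact hne (by rw [show x = -1 by omega])

include hH hN h0 in
theorem opens_of_not_exists_neg (h : ¬ ∃ x : Pt N, IsNeg x ∧ x ≠ bar (pos N N) ∧
    partition N H (bar (pos N N)) x) : H (-1) ≤ H 0 := by
  simp only [bar_pos_self, not_exists, not_and] at h
  rcases opens_or_outer H (-1) with ⟨y, hy⟩ | ho
  · rcases hy.1.eq_or_lt with rfl | hl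
    · exact hy.2.1
    · have := hH.lt_of_opens hy
      exact absurd (rel_of_opens hH hy hy.self) (h _ (isNeg_intCast (by omega) (by omega))
        (intCast_ne (by omega) (by omega) (by omega)))
  · have ho' : Outer H 0 := by
      intro y hy
      rcases hy.eq_or_lt with rfl | hl
      · rw [zero_add]; omega
      · have := ho y (by omega)
        rw [neg_add_cancel] at this
        rw [zero_add]
        omega
    exact absurd (rel_of_outer hH ho (hH.outer_sub ho')) (h _ (isNeg_intCast (by omega) (by omega))
        (intCast_ne (by omega) (by omega) (by omega)))

omit [NeZero N] in
theorem moveOpener_eq_self (hH : IsHeight N H) (h : H 0 = H (-1) - 1) : moveOpener N H = H := by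
  funext x
  by_cases hd : (N : ℤ) ∣ x
  · rw [moveOpener_of_dvd hd]
    obtain ⟨k, rfl⟩ := hd
    have h1 := hH.per_mul 0 k
    have h2 := hH.per_mul (-1) k
    rw [zero_add] at h1
    rw [mul_comm, sub_eq_add_neg (k * (N : ℤ)), add_comm (k * (N : ℤ)), h2, h1]
    omega
  · exact moveOpener_of_not_dvd hd

include hH hN h0 in
/-- The case in which `{N}` is a block. -/
theorem isTurn_zero (h : H (-1) ≤ H 0)
    (hs : ∀ x : Pt N, partition N H (pos N N) x → x = pos N N) : IsTurn N H 0 := by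
  have heq : H 0 = H (-1) := by
    by_contra hc
    have hop : Opens H (-1) 0 := by
      refine ⟨by omega, by rw [zero_add]; omega, fun z h1 h2 => ?_⟩
      rw [show z = 0 by omega, zero_add]
      omega
    have h1 := rel_of_opens hH (hH.opens_add hop.self) (hH.opens_add hop)
    rw [show (-1 : ℤ) + N = N - 1 by ring, zero_add] at h1
    rw [pos_eq_intCast] at hs
    exact intCast_ne (by omega) (by omega) (by omega) (hs _ h1)
  refine ⟨le_rfl, by omega, fun z h1 h2 => ?_, fun _ => by rw [zero_add]; omega, fun _ => by omega⟩
  rcases lt_or_ge z 0 with hz | hz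
  · rw [show z = -1 by omega]
  · rw [show z = 0 by omega, heq]

include hH h0 in
/-- In the remaining case, `-N` and `1` are successive elements of the block opened at `-N`. -/
theorem opens_zero_of_not_singleton (h : H (-1) ≤ H 0)
    (hs : ¬ ∀ x : Pt N, partition N H (pos N N) x → x = pos N N) : Opens H (-1) 0 := by
  have hop : Opens H (-1) (-1) := opens_self_iff.2 h
  refine ⟨by omega, ?_, fun z h1 h2 => by rw [show z = 0 by omega, zero_add]; omega⟩
  rw [zero_add, h0]
  by_contra hc
  apply hs
  intro a ha
  obtain ⟨x, rfl, h1, h2⟩ := exists_rep a (N - 2)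
  rw [pos_eq_intCast] at ha ⊢
  have hop' := hH.opens_add hop
  rw [show (-1 : ℤ) + N = N - 1 by ring] at hop'
  have hx := opens_of_rel hH hop' ha (by omega) (by omega)
  rcases hx.1.eq_or_lt with rfl | hl
  · rfl
  · have h3 := hx.2.2 N (by omega) (by omega)
    have h4 := hx.2.1
    have h5 := hH.per (-1)
    have h6 := hH.per 0
    rw [show (-1 : ℤ) + N = N - 1 by ring] at h5
    rw [zero_add] at h6
    omega

section

variable {b : ℤ} (hb : IsTurn N H b)
include hb

omit [NeZero N] in
theorem IsTurn.exists_opens {x : ℤ} (h1 : -1 ≤ x) (h2 : x < b) : ∃ y, Opens H y x ∧ -1 ≤ y := by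
  have h3 := hb.le (x + 1) (by omega) (by omega)
  rcases opens_or_outer H x with ⟨y, hy⟩ | ho
  · refine ⟨y, hy, ?_⟩
    by_contra hc
    have := hy.2.2 (-1) (by omega) (by omega)
    omega
  · have := ho (-1) (by omega)
    omega

include hH

theorem IsTurn.not_rel (hbN : b < N - 1) {z : ℤ} (h1 : -1 ≤ z) (h2 : z < b) :
    ¬ partition N H (b : Pt N) (z : Pt N) := by
  intro hrel
  obtain ⟨v, hv, hv1⟩ := hb.exists_opens h1 h2
  have hv2 := hv.1
  have := opens_of_rel hH hv (Setoid.symm' _ hrel) (by omega) (by omega)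
  have h3 := this.2.1
  have h4 := hb.le v hv1 (by omega)
  have := hb.eq hbN
  omega

theorem IsTurn.rel_neg (hbN : b < N - 1) :
    ∃ z : ℤ, -N ≤ z ∧ z < -1 ∧ partition N H (b : Pt N) (z : Pt N) := by
  have hb0 := hb.nonneg
  rcases opens_or_outer H b with ⟨y, hy⟩ | ho
  · have := hH.lt_of_opens hy
    refine ⟨y, by omega, ?_, rel_of_opens hH hy hy.self⟩
    by_contra hc
    have h1 := hb.le y (by omega) hy.1
    have h2 := hb.eq hbN
    have h3 := hy.2.1
    omega
  · exact ⟨b - N, by omega, by omega, rel_of_outer hH ho (hH.outer_sub ho)⟩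

theorem IsTurn.isNeg_prev (hbN : b < N - 1) : IsNeg (prev (partition N H) (b : Pt N)) := by
  obtain ⟨z, h1, h2, h3, h4⟩ := exists_prev (π := partition N H) b
  obtain ⟨t, ht1, ht2, ht3⟩ := hb.rel_neg hH hbN
  rw [h3]
  have hrel := rel_prev (partition N H) (b : Pt N)
  rw [h3] at hrel
  have hb0 := hb.nonneg
  have hz : z < -1 := by
    by_contra hc
    exact hb.not_rel hH hbN (by omega) h1 hrel
  refine isNeg_intCast ?_ (by omega)
  by_contra hc
  exact h4 t (by omega) (by omega) ht3

/-- A point before `b` off the special blocks belongs to a block which is opened at one of the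
points `0, …, b`. If it is not the opener itself, then its predecessor is not before the opener;
if it is, then its predecessor is the last element of the block, which precedes `b`. -/
theorem IsTurn.not_turning (hbN : b < N - 1) {x : ℤ} (hx1 : 0 ≤ x) (hx2 : x < b)
    (hoff : OffSpecial (partition N H) (x : Pt N)) :
    ¬ IsNeg (prev (partition N H) (x : Pt N)) := by
  intro hneg
  obtain ⟨z, h1, h2, h3, h4⟩ := exists_prev (π := partition N H) x
  have hrel := rel_prev (partition N H) (x : Pt N)
  rw [h3] at hrel hneg
  have hz : z < 0 := by
    by_contra hc
    exact not_isNeg_intCast (by omega) (by omega) hneg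
  obtain ⟨y, hy, hy1⟩ := hb.exists_opens (x := x) (by omega) hx2
  have hy2 : y ≠ -1 := by
    rintro rfl
    have := hoff.2.2.2
    rw [bar_pos_self] at this
    exact this (rel_of_opens hH hy hy.self)
  have hyx : y = x := by
    by_contra hne
    have := hy.1
    exact h4 y (by omega) (by omega) (rel_of_opens hH hy hy.self)
  subst hyx
  have hzN : z < y - N := by
    by_contra hc
    have := (opens_of_rel hH hy hrel (by omega) (by omega)).1
    omega
  have hz2 : -N ≤ z := by
    by_contra hc
    refine not_isNeg_intCast (N := N) (x := z + 2 * N) (by omega) (by omega) ?_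
    rwa [intCast_add_two]
  rw [← intCast_add_two z] at hrel
  have h5 := opens_of_rel hH hy hrel (by omega) (by omega)
  have h6 := h5.2.2 (b + 1) (by omega) (by omega)
  have h7 := h5.2.1
  have h8 := hb.eq hbN
  have h9 := hb.le y (by omega) (by omega)
  omega

theorem IsTurn.not_exists (hbN : b = N - 1) : ¬ ∃ x y : Pt N, OffSpecial (partition N H) x ∧
    partition N H x y ∧ IsNeg x ∧ ¬ IsNeg y := by
  rintro ⟨x, y, hoff, hrel, hx, hy⟩
  obtain ⟨x, rfl, hx1, hx2⟩ := hx.exists_rep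
  obtain ⟨y, rfl, hy1, hy2⟩ := exists_rep_of_not_isNeg hy
  have h1 : ¬ partition N H (x : Pt N) ((-1 : ℤ) : Pt N) := by
    rw [← bar_pos_self]
    exact hoff.2.2.2
  have h2 : ¬ partition N H (x : Pt N) ((N - 1 : ℤ) : Pt N) := by
    have := hoff.2.2.1
    rwa [pos_eq_intCast] at this
  have hxne : x ≠ -1 := fun h => h1 (by rw [h])
  have hyne : y ≠ N - 1 := fun h => h2 (by rw [← h]; exact hrel)
  obtain ⟨v, hv, hv1⟩ := hb.exists_opens (x := y) (by omega) (by omega)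
  obtain ⟨w, hw, hw1⟩ := hb.exists_opens (x := x + N) (by omega) (by omega)
  have hw' := hH.opens_sub hw
  rw [add_sub_cancel_right] at hw'
  have hv2 : v ≠ -1 := by
    rintro rfl
    exact h1 (Setoid.trans' _ hrel (rel_of_opens hH hv hv.self))
  have hw2 : w ≠ -1 := by
    rintro rfl
    have h3 := rel_of_opens hH hw' hw'.self
    rw [← intCast_add_two (-1 - N), show (-1 - N + 2 * N : ℤ) = N - 1 by ring] at h3
    exact h2 h3
  have h4 := (rel_iff_of_opens hH hw' hv).1 hrel
  have := hv.1
  have := hw.1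
  have := eq_of_intCast_eq h4 (by omega) (by omega)
  omega

variable (hop : Opens H (-1) 0)
include hop

theorem IsTurn.offSpecial (hbN : b < N - 1) : OffSpecial (partition N H) (b : Pt N) := by
  have hb0 := hb.nonneg
  have hs := partition_isSymmetric hH
  have h1 : ¬ partition N H (b : Pt N) ((-1 : ℤ) : Pt N) :=
    hb.not_rel hH hbN le_rfl (by omega)
  have h2 : partition N H ((0 : ℤ) : Pt N) ((-1 : ℤ) : Pt N) := rel_of_opens hH hop hop.self
  have h3 : ¬ partition N H (b : Pt N) (pos N N) := by
    intro h
    have hop' := hH.opens_add hop.self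
    rw [show (-1 : ℤ) + N = N - 1 by ring] at hop'
    rw [pos_eq_intCast] at h
    have := (opens_of_rel hH hop' (Setoid.symm' _ h) (by omega) (by omega)).1
    omega
  have h4 : partition N H (bar ((0 : ℤ) : Pt N)) (pos N N) := by
    rw [← bar_bar (pos N N), bar_pos_self, hs.bar_iff]
    exact h2
  rw [OffSpecial, pos_one, bar_pos_self]
  exact ⟨fun h => h1 (Setoid.trans' _ h h2), fun h => h3 (Setoid.trans' _ h h4), h3, h1⟩

theorem IsTurn.turningPoint_eq (hbN : b < N - 1) :
    turningPoint (partition N H) = (b : Pt N) := by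
  have hb0 := hb.nonneg
  have e (i : ℕ) : pos N i = ((i - 1 : ℤ) : Pt N) := pos_eq_intCast i
  have hmem : (b + 1).toNat ∈ turningIndices (partition N H) := by
    have e2 : pos N (b + 1).toNat = (b : Pt N) := by
      rw [e]
      congr 1
      omega
    refine ⟨by omega, by omega, ?_, ?_⟩ <;> rw [e2]
    · exact hb.offSpecial hH hop hbN
    · exact hb.isNeg_prev hH hbN
  have hinf : sInf (turningIndices (partition N H)) = (b + 1).toNat := by
    refine le_antisymm (Nat.sInf_le hmem) (le_csInf ⟨_, hmem⟩ ?_)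
    rintro i ⟨hi1, hi2, hi3, hi4⟩
    by_contra hc
    rw [e] at hi3 hi4
    exact hb.not_turning hH hbN (by omega) (by omega) hi3 hi4
  rw [turningPoint, hinf, e]
  congr 1
  omega

end

end

end TypeB

namespace TypeB

variable {N : ℕ}

theorem bar_add_one (a : Pt N) : bar (a + 1) = bar a + 1 := by
  simp only [bar]
  ring

theorem pos_one_eq_add_one : pos N 1 = ((-1 : ℤ) : Pt N) + 1 := by simp [pos]

theorem pos_two_eq_add_one : pos N 2 = ((0 : ℤ) : Pt N) + 1 := by
  rw [pos_two]
  simp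

theorem OffSpecial.of_rel {π : Setoid (Pt N)} {x y : Pt N} (h : OffSpecial π x) (hxy : π x y) :
    OffSpecial π y :=
  ⟨fun h' => h.1 (Setoid.trans' _ hxy h'), fun h' => h.2.1 (Setoid.trans' _ hxy h'),
    fun h' => h.2.2.1 (Setoid.trans' _ hxy h'), fun h' => h.2.2.2 (Setoid.trans' _ hxy h')⟩

section

variable [NeZero N] {H : ℤ → ℤ} (hH : IsHeight N H) (hN : 2 ≤ N) (h0 : H 1 = H 0 - 1)

omit [NeZero N] in
include hN in
/-- The relabelling which is applied if `{N}` is a block is an exchange followed by a rotation. -/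
theorem relabelling_eq_exchange (x : Pt N) :
    (if x = pos N 1 ∨ x = bar (pos N 1) then x
      else if x = pos N 2 then bar (pos N N)
      else if x = bar (pos N 2) then pos N N
      else x - 1) = exchange ((-1 : ℤ) : Pt N) ((0 : ℤ) : Pt N) (x - 1) := by
  obtain ⟨y, rfl⟩ : ∃ y, x = y + 1 := ⟨x - 1, by ring⟩
  have hne' : ((-1 : ℤ) : Pt N) ≠ bar ((0 : ℤ) : Pt N) := by
    rw [bar_intCast]
    exact intCast_ne (by omega) (by omega) (by omega)
  have ho : ((-1 : ℤ) : Pt N) + 1 = ((0 : ℤ) : Pt N) := by simp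
  have hpos : pos N N = bar ((-1 : ℤ) : Pt N) := by rw [← bar_pos_self, bar_bar]
  rw [bar_pos_self, hpos, pos_one_eq_add_one, pos_two_eq_add_one, bar_add_one, bar_add_one]
  simp only [add_left_inj, add_sub_cancel_right, exchange]
  have ho' : bar ((-1 : ℤ) : Pt N) + 1 = bar ((0 : ℤ) : Pt N) := by rw [← bar_add_one, ho]
  by_cases h1 : y = ((-1 : ℤ) : Pt N)
  · rw [if_pos (Or.inl h1), if_pos h1, h1, ho]
  by_cases h2 : y = bar ((-1 : ℤ) : Pt N)
  · have h3 : bar ((-1 : ℤ) : Pt N) ≠ ((0 : ℤ) : Pt N) := fun h => hne' (by rw [← h, bar_bar])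
    rw [if_pos (Or.inr h2), if_neg h1, h2, if_neg h3, if_pos rfl, ho']
  rw [if_neg (not_or.2 ⟨h1, h2⟩), if_neg h1, if_neg h2]

include hH hN h0

theorem kappa_partition_of_opens_zero (h : H (-1) ≤ H 0) (hop : Opens H (-1) 0)
    (hneg : ¬ ∃ x : Pt N, IsNeg x ∧ x ≠ bar (pos N N) ∧ partition N H (bar (pos N N)) x)
    (hsing : ¬ ∀ x : Pt N, partition N H (pos N N) x → x = pos N N) :
    kappa (partition N H) = Setoid.comap (fun x => x - 1) (partition N (moveOpener N H)) := by
  obtain ⟨b, hb⟩ := exists_isTurn hH h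
  rw [partition_moveOpener hH hN h0 hb]
  have hb0 := hb.nonneg
  have hb1 := hb.lt
  have hs := partition_isSymmetric hH
  have hAo : partition N H ((-1 : ℤ) : Pt N) ((0 : ℤ) : Pt N) := rel_of_opens hH hop.self hop
  have hAA : ¬ partition N H ((-1 : ℤ) : Pt N) (bar ((-1 : ℤ) : Pt N)) := by
    intro h
    rw [bar_intCast] at h
    have := hH.lt_of_opens (opens_of_rel hH hop.self h (by omega) (by omega))
    omega
  have hone : ((0 : ℤ) : Pt N) ≠ ((-1 : ℤ) : Pt N) := intCast_ne (by omega) (by omega) (by omega)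
  have hnext : next (partition N H) ((-1 : ℤ) : Pt N) = ((0 : ℤ) : Pt N) := by
    obtain ⟨z, h1, h2, h3, h4⟩ := exists_prev (π := partition N H) 0
    have hz : z = -1 := by
      by_contra hc
      exact h4 (-1) (by omega) (by omega) (Setoid.symm' _ hAo)
    rw [← hz, ← h3, next_prev]
  have hAb : ((-1 : ℤ) : Pt N) ≠ (b : Pt N) := intCast_ne (by omega) (by omega) (by omega)
  have hrot : rotNext (partition N H) = fun x => next (partition N H) (x - 1) + 1 := rfl
  have haA := rel_prev (partition N H) ((-1 : ℤ) : Pt N)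
  have ha := next_prev (partition N H) ((-1 : ℤ) : Pt N)
  have hbnext := next_bar hs
  rw [kappa, if_neg hneg, if_neg hsing]
  simp only [bar_pos_self, pos_one_eq_add_one, pos_two_eq_add_one, bar_add_one, hrot]
  have ha1 : prev (partition N H) ((-1 : ℤ) : Pt N) ≠ ((-1 : ℤ) : Pt N) := by
    intro h'
    rw [h', hnext] at ha
    exact hone ha
  generalize prev (partition N H) ((-1 : ℤ) : Pt N) = a at *
  have ne_of (x y u v : Pt N) (hxu : partition N H u x) (hyv : partition N H v y)
      (huv : ¬ partition N H u v) : x ≠ y := by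
    rintro rfl
    exact huv (Setoid.trans' _ hxu (Setoid.symm' _ hyv))
  have rfl' (x : Pt N) : partition N H x x := Setoid.refl' _ x
  rcases (show b ≤ N - 1 by omega).eq_or_lt with hbN | hbN
  · have hbA : (b : Pt N) = bar ((-1 : ℤ) : Pt N) := by
      rw [bar_intCast, hbN, neg_add_eq_sub]
    rw [if_neg (hb.not_exists hH hbN), link_add_one, link_add_one, hbA]
    exact ofNext_conj (exchange_exchange (hbA ▸ hAb))
      (exchange_link_bar (next_injective _) hbnext ha hnext
        ⟨ha1, ne_of _ _ _ _ haA (rfl' _) hAA⟩ ⟨hone, ne_of _ _ _ _ hAo (rfl' _) hAA⟩)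
  · have hoff := hb.offSpecial hH hop hbN
    have hnegprev := hb.isNeg_prev hH hbN
    have hnb : ¬ IsNeg (b : Pt N) := not_isNeg_intCast hb0 hb1
    have hdb := rel_prev (partition N H) (b : Pt N)
    have heb := rel_next (partition N H) (b : Pt N)
    have hd := next_prev (partition N H) (b : Pt N)
    have hpe := prev_next (partition N H) (b : Pt N)
    rw [if_pos ⟨_, (b : Pt N), hoff.of_rel hdb, Setoid.symm' _ hdb, hnegprev, hnb⟩,
      hb.turningPoint_eq hH hop hbN]
    have hc1 : ¬ partition N H ((-1 : ℤ) : Pt N) (b : Pt N) := fun h' => by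
      rw [← bar_pos_self] at h'
      exact hoff.2.2.2 (Setoid.symm' _ h')
    have hc2 : ¬ partition N H ((-1 : ℤ) : Pt N) (bar (b : Pt N)) := fun h' => by
      rw [← bar_pos_self, hs.bar_iff] at h'
      exact hoff.2.2.1 (Setoid.symm' _ h')
    have hc3 : ¬ partition N H (b : Pt N) (bar ((-1 : ℤ) : Pt N)) := fun h' => by
      rw [← hs.bar_iff, bar_bar] at h'
      exact hc2 (Setoid.symm' _ h')
    have hA2 : ((-1 : ℤ) : Pt N) ≠ bar (b : Pt N) := ne_of _ _ _ _ (rfl' _) (rfl' _) hc2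
    have hA' (x : Pt N) (hx : x ≠ ((-1 : ℤ) : Pt N))
        (hx' : partition N H ((-1 : ℤ) : Pt N) x) : x ≠ ((-1 : ℤ) : Pt N) ∧ x ≠ (b : Pt N) ∧
        x ≠ bar ((-1 : ℤ) : Pt N) ∧ x ≠ bar (b : Pt N) :=
      ⟨hx, ne_of _ _ _ _ hx' (rfl' _) hc1, ne_of _ _ _ _ hx' (rfl' _) hAA,
        ne_of _ _ _ _ hx' (rfl' _) hc2⟩
    by_cases hbar : prev (partition N H) (b : Pt N) = bar (b : Pt N)
    · rw [if_pos hbar, link_add_one, link_add_one, link_add_one]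
      rw [hbar] at hd
      exact ofNext_conj (exchange_exchange hAb)
        (exchange_link_of_bar (next_injective _) hbnext ha hnext hd hAb hA2
          (hA' _ ha1 haA) (hA' _ hone hAo))
    · rw [if_neg hbar, link_add_one, link_add_one, link_add_one, link_add_one]
      have hd1 : prev (partition N H) (b : Pt N) ≠ (b : Pt N) := fun h' => hnb (h' ▸ hnegprev)
      have he1 : next (partition N H) (b : Pt N) ≠ (b : Pt N) := fun h' => hd1 (by
        rw [h'] at hpe
        exact hpe)
      have he2 : next (partition N H) (b : Pt N) ≠ bar (b : Pt N) := fun h' => hbar (by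
        have := hbnext (b : Pt N)
        rw [h', bar_bar] at this
        conv_lhs => rw [← this, prev_next])
      have hcs : ¬ partition N H (b : Pt N) ((-1 : ℤ) : Pt N) := fun h' => hc1 (Setoid.symm' _ h')
      refine ofNext_conj (exchange_exchange hAb)
        (exchange_link_of_ne (next_injective _) hbnext ha hnext hd rfl hAb hA2
          (hA' _ ha1 haA) (hA' _ hone hAo)
          ⟨ne_of _ _ _ _ hdb (rfl' _) hcs, hd1, ne_of _ _ _ _ hdb (rfl' _) hc3, hbar⟩
          ⟨ne_of _ _ _ _ heb (rfl' _) hcs, he1, ne_of _ _ _ _ heb (rfl' _) hc3, he2⟩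
          ⟨ne_of _ _ _ _ haA hdb hc1, ne_of _ _ _ _ haA (hs _ _ hdb) hc2⟩)

/-- The pseudo-rotation moves the opener at the point `-1` to the point `0`, and then it rotates. -/
theorem kappa_partition :
    kappa (partition N H) = Setoid.comap (fun x => x - 1) (partition N (moveOpener N H)) := by
  by_cases hneg : ∃ x : Pt N, IsNeg x ∧ x ≠ bar (pos N N) ∧ partition N H (bar (pos N N)) x
  · rw [moveOpener_eq_self hH (descends_of_exists_neg hH hneg), kappa, if_pos hneg]
  have h := opens_of_not_exists_neg hH hN h0 hneg
  by_cases hsing : ∀ x : Pt N, partition N H (pos N N) x → x = pos N N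
  · rw [partition_moveOpener hH hN h0 (isTurn_zero hH hN h0 h hsing), kappa, if_neg hneg,
      if_pos hsing]
    simp only [relabelling_eq_exchange hN]
    rfl
  · exact kappa_partition_of_opens_zero hH hN h0 h
      (opens_zero_of_not_singleton hH h0 h hsing) hneg hsing

end

end TypeB

/-! ### The blocks of a partition and their first elements -/

namespace TypeB

variable {N : ℕ}

theorem intCast_sub_eq_bar (x : ℤ) : ((x - N : ℤ) : Pt N) = bar (x : Pt N) := by
  rw [← bar_bar ((x - N : ℤ) : Pt N), bar_intCast, sub_add_cancel]

theorem openedSize_of_isOpener {π : Setoid (Pt N)} {a : Pt N} (h : IsOpener π a) :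
    openedSize π a = {x | π x a}.ncard := if_pos h

theorem ncard_rel_ne_zero [NeZero N] (π : Setoid (Pt N)) (a : Pt N) : {x | π x a}.ncard ≠ 0 :=
  ((Set.ncard_pos (Set.toFinite {x | π x a})).2 ⟨a, Setoid.refl' π a⟩).ne'

theorem openedSize_eq_zero_iff [NeZero N] {π : Setoid (Pt N)} {a : Pt N} :
    openedSize π a = 0 ↔ ¬ IsOpener π a := by
  rw [openedSize]
  split_ifs with h
  · exact iff_of_false (ncard_rel_ne_zero π a) (not_not.2 h)
  · exact iff_of_true rfl h

theorem setOf_rel_eq {π : Setoid (Pt N)} {a b : Pt N} (h : π a b) : {x | π x a} = {x | π x b} :=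
  Set.ext fun _ => ⟨fun h' => Setoid.trans' _ h' h, fun h' => Setoid.trans' _ h' (Setoid.symm' _ h)⟩

/-- A partition is positive if and only if no block starts at the point of `1`. -/
theorem isPositive_iff [NeZero N] {π : Setoid (Pt N)} :
    IsPositive π ↔ openedSize π ((0 : ℤ) : Pt N) = 0 := by
  rw [openedSize_eq_zero_iff, isOpener_intCast, IsPositive, pos_one]
  constructor
  · rintro ⟨x, hx, hrel⟩ h
    obtain ⟨x, rfl, h1, h2⟩ := hx.exists_rep
    exact h x (by omega) h2 (Setoid.symm' _ hrel)
  · intro h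
    push Not at h
    obtain ⟨z, h1, h2, h3⟩ := h
    exact ⟨z, isNeg_intCast (by omega) h2, Setoid.symm' _ h3⟩

theorem IsOpener.not_rel_bar [NeZero N] {π : Setoid (Pt N)} {a : Pt N} (h : IsOpener π a) :
    ¬ π (bar a) a := by
  obtain ⟨x, rfl⟩ := ZMod.intCast_surjective a
  rw [← intCast_sub_eq_bar]
  exact isOpener_intCast.1 h _ le_rfl (by have := NeZero.pos N; omega)

theorem IsSymmetric.not_rel_bar_of_rel {π : Setoid (Pt N)} (hs : IsSymmetric π) {x y : Pt N}
    (h : π x y) (hx : ¬ π (bar x) x) : ¬ π (bar y) y := fun hy =>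
  hx (Setoid.trans' _ (Setoid.trans' _ (hs _ _ h) hy) (Setoid.symm' _ h))

section

variable [NeZero N] {π : Setoid (Pt N)} (hn : IsNoncrossing π) (hs : IsSymmetric π)
include hn hs

theorem exists_isOpener {a : Pt N} (ha : ¬ π (bar a) a) : ∃ b, IsOpener π b ∧ π a b := by
  obtain ⟨x, rfl⟩ := ZMod.intCast_surjective a
  rw [← intCast_sub_eq_bar] at ha
  obtain ⟨y, hy⟩ := exists_firstOf hn hs ha
  exact ⟨_, hy.1, Setoid.symm' _ hy.2.2.2⟩

/-- The antipodal pairs which are in a common block form the zero block. -/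
theorem rel_of_rel_bar {a b : Pt N} (ha : π (bar a) a) (hb : π (bar b) b) : π a b := by
  obtain ⟨x, rfl⟩ := ZMod.intCast_surjective a
  obtain ⟨y, rfl⟩ := ZMod.intCast_surjective b
  rw [← intCast_sub_eq_bar] at ha hb
  exact rel_of_zero hn hs ha hb

theorem setOf_rel_eq_zeroBlock {a : Pt N} (ha : π (bar a) a) : {x | π x a} = {x | π (bar x) x} := by
  ext x
  refine ⟨fun hx => ?_, fun hx => rel_of_rel_bar hn hs hx ha⟩
  exact Setoid.trans' _ (Setoid.trans' _ (hs _ _ hx) ha) (Setoid.symm' _ hx)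

theorem mem_nonzeroBlocks_iff {B : Set (Pt N)} :
    B ∈ nonzeroBlocks π ↔ ∃ a, IsOpener π a ∧ {x | π x a} = B := by
  constructor
  · rintro ⟨⟨y, rfl⟩, hB⟩
    rw [hs.bar_image] at hB
    obtain ⟨b, hb, hyb⟩ := exists_isOpener hn hs (a := y) fun h => hB (setOf_rel_eq h)
    exact ⟨b, hb, (setOf_rel_eq hyb).symm⟩
  · rintro ⟨a, ha, rfl⟩
    refine ⟨⟨a, rfl⟩, fun h => ha.not_rel_bar ?_⟩
    rw [hs.bar_image] at h
    exact Set.ext_iff.1 h (bar a) |>.1 (Setoid.refl' _ _)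

/-- The non-zero blocks are counted by their first elements. -/
theorem ncard_nonzeroBlocks_filter {P : ℕ → Prop} [DecidablePred P] (h0 : ¬ P 0) :
    {B | B ∈ nonzeroBlocks π ∧ P B.ncard}.ncard = ∑ a, if P (openedSize π a) then 1 else 0 := by
  have h1 : {B | B ∈ nonzeroBlocks π ∧ P B.ncard} =
      (fun a => {x | π x a}) '' {a | P (openedSize π a)} := by
    ext B
    simp only [Set.mem_ofPred_eq, Set.mem_image, mem_nonzeroBlocks_iff hn hs]
    constructor
    · rintro ⟨⟨a, ha, rfl⟩, hP⟩
      exact ⟨a, by rwa [openedSize_of_isOpener ha], rfl⟩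
    · rintro ⟨a, hP, rfl⟩
      by_cases ha : IsOpener π a
      · exact ⟨⟨a, ha, rfl⟩, by rwa [openedSize_of_isOpener ha] at hP⟩
      · rw [openedSize_eq_zero_iff.2 ha] at hP
        exact absurd hP h0
  have hinj : Set.InjOn (fun a => {x | π x a}) {a | P (openedSize π a)} := by
    intro a ha b hb hab
    have h2 (c : Pt N) (hc : P (openedSize π c)) : IsOpener π c := by
      by_contra h
      rw [openedSize_eq_zero_iff.2 h] at hc
      exact h0 hc
    exact (h2 a ha).eq_of_rel (h2 b hb) (Set.ext_iff.1 hab a |>.1 (Setoid.refl' _ _))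
  rw [h1, hinj.ncard_image, Finset.sum_boole, Nat.cast_id, ← Set.ncard_coe_finset]
  simp

theorem ncard_nonzeroBlocks :
    (nonzeroBlocks π).ncard = ∑ a, if openedSize π a ≠ 0 then 1 else 0 := by
  rw [← ncard_nonzeroBlocks_filter hn hs (P := fun i => i ≠ 0) (by simp)]
  congr 1
  ext B
  refine ⟨fun h => ⟨h, ?_⟩, And.left⟩
  obtain ⟨⟨y, rfl⟩, -⟩ := h
  exact ncard_rel_ne_zero π y

theorem ncard_zeroBlock_add : {x | π (bar x) x}.ncard + ∑ a, openedSize π a = 2 * N := by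
  classical
  have h1 (a : Pt N) : openedSize π a = ∑ x, if π x a ∧ IsOpener π a then 1 else 0 := by
    rw [Finset.sum_boole, Nat.cast_id, openedSize]
    split_ifs with ho
    · rw [← Set.ncard_coe_finset]
      simp [ho]
    · simp [ho]
  have h2 (x : Pt N) : (∑ a, if π x a ∧ IsOpener π a then 1 else 0) =
      if ¬ π (bar x) x then 1 else 0 := by
    rw [Finset.sum_boole, Nat.cast_id]
    by_cases h : ¬ π (bar x) x
    · obtain ⟨b, hb, hxb⟩ := exists_isOpener hn hs h
      rw [if_pos h, Finset.card_eq_one]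
      refine ⟨b, Finset.ext fun a => ?_⟩
      simp only [Finset.mem_filter, Finset.mem_univ, true_and, Finset.mem_singleton]
      constructor
      · rintro ⟨h1, h2⟩
        exact h2.eq_of_rel hb (Setoid.trans' _ (Setoid.symm' _ h1) hxb)
      · rintro rfl
        exact ⟨hxb, hb⟩
    · rw [if_neg h, Finset.card_eq_zero, Finset.filter_eq_empty_iff]
      rintro a - ⟨hxa, ha⟩
      exact hs.not_rel_bar_of_rel (Setoid.symm' _ hxa) ha.not_rel_bar (not_not.1 h)
  have h3 : {x : Pt N | π (bar x) x} = ↑(Finset.univ.filter fun x : Pt N => π (bar x) x) := by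
    simp
  rw [Finset.sum_congr rfl fun a _ => h1 a, Finset.sum_comm, Finset.sum_congr rfl fun x _ => h2 x,
    Finset.sum_boole, Nat.cast_id, h3, Set.ncard_coe_finset, Finset.card_filter_add_card_filter_not,
    Finset.card_univ, ZMod.card]

theorem forall_dvd_ncard_iff {m : ℕ} (hm : m ∣ N) :
    (∀ B ∈ π.classes, m ∣ B.ncard) ↔ ∀ a, m ∣ openedSize π a := by
  constructor
  · intro h a
    rw [openedSize]
    split_ifs with ha
    · exact h _ ⟨a, rfl⟩
    · exact dvd_zero m
  · rintro h _ ⟨y, rfl⟩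
    by_cases hy : π (bar y) y
    · have h2 := ncard_zeroBlock_add hn hs
      rw [setOf_rel_eq_zeroBlock hn hs hy]
      exact (Nat.dvd_add_left (Finset.dvd_sum fun a _ => h a)).1 (h2 ▸ hm.mul_left 2)
    · obtain ⟨b, hb, hyb⟩ := exists_isOpener hn hs hy
      rw [setOf_rel_eq hyb, ← openedSize_of_isOpener hb]
      exact h b

end

end TypeB

/-! ### Positive partitions and words -/

namespace TypeB

variable {N : ℕ}

/-- The sizes of the blocks which start at the integer points, for a word `w` of length `N - 1`:
the letters of `w`, multiplied by `m`, belong to the points `1, …, N - 1` of each half-turn, and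
no block starts at a multiple of `N`. -/
def wordSize (N m : ℕ) (w : ZMod (N - 1) → ℕ) (x : ℤ) : ℕ :=
  if (N : ℤ) ∣ x then 0 else m * w ((x % N - 1 : ℤ) : ZMod (N - 1))

/-- The partition with the block sizes given by a word. -/
noncomputable def ofWord (N m : ℕ) (w : ZMod (N - 1) → ℕ) : Setoid (Pt N) :=
  partition N (height (wordSize N m w))

theorem wordSize_of_dvd {m : ℕ} (w : ZMod (N - 1) → ℕ) {x : ℤ} (h : (N : ℤ) ∣ x) :
    wordSize N m w x = 0 := if_pos h

theorem wordSize_of_not_dvd {m : ℕ} (w : ZMod (N - 1) → ℕ) {x : ℤ} (h : ¬ (N : ℤ) ∣ x) :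
    wordSize N m w x = m * w ((x % N - 1 : ℤ) : ZMod (N - 1)) := if_neg h

theorem wordSize_add (m : ℕ) (w : ZMod (N - 1) → ℕ) (x : ℤ) :
    wordSize N m w (x + N) = wordSize N m w x := by
  rw [wordSize, wordSize, Int.add_emod_right]
  simp only [dvd_add_left (dvd_refl (N : ℤ))]

theorem wordSize_natCast_succ (m : ℕ) (w : ZMod (N - 1) → ℕ) {i : ℕ} (hi : i < N - 1) :
    wordSize N m w ((i + 1 : ℕ) : ℤ) = m * w (i : ZMod (N - 1)) := by
  rw [wordSize_of_not_dvd _ (not_dvd_of_pos_of_lt (by omega) (by omega)),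
    Int.emod_eq_of_lt (by omega) (by omega)]
  push_cast
  rw [add_sub_cancel_right]

section

variable [NeZero (N - 1)]

variable (N) in
theorem two_le_of_neZero : 2 ≤ N := by
  have := NeZero.ne (N - 1)
  omega

theorem sum_wordSize (m : ℕ) (w : ZMod (N - 1) → ℕ) (f : ℕ → ℕ) (h0 : f 0 = 0) :
    ∑ i ∈ Finset.range N, f (wordSize N m w i) = ∑ j, f (m * w j) := by
  have hN := two_le_of_neZero N
  rw [show Finset.range N = Finset.range (N - 1 + 1) by congr 1; omega, Finset.sum_range_succ',
    Nat.cast_zero, wordSize_of_dvd _ (dvd_zero _), h0, add_zero,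
    sum_zmod (fun j => f (m * w j)) rfl]
  refine Finset.sum_congr rfl fun i hi => ?_
  rw [wordSize_natCast_succ m w (Finset.mem_range.1 hi)]

variable {m : ℕ} {w : ZMod (N - 1) → ℕ} (hw : m * ∑ j, w j ≤ N)
include hw

theorem isHeight_wordSize : IsHeight N (height (wordSize N m w)) := by
  refine isHeight_height (wordSize_add m w) ?_
  rw [sum_wordSize m w (fun i => i) rfl, ← Finset.mul_sum]
  exact hw

variable [NeZero N]

theorem openedSize_ofWord (x : ℤ) :
    openedSize (ofWord N m w) (x : Pt N) = wordSize N m w x := by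
  rw [ofWord, openedSize_partition (isHeight_wordSize hw), height_succ]
  omega

theorem ofWord_isNoncrossing : IsNoncrossing (ofWord N m w) :=
  partition_isNoncrossing (isHeight_wordSize hw)

theorem ofWord_isSymmetric : IsSymmetric (ofWord N m w) :=
  partition_isSymmetric (isHeight_wordSize hw)

theorem sum_openedSize_ofWord (f : ℕ → ℕ) (h0 : f 0 = 0) :
    ∑ a, f (openedSize (ofWord N m w) a) = 2 * ∑ j, f (m * w j) := by
  rw [sum_pt_of_bar (fun a => f (openedSize (ofWord N m w) a))
    fun a => by rw [(ofWord_isSymmetric hw).openedSize_bar], ← sum_wordSize m w f h0]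
  congr 1
  refine Finset.sum_congr rfl fun i _ => ?_
  rw [← Int.cast_natCast, openedSize_ofWord hw]

/-- On the partitions given by words, the pseudo-rotation is the rotation of the words. -/
theorem kappa_ofWord : kappa (ofWord N m w) = ofWord N m fun j => w (j - 1) := by
  have hN := two_le_of_neZero N
  have hH := isHeight_wordSize hw
  have h0 : height (wordSize N m w) 1 = height (wordSize N m w) 0 - 1 := by
    rw [show (1 : ℤ) = 0 + 1 by ring, height_succ, wordSize_of_dvd _ (dvd_zero _)]
    push_cast
    ring
  have hG := isHeight_moveOpener hH hN h0
  have hG' : IsHeight N fun x => moveOpener N (height (wordSize N m w)) (x - 1) := by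
    refine ⟨fun x => ?_, fun x => ?_, ?_⟩
    · have := hG.step (x - 1)
      rwa [show x - 1 + 1 = x + 1 - 1 by ring] at this
    · have h1 := hG.per (x - 1)
      have h2 := hG.per (-1)
      rw [show (N : ℤ) - 1 = -1 + N by ring, h2, zero_sub, show x + N - 1 = x - 1 + N by ring, h1]
      ring
    · have h2 := hG.per (-1)
      have := hG.nonpos
      rw [show (N : ℤ) - 1 = -1 + N by ring, h2, zero_sub]
      omega
  rw [ofWord, kappa_partition hH hN h0, ← partition_comp_sub_one hG hG', ofWord]
  refine partition_congr fun x => ?_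
  rw [add_sub_cancel_right, height_succ]
  have hsucc (x : ℤ) : height (wordSize N m w) x =
      height (wordSize N m w) (x - 1) + wordSize N m w (x - 1) - 1 := by
    rw [← height_succ, sub_add_cancel]
  have hpos : (0 : ℤ) < N := by omega
  by_cases h1 : (N : ℤ) ∣ x
  · have h2 : ¬ (N : ℤ) ∣ x - 1 := fun h => by
      have := Int.le_of_dvd one_pos ((dvd_sub_right h1).1 h)
      omega
    rw [moveOpener_of_dvd h1, moveOpener_of_not_dvd h2, wordSize_of_dvd _ h1]
    push_cast
    ring
  rw [moveOpener_of_not_dvd h1, hsucc, wordSize_of_not_dvd _ h1]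
  have hmod := Int.emod_add_mul_ediv x N
  have hmod0 := Int.emod_nonneg x hpos.ne'
  have hmod1 := Int.emod_lt_of_pos x hpos
  have hmod2 : x % N ≠ 0 := fun h => h1 (Int.dvd_of_emod_eq_zero h)
  by_cases h2 : (N : ℤ) ∣ x - 1
  · obtain ⟨k, hk⟩ := h2
    have e1 : x % N = 1 := by
      rw [show x = 1 + N * k by omega, Int.add_mul_emod_self_left]
      exact Int.emod_eq_of_lt (by omega) (by omega)
    have e2 : (x - 1 - 1) % N = N - 1 := by
      rw [show x - 1 - 1 = N - 1 + N * (k - 1) by rw [hk]; ring, Int.add_mul_emod_self_left]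
      exact Int.emod_eq_of_lt (by omega) (by omega)
    have h3 : ¬ (N : ℤ) ∣ x - 1 - 1 := fun h => by
      rw [Int.emod_eq_zero_of_dvd h] at e2
      omega
    have e3 : ((N - 1 - 1 : ℤ) : ZMod (N - 1)) = -1 := by
      have : ((N - 1 : ℕ) : ZMod (N - 1)) = 0 := ZMod.natCast_self _
      rw [Nat.cast_sub (by omega)] at this
      push_cast at this ⊢
      rw [this, zero_sub]
    rw [wordSize_of_dvd _ ⟨k, hk⟩, moveOpener_of_dvd ⟨k, hk⟩, hsucc (x - 1),
      wordSize_of_not_dvd _ h3, e1, e2, e3]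
    push_cast
    rw [zero_sub]
    ring
  · have e1 : (x - 1) % N = x % N - 1 := by
      rw [show x - 1 = x % N - 1 + N * (x / N) by omega, Int.add_mul_emod_self_left]
      exact Int.emod_eq_of_lt (by omega) (by omega)
    rw [moveOpener_of_not_dvd h2, wordSize_of_not_dvd _ h2, e1]
    push_cast
    ring

end

/-- The positive `m`-divisible partitions correspond to the words with sum at most `n`. -/
theorem bijOn_ofWord {m n : ℕ} [NeZero (m * n - 1)] :
    Set.BijOn (ofWord (m * n) m) {w | ∑ j, w j ≤ n} (mNCBPlus m n) := by
  have hN := two_le_of_neZero (m * n)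
  have : NeZero (m * n) := ⟨by omega⟩
  have hm : 0 < m := Nat.pos_of_mul_pos_right (by omega : 0 < m * n)
  have hmul {w : ZMod (m * n - 1) → ℕ} (hw : ∑ j, w j ≤ n) : m * ∑ j, w j ≤ m * n :=
    Nat.mul_le_mul_left m hw
  refine ⟨fun w hw => ?_, fun w hw w' hw' h => ?_, fun π hπ => ?_⟩
  · have hw := hmul hw
    have hn := ofWord_isNoncrossing hw
    have hs := ofWord_isSymmetric hw
    refine ⟨⟨hn, hs, (forall_dvd_ncard_iff hn hs (dvd_mul_right m n)).2 fun a => ?_⟩,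
      isPositive_iff.2 ?_⟩
    · obtain ⟨x, rfl⟩ := ZMod.intCast_surjective a
      rw [openedSize_ofWord hw, wordSize]
      split_ifs
      · exact dvd_zero m
      · exact dvd_mul_right m _
    · rw [openedSize_ofWord hw, wordSize_of_dvd _ (dvd_zero _)]
  · funext j
    have h1 := openedSize_ofWord (hmul hw) ((j.val + 1 : ℕ) : ℤ)
    have h2 := openedSize_ofWord (hmul hw') ((j.val + 1 : ℕ) : ℤ)
    rw [wordSize_natCast_succ _ _ (ZMod.val_lt j), ZMod.natCast_zmod_val] at h1 h2
    rw [h, h2] at h1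
    exact (Nat.eq_of_mul_eq_mul_left hm h1).symm
  · obtain ⟨⟨hn, hs, hd⟩, hp⟩ := hπ
    rw [forall_dvd_ncard_iff hn hs (dvd_mul_right m n)] at hd
    rw [isPositive_iff] at hp
    obtain ⟨w, hw⟩ : ∃ w : ZMod (m * n - 1) → ℕ, ∀ i < m * n - 1,
        openedSize π (((i + 1 : ℕ) : ℤ) : Pt (m * n)) = m * w i := by
      choose c hc using hd
      refine ⟨fun j => c ((j.val + 1 : ℕ) : ℤ), fun i hi => ?_⟩
      simp only [hc, ZMod.val_natCast_of_lt hi]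
    have hper : Function.Periodic (fun x : ℤ => openedSize π (x : Pt (m * n))) ((m * n : ℕ) : ℤ) :=
      fun x => by simp only [← bar_intCast, hs.openedSize_bar]
    have hsize : (fun x : ℤ => openedSize π (x : Pt (m * n))) = wordSize (m * n) m w := by
      funext x
      have hpos : (0 : ℤ) < (m * n : ℕ) := by omega
      have h1 : openedSize π (x : Pt (m * n)) =
          openedSize π ((x % (m * n : ℕ) : ℤ) : Pt (m * n)) := by
        have := hper.int_mul (x / (m * n : ℕ)) (x % (m * n : ℕ))
        rw [Int.cast_id, mul_comm (x / _), Int.emod_add_mul_ediv] at this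
        exact this
      rw [h1]
      have hmod0 := Int.emod_nonneg x hpos.ne'
      have hmod1 := Int.emod_lt_of_pos x hpos
      by_cases hx : ((m * n : ℕ) : ℤ) ∣ x
      · rw [wordSize_of_dvd _ hx, Int.emod_eq_zero_of_dvd hx, hp]
      · have hmod2 : x % (m * n : ℕ) ≠ 0 := fun h => hx (Int.dvd_of_emod_eq_zero h)
        have h2 := hw (x % (m * n : ℕ) - 1).toNat (by omega)
        have e : (((x % (m * n : ℕ) - 1).toNat : ℕ) : ℤ) = x % (m * n : ℕ) - 1 := by omega
        rw [Nat.cast_succ, e, sub_add_cancel] at h2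
        rw [wordSize_of_not_dvd _ hx, h2, ← Int.cast_natCast, e]
    have hsum : ∑ j, w j ≤ n := by
      have h1 := sum_openedSize_univ_le π
      rw [sum_pt_of_bar _ hs.openedSize_bar] at h1
      have h2 := sum_wordSize m w (fun i => i) rfl
      rw [← hsize] at h2
      simp only [Int.cast_natCast, ← Finset.mul_sum] at h2
      rw [h2] at h1
      exact Nat.le_of_mul_le_mul_left (by omega : m * ∑ j, w j ≤ m * n) hm
    exact ⟨w, hsum, by rw [ofWord, ← hsize]; exact partition_heightOf hn hs⟩

end TypeB

/-! ### The rank -/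

namespace TypeB

variable {N : ℕ}

theorem sub_bar (a b : Pt N) : a - bar b = bar (a - b) := by
  rw [eq_bar_iff]
  simp only [bar]
  ring

theorem val_bar [NeZero N] (a : Pt N) :
    (a.val < N ∧ (bar a).val = a.val + N) ∨ (N ≤ a.val ∧ (bar a).val + N = a.val) := by
  have hN := NeZero.pos N
  have hv : (N : Pt N).val = N := ZMod.val_natCast_of_lt (by omega)
  have ha := ZMod.val_lt a
  rcases lt_or_ge a.val N with h | h
  · refine Or.inl ⟨h, ?_⟩
    rw [bar, ZMod.val_add_of_lt (by rw [hv]; omega), hv]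
  · refine Or.inr ⟨h, ?_⟩
    have := ZMod.val_add_val_of_le (a := a) (b := (N : Pt N)) (by rw [hv]; omega)
    rw [bar]
    omega

theorem val_sub_cases [NeZero N] (a b : Pt N) :
    a.val = (a - b).val + b.val ∨ a.val + 2 * N = (a - b).val + b.val := by
  rcases lt_or_ge ((a - b).val + b.val) (2 * N) with h | h
  · left
    rw [← ZMod.val_add_of_lt h, sub_add_cancel]
  · right
    rw [ZMod.val_add_val_of_le h, sub_add_cancel]

/-- The elements of the block of `y` which are among the `j` points from `y` on. -/
def arcPart (π : Setoid (Pt N)) (y : Pt N) (j : ℕ) : Set (Pt N) := {x | π x y ∧ (x - y).val < j}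

/-- The partition in which the elements of the block of `y` which are among the `j` points from
`y` on are separated from this block, and likewise their antipodes. -/
def splitOff (π : Setoid (Pt N)) (y : Pt N) (j : ℕ) : Setoid (Pt N) :=
  π ⊓ Setoid.ker (· ∈ arcPart π y j) ⊓ Setoid.ker (· ∈ arcPart π (bar y) j)

theorem splitOff_iff {π : Setoid (Pt N)} {y : Pt N} {j : ℕ} {a b : Pt N} :
    splitOff π y j a b ↔ π a b ∧ (a ∈ arcPart π y j ↔ b ∈ arcPart π y j) ∧
      (a ∈ arcPart π (bar y) j ↔ b ∈ arcPart π (bar y) j) := by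
  change (π a b ∧ (a ∈ arcPart π y j) = (b ∈ arcPart π y j)) ∧
    (a ∈ arcPart π (bar y) j) = (b ∈ arcPart π (bar y) j) ↔ _
  rw [eq_iff_iff, eq_iff_iff, and_assoc]

theorem splitOff_le (π : Setoid (Pt N)) (y : Pt N) (j : ℕ) : splitOff π y j ≤ π := fun _ _ h =>
  (splitOff_iff.1 h).1

section

variable {π : Setoid (Pt N)} (hn : IsNoncrossing π) (hs : IsSymmetric π)

include hs in
theorem bar_mem_arcPart {y : Pt N} {j : ℕ} {a : Pt N} :
    bar a ∈ arcPart π (bar y) j ↔ a ∈ arcPart π y j := by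
  rw [arcPart, arcPart, Set.mem_ofPred_eq, Set.mem_ofPred_eq, hs.bar_iff, bar, bar,
    add_sub_add_right_eq_sub]

include hs in
theorem ncard_arcPart_bar (y : Pt N) (j : ℕ) :
    (arcPart π (bar y) j).ncard = (arcPart π y j).ncard := by
  have h : arcPart π (bar y) j = bar '' arcPart π y j := by
    ext x
    rw [← bar_bar x, bar_mem_arcPart hs, Function.Injective.mem_set_image bar_injective]
  rw [h, Set.ncard_image_of_injective _ bar_injective]

include hs in
theorem splitOff_isSymmetric (y : Pt N) (j : ℕ) : IsSymmetric (splitOff π y j) := by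
  intro a b h
  rw [splitOff_iff] at h ⊢
  have e (x : Pt N) : bar x ∈ arcPart π y j ↔ x ∈ arcPart π (bar y) j := by
    rw [← bar_mem_arcPart hs, bar_bar]
  rw [hs.bar_iff, bar_mem_arcPart hs, bar_mem_arcPart hs, e, e]
  exact ⟨h.1, h.2.2, h.2.1⟩

variable [NeZero N]

/-- The parts of a block in an arc and outside of it do not cross. -/
theorem mem_arcPart_iff_of_lt {y : Pt N} {j : ℕ} {a b c d : Pt N} (hab : a.val < b.val)
    (hbc : b.val < c.val) (hcd : c.val < d.val) (h : π a b) (hac : π a c) (hbd : π b d)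
    (h1 : a ∈ arcPart π y j ↔ c ∈ arcPart π y j) (h2 : b ∈ arcPart π y j ↔ d ∈ arcPart π y j) :
    a ∈ arcPart π y j ↔ b ∈ arcPart π y j := by
  by_cases ha : π a y
  · have hb : π b y := Setoid.trans' _ (Setoid.symm' _ h) ha
    have hc : π c y := Setoid.trans' _ (Setoid.symm' _ hac) ha
    have hd : π d y := Setoid.trans' _ (Setoid.symm' _ hbd) hb
    simp only [arcPart, Set.mem_ofPred_eq, ha, hb, hc, hd, true_and] at h1 h2 ⊢
    have ha1 := val_sub_cases a y
    have hb1 := val_sub_cases b y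
    have hc1 := val_sub_cases c y
    have hd1 := val_sub_cases d y
    have ha2 := ZMod.val_lt (a - y)
    have hb2 := ZMod.val_lt (b - y)
    have hc2 := ZMod.val_lt (c - y)
    have hd2 := ZMod.val_lt (d - y)
    have hd3 := ZMod.val_lt d
    omega
  · exact iff_of_false (fun h' => ha h'.1) fun h' => ha (Setoid.trans' _ h h'.1)

include hn in
theorem splitOff_isNoncrossing (y : Pt N) (j : ℕ) : IsNoncrossing (splitOff π y j) := by
  intro a b c d hab hbc hcd hac hbd
  rw [splitOff_iff] at hac hbd ⊢
  have h := hn a b c d hab hbc hcd hac.1 hbd.1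
  exact ⟨h, mem_arcPart_iff_of_lt hab hbc hcd h hac.1 hbd.1 hac.2.1 hbd.2.1,
    mem_arcPart_iff_of_lt hab hbc hcd h hac.1 hbd.1 hac.2.2 hbd.2.2⟩

theorem notMem_arcPart_bar {y : Pt N} {j : ℕ} (hj : j ≤ N) {a : Pt N} (ha : a ∈ arcPart π y j) :
    a ∉ arcPart π (bar y) j := by
  intro h
  have h1 := ha.2
  have h2 := h.2
  rw [sub_bar] at h2
  have := val_bar (a - y)
  omega

omit [NeZero N] in
theorem self_mem_arcPart (π : Setoid (Pt N)) (y : Pt N) {j : ℕ} (hj : 0 < j) :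
    y ∈ arcPart π y j := ⟨Setoid.refl' _ _, by rwa [sub_self, ZMod.val_zero]⟩

theorem isOpener_splitOff {y : Pt N} {j : ℕ} (hj0 : 0 < j) (hj : j ≤ N) :
    IsOpener (splitOff π y j) y := by
  intro i hi0 hi h
  have h1 := ((splitOff_iff.1 h).2.1.2 (self_mem_arcPart π y hj0)).2
  rw [sub_sub_cancel_left, ZMod.neg_val] at h1
  have h2 : (i : Pt N).val = i := ZMod.val_natCast_of_lt (by omega)
  rw [if_neg (fun h => by rw [h, ZMod.val_zero] at h2; omega), h2] at h1
  omega

theorem setOf_splitOff_of_mem {y : Pt N} {j : ℕ} (hj : j ≤ N) {c : Pt N}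
    (hc : c ∈ arcPart π y j) : {x | splitOff π y j x c} = arcPart π y j := by
  ext x
  simp only [Set.mem_ofPred_eq, splitOff_iff]
  constructor
  · rintro ⟨-, h, -⟩
    exact h.2 hc
  · intro hx
    exact ⟨Setoid.trans' _ hx.1 (Setoid.symm' _ hc.1), iff_of_true hx hc,
      iff_of_false (notMem_arcPart_bar hj hx) (notMem_arcPart_bar hj hc)⟩

omit [NeZero N] in
theorem dvd_ncard_inter_arcPart {m : ℕ} {y c : Pt N} {j : ℕ} (hm : (arcPart π y j).ncard = m) :
    m ∣ ({x | π x c} ∩ arcPart π y j).ncard := by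
  by_cases hc : π c y
  · have : arcPart π y j ⊆ {x | π x c} := fun x hx => Setoid.trans' _ hx.1 (Setoid.symm' _ hc)
    rw [Set.inter_eq_right.2 this, hm]
  · have : {x | π x c} ∩ arcPart π y j = ∅ := Set.eq_empty_iff_forall_notMem.2 fun x hx =>
      hc (Setoid.trans' _ (Setoid.symm' _ hx.1) hx.2.1)
    rw [this, Set.ncard_empty]
    exact dvd_zero m

include hs in
theorem dvd_ncard_splitOff {m : ℕ} {y : Pt N} {j : ℕ} (hj : j ≤ N)
    (hm : (arcPart π y j).ncard = m) (hd : ∀ B ∈ π.classes, m ∣ B.ncard) :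
    ∀ B ∈ (splitOff π y j).classes, m ∣ B.ncard := by
  rintro _ ⟨c, rfl⟩
  have hm' : (arcPart π (bar y) j).ncard = m := (ncard_arcPart_bar hs y j).trans hm
  have hsymm : splitOff π (bar y) j = splitOff π y j := by
    rw [splitOff, splitOff, bar_bar, inf_assoc, inf_assoc, inf_comm (Setoid.ker _)]
  by_cases h1 : c ∈ arcPart π y j
  · rw [setOf_splitOff_of_mem hj h1, hm]
  by_cases h2 : c ∈ arcPart π (bar y) j
  · rw [← hsymm, setOf_splitOff_of_mem hj h2, hm']
  have h3 : {x | splitOff π y j x c} = ({x | π x c} \ arcPart π y j) \ arcPart π (bar y) j := by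
    ext x
    simp only [Set.mem_ofPred_eq, splitOff_iff, Set.mem_sdiff]
    tauto
  have h4 := Set.ncard_inter_add_ncard_sdiff_eq_ncard {x | π x c} (arcPart π y j) (Set.toFinite _)
  have h5 := Set.ncard_inter_add_ncard_sdiff_eq_ncard ({x | π x c} \ arcPart π y j)
    (arcPart π (bar y) j) (Set.toFinite _)
  have h6 : ({x | π x c} \ arcPart π y j) ∩ arcPart π (bar y) j =
      {x | π x c} ∩ arcPart π (bar y) j := by
    ext x
    simp only [Set.mem_inter_iff, Set.mem_sdiff]
    have := @notMem_arcPart_bar N π _ y j hj x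
    tauto
  rw [h6] at h5
  have h7 := (Nat.dvd_add_right (dvd_ncard_inter_arcPart hm)).1 (h4 ▸ hd _ ⟨c, rfl⟩)
  rw [h3]
  exact (Nat.dvd_add_right (dvd_ncard_inter_arcPart hm')).1 (h5 ▸ h7)

include hn hs

theorem ncard_nonzeroBlocks_eq_isOpener :
    (nonzeroBlocks π).ncard = {a | IsOpener π a}.ncard := by
  classical
  rw [ncard_nonzeroBlocks hn hs, Finset.sum_boole, Nat.cast_id, ← Set.ncard_coe_finset]
  congr 1
  ext a
  simp [openedSize_eq_zero_iff]

/-- If a part of a block and the antipodes of this part are separated from their blocks, then the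
number of non-zero blocks increases by at most two. -/
theorem ncard_nonzeroBlocks_splitOff_le {y : Pt N} {j : ℕ} (hj0 : 0 < j) (hj : j ≤ N) :
    (nonzeroBlocks (splitOff π y j)).ncard ≤ (nonzeroBlocks π).ncard + 2 := by
  have hs' := splitOff_isSymmetric hs y j
  have hy := isOpener_splitOff (π := π) (y := y) hj0 hj
  have hy' := (hs'.isOpener_bar_iff y).2 hy
  rw [ncard_nonzeroBlocks_eq_isOpener (splitOff_isNoncrossing hn y j) hs']
  have h1 : {a | IsOpener (splitOff π y j) a} ⊆
      ({a | IsOpener (splitOff π y j) a} \ {y, bar y}) ∪ {y, bar y} := by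
    rw [Set.sdiff_union_self]
    exact Set.subset_union_left
  refine (Set.ncard_le_ncard h1 (Set.toFinite _)).trans ((Set.ncard_union_le _ _).trans
    (Nat.add_le_add ?_ ((Set.ncard_insert_le _ _).trans
      (by rw [Set.ncard_singleton]))))
  have hbar : bar y ∈ arcPart π (bar y) j := (bar_mem_arcPart hs).2 (self_mem_arcPart π y hj0)
  -- the other first elements are outside of the two separated parts
  have h2 : ∀ a ∈ {a | IsOpener (splitOff π y j) a} \ {y, bar y},
      a ∉ arcPart π y j ∧ a ∉ arcPart π (bar y) j := by
    rintro a ⟨ha, hne⟩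
    rw [Set.mem_insert_iff, Set.mem_singleton_iff, not_or] at hne
    refine ⟨fun h => hne.1 (IsOpener.eq_of_rel ha hy (splitOff_iff.2 ⟨h.1, ?_, ?_⟩)),
      fun h => hne.2 (IsOpener.eq_of_rel ha hy' (splitOff_iff.2 ⟨h.1, ?_, ?_⟩))⟩
    · exact iff_of_true h (self_mem_arcPart π y hj0)
    · exact iff_of_false (notMem_arcPart_bar hj h)
        (notMem_arcPart_bar hj (self_mem_arcPart π y hj0))
    · exact iff_of_false (fun h' => notMem_arcPart_bar hj h' h)
        fun h' => notMem_arcPart_bar hj h' hbar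
    · exact iff_of_true h hbar
  refine Set.ncard_le_ncard_of_injOn (fun a => {x | π x a}) (fun a ha => ?_)
    (fun a ha b hb hab => ?_) (Set.toFinite _)
  · refine ⟨⟨a, rfl⟩, fun h => ?_⟩
    rw [hs.bar_image] at h
    have h3 := Set.ext_iff.1 h (bar a) |>.1 (Setoid.refl' _ _)
    refine ha.1.not_rel_bar (splitOff_iff.2 ⟨h3, iff_of_false (fun h4 => ?_) (h2 a ha).1,
      iff_of_false (fun h4 => ?_) (h2 a ha).2⟩)
    · rw [← bar_mem_arcPart hs, bar_bar] at h4
      exact (h2 a ha).2 h4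
    · exact (h2 a ha).1 ((bar_mem_arcPart hs).1 h4)
  · exact IsOpener.eq_of_rel ha.1 hb.1 (splitOff_iff.2
      ⟨Set.ext_iff.1 hab a |>.1 (Setoid.refl' _ _), iff_of_false (h2 a ha).1 (h2 b hb).1,
        iff_of_false (h2 a ha).2 (h2 b hb).2⟩)

omit hn in
theorem ncard_rel_le_of_rel_bar {y : Pt N} (hy : π (bar y) y) :
    {x | π x y}.ncard ≤ 2 * (arcPart π y N).ncard := by
  have h : {x | π x y} ⊆ arcPart π y N ∪ arcPart π (bar y) N := by
    intro x hx
    have h1 := val_bar (x - y)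
    have h2 := ZMod.val_lt (x - y)
    rcases lt_or_ge (x - y).val N with h | h
    · exact Or.inl ⟨hx, h⟩
    · refine Or.inr ⟨Setoid.trans' _ hx (Setoid.symm' _ hy), ?_⟩
      rw [sub_bar]
      omega
  refine (Set.ncard_le_ncard h (Set.toFinite _)).trans ((Set.ncard_union_le _ _).trans ?_)
  rw [ncard_arcPart_bar hs, two_mul]

omit hn hs in
theorem IsOpener.arcPart_eq {y : Pt N} (hy : IsOpener π y) : arcPart π y N = {x | π x y} := by
  ext x
  refine ⟨fun h => h.1, fun h => ⟨h, ?_⟩⟩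
  by_contra hc
  have h1 := ZMod.val_lt (x - y)
  refine hy (2 * N - (x - y).val) (by omega) (by omega) ?_
  rw [Nat.cast_sub h1.le, natCast_two_mul_self, ZMod.natCast_zmod_val, zero_sub, sub_neg_eq_add,
    add_sub_cancel]
  exact h

omit hn hs in
theorem exists_ncard_arcPart_eq {y : Pt N} {m k : ℕ} (h : m ≤ (arcPart π y k).ncard) :
    ∃ j ≤ k, (arcPart π y j).ncard = m := by
  induction k with
  | zero =>
    refine ⟨0, le_rfl, le_antisymm ?_ h⟩
    rw [show arcPart π y 0 = ∅ from Set.eq_empty_iff_forall_notMem.2 fun x hx =>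
      Nat.not_lt_zero _ hx.2, Set.ncard_empty]
    exact Nat.zero_le m
  | succ k ih =>
    rcases Nat.lt_or_ge (arcPart π y k).ncard m with hlt | hge
    · refine ⟨k + 1, le_rfl, le_antisymm ?_ h⟩
      have hsub : arcPart π y (k + 1) ⊆ insert (y + (k : Pt N)) (arcPart π y k) := by
        intro x hx
        rcases (Nat.lt_succ_iff.1 hx.2).eq_or_lt with he | hl
        · left
          rw [← he, ZMod.natCast_zmod_val, add_sub_cancel]
        · exact Or.inr ⟨hx.1, hl⟩
      have := (Set.ncard_le_ncard hsub (Set.toFinite _)).trans (Set.ncard_insert_le _ _)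
      omega
    · obtain ⟨j, hj, hj'⟩ := ih hge
      exact ⟨j, by omega, hj'⟩

/-- The number of non-zero blocks is even. -/
theorem even_ncard_nonzeroBlocks : Even (nonzeroBlocks π).ncard := by
  rw [ncard_nonzeroBlocks hn hs, sum_pt_of_bar _ fun a => by rw [hs.openedSize_bar]]
  exact even_two_mul _

theorem mul_ncard_nonzeroBlocks_le {m : ℕ} (hd : ∀ a, m ∣ openedSize π a) :
    m * (nonzeroBlocks π).ncard ≤ 2 * N := by
  refine le_trans ?_ (sum_openedSize_univ_le π)
  rw [ncard_nonzeroBlocks hn hs, Finset.mul_sum]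
  refine Finset.sum_le_sum fun a _ => ?_
  split_ifs with h
  · rw [mul_one]
    exact Nat.le_of_dvd (Nat.pos_of_ne_zero h) (hd a)
  · exact Nat.zero_le _

/-- If there are less than `2n` non-zero blocks, then some block is large enough to be split. -/
theorem exists_arcPart {m n : ℕ} (hN : N = m * n) (hm : 0 < m)
    (hlt : (nonzeroBlocks π).ncard < 2 * n) :
    ∃ y j, 0 < j ∧ j ≤ N ∧ (arcPart π y j).ncard = m ∧ m < {x | π x y}.ncard := by
  suffices h : ∃ y, m ≤ (arcPart π y N).ncard ∧ m < {x | π x y}.ncard by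
    obtain ⟨y, h1, h2⟩ := h
    obtain ⟨j, hj, hj'⟩ := exists_ncard_arcPart_eq h1
    refine ⟨y, j, Nat.pos_of_ne_zero ?_, hj, hj', h2⟩
    rintro rfl
    rw [show arcPart π y 0 = ∅ from Set.eq_empty_iff_forall_notMem.2 fun x hx =>
      Nat.not_lt_zero _ hx.2, Set.ncard_empty] at hj'
    omega
  by_cases h : ∃ y, m < openedSize π y
  · obtain ⟨y, hy⟩ := h
    have hop : IsOpener π y := by
      by_contra hc
      rw [openedSize_eq_zero_iff.2 hc] at hy
      omega
    rw [openedSize_of_isOpener hop] at hy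
    exact ⟨y, by rw [hop.arcPart_eq]; exact hy.le, hy⟩
  · -- otherwise the non-zero blocks have at most `m` elements, and the zero block is large
    push Not at h
    have h1 : ∑ a, openedSize π a ≤ m * (nonzeroBlocks π).ncard := by
      rw [ncard_nonzeroBlocks hn hs, Finset.mul_sum]
      refine Finset.sum_le_sum fun a _ => ?_
      split_ifs with h0
      · rw [mul_one]
        exact h a
      · exact (not_not.1 h0).le
    have h2 := ncard_zeroBlock_add hn hs
    obtain ⟨k, hk⟩ := even_ncard_nonzeroBlocks hn hs
    have h3 : m * (k + 1) ≤ m * n := Nat.mul_le_mul_left m (by omega)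
    rw [hk, Nat.mul_add] at h1
    rw [Nat.mul_add, mul_one] at h3
    obtain ⟨y, hy⟩ := Set.nonempty_of_ncard_ne_zero (s := {x | π (bar x) x}) (by omega)
    have h4 := ncard_rel_le_of_rel_bar hs hy
    have h5 := setOf_rel_eq_zeroBlock hn hs hy
    rw [h5] at h4
    exact ⟨y, by omega, by rw [h5]; omega⟩

/-- A coarsening without loss of first elements is trivial. -/
theorem eq_of_le_of_isOpener {π' : Setoid (Pt N)} (hs' : IsSymmetric π') (hle : π ≤ π')
    (h : ∀ a, IsOpener π a → IsOpener π' a) : π = π' := by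
  have hz {a b : Pt N} (hab : π' a b) (ha : π (bar a) a) : π (bar b) b := by
    by_contra hb
    obtain ⟨c, hc, hbc⟩ := exists_isOpener hn hs hb
    exact hs'.not_rel_bar_of_rel (Setoid.symm' _ (Setoid.trans' _ hab (hle hbc)))
      (h c hc).not_rel_bar (hle ha)
  refine le_antisymm hle fun {a b} hab => ?_
  by_cases ha : π (bar a) a
  · exact rel_of_rel_bar hn hs ha (hz hab ha)
  · have hb : ¬ π (bar b) b := fun hb => ha (hz (Setoid.symm' _ hab) hb)
    obtain ⟨c, hc, hac⟩ := exists_isOpener hn hs ha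
    obtain ⟨d, hd, hbd⟩ := exists_isOpener hn hs hb
    have hcd : c = d := (h c hc).eq_of_rel (h d hd)
      (Setoid.trans' _ (Setoid.symm' _ (hle hac)) (Setoid.trans' _ hab (hle hbd)))
    subst hcd
    exact Setoid.trans' _ hac (Setoid.symm' _ hbd)

theorem ncard_nonzeroBlocks_lt {π' : Setoid (Pt N)} (hn' : IsNoncrossing π')
    (hs' : IsSymmetric π') (hlt : π < π') :
    (nonzeroBlocks π').ncard < (nonzeroBlocks π).ncard := by
  rw [ncard_nonzeroBlocks_eq_isOpener hn hs, ncard_nonzeroBlocks_eq_isOpener hn' hs']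
  refine Set.ncard_lt_ncard (Set.ssubset_iff_subset_ne.2
    ⟨fun a ha i h0 hi h => ha i h0 hi (hlt.le h), fun he => ?_⟩) (Set.toFinite _)
  exact hlt.ne (eq_of_le_of_isOpener hn hs hs' hlt.le fun a ha => by
    rw [← Set.mem_ofPred_eq (p := IsOpener π'), he]
    exact ha)

end

section

variable {m n : ℕ} [NeZero (m * n)]

theorem ncard_nonzeroBlocks_le (π : mNCB m n) :
    (nonzeroBlocks (π : Setoid (Pt (m * n)))).ncard ≤ 2 * n := by
  obtain ⟨π, hn, hs, hd⟩ := π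
  have hm : 0 < m := Nat.pos_of_mul_pos_right (NeZero.pos (m * n))
  have h := mul_ncard_nonzeroBlocks_le hn hs ((forall_dvd_ncard_iff hn hs (dvd_mul_right m n)).1 hd)
  rw [mul_left_comm] at h
  exact Nat.le_of_mul_le_mul_left h hm

theorem le_rank (r : ℕ) (π : mNCB m n)
    (h : (nonzeroBlocks (π : Setoid (Pt (m * n)))).ncard + 2 * r ≤ 2 * n) : r ≤ rank m n π := by
  induction r generalizing π with
  | zero => exact bot_le
  | succ r ih =>
    have hm : 0 < m := Nat.pos_of_mul_pos_right (NeZero.pos (m * n))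
    have hn := π.2.1
    have hs := π.2.2.1
    obtain ⟨y, j, hj0, hj, hj1, hj2⟩ := exists_arcPart hn hs rfl hm (by omega)
    have hmem : splitOff π.1 y j ∈ mNCB m n := ⟨splitOff_isNoncrossing hn y j,
      splitOff_isSymmetric hs y j, dvd_ncard_splitOff hs hj hj1 π.2.2.2⟩
    have hlt : (⟨_, hmem⟩ : mNCB m n) < π := by
      refine lt_of_le_of_ne (splitOff_le π.1 y j) fun he => ?_
      have h1 := setOf_splitOff_of_mem hj (self_mem_arcPart π.1 y hj0)
      have h2 : splitOff π.1 y j = π.1 := congrArg Subtype.val he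
      rw [h2] at h1
      rw [h1] at hj2
      omega
    have h2 := ncard_nonzeroBlocks_splitOff_le hn hs (y := y) hj0 hj
    have h3 := ih ⟨_, hmem⟩ (by simp only; omega)
    rw [Nat.cast_add, Nat.cast_one]
    exact (add_le_add_left h3 1).trans (Order.height_add_one_le hlt)

theorem rank_le (π : mNCB m n) :
    rank m n π ≤ (n - (nonzeroBlocks (π : Setoid (Pt (m * n)))).ncard / 2 : ℕ) := by
  have hmono : StrictMono fun π : mNCB m n =>
      n - (nonzeroBlocks (π : Setoid (Pt (m * n)))).ncard / 2 := by
    intro π π' hlt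
    have h1 := ncard_nonzeroBlocks_lt π.2.1 π.2.2.1 π'.2.1 π'.2.2.1 hlt
    obtain ⟨k, hk⟩ := even_ncard_nonzeroBlocks π.2.1 π.2.2.1
    obtain ⟨l, hl⟩ := even_ncard_nonzeroBlocks π'.2.1 π'.2.2.1
    have h2 := ncard_nonzeroBlocks_le π
    simp only
    omega
  have h := Order.height_le_height_apply_of_strictMono _ hmono π
  rwa [Order.height_nat] at h

/-- The rank is the complement of half the number of non-zero blocks. -/
theorem rank_eq_iff (π : mNCB m n) {s : ℕ} (hs : s ≤ n) : rank m n π = s ↔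
    (nonzeroBlocks (π : Setoid (Pt (m * n)))).ncard = 2 * (n - s) := by
  obtain ⟨k, hk⟩ := even_ncard_nonzeroBlocks π.2.1 π.2.2.1
  have h1 := ncard_nonzeroBlocks_le π
  have h2 := rank_le π
  have h3 := le_rank (n - k) π (by omega)
  have h4 : rank m n π = (n - k : ℕ) := le_antisymm (by
    rw [hk, ← two_mul, Nat.mul_div_cancel_left k two_pos] at h2
    exact h2) h3
  rw [h4, Nat.cast_inj]
  omega

end

end TypeB

/-! ### Cyclic sieving for positive partitions -/

namespace TypeB

section

variable {m n : ℕ} [NeZero (m * n - 1)]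

/-- Cyclic sieving for partitions which are characterized by a rotation-invariant property `Q` of
the corresponding words. -/
theorem cyclicSievingUnder_of_ofWord {P : Setoid (Pt (m * n)) → Prop}
    {Q : (ZMod (m * n - 1) → ℕ) → Prop} (hPQ : ∀ w, ∑ j, w j ≤ n → (Q w ↔ P (ofWord (m * n) m w)))
    (hQ : ∀ w t, Q w → Q fun j => w (j - t)) {p : ℤ[X]} (hp : ∀ i, 0 ≤ p.coeff i)
    (hcount : ∀ (t : ZMod (m * n - 1)) (ω : ℂ), IsPrimitiveRoot ω (addOrderOf t) →
      (Nat.card {w : ZMod (m * n - 1) → ℕ // (Q w ∧ ∑ j, w j ≤ n) ∧ ∀ j, w (j - t) = w j} : ℂ) =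
        aeval ω p) :
    CyclicSievingUnder {π | π ∈ mNCBPlus m n ∧ P π} (p.comp (X ^ 2)) kappa (2 * (m * n) - 2) := by
  have hN := two_le_of_neZero (m * n)
  have : NeZero (m * n) := ⟨by omega⟩
  have hb : Set.BijOn (ofWord (m * n) m) {w | Q w ∧ ∑ j, w j ≤ n} {π | π ∈ mNCBPlus m n ∧ P π} := by
    have h := bijOn_ofWord (m := m) (n := n)
    refine ⟨fun w hw => ⟨h.mapsTo hw.2, (hPQ w hw.2).1 hw.1⟩, h.injOn.mono fun w hw => hw.2,
      fun π hπ => ?_⟩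
    obtain ⟨w, hw, rfl⟩ := h.surjOn hπ.1
    exact ⟨w, ⟨(hPQ w hw).2 hπ.2, hw⟩, rfl⟩
  rw [show 2 * (m * n) - 2 = 2 * (m * n - 1) by omega]
  refine cyclicSievingUnder_of_words hb (fun w hw t => ⟨hQ w t hw.1, ?_⟩)
    (fun w hw => kappa_ofWord (Nat.mul_le_mul_left m hw.2)) hp hcount
  have := (Equiv.subRight t).sum_comp w
  simp only [Equiv.subRight_apply] at this
  rw [this]
  exact hw.2

omit [NeZero (m * n - 1)] in
theorem card_comp_sub (p : ℕ → Prop) (w : ZMod (m * n - 1) → ℕ) (t : ZMod (m * n - 1)) :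
    Nat.card {j // p (w (j - t))} = Nat.card {j // p (w j)} :=
  Nat.card_congr ((Equiv.subRight t).subtypeEquiv fun _ => Iff.rfl)

variable {w : ZMod (m * n - 1) → ℕ} (hw : ∑ j, w j ≤ n)
include hw

theorem ncard_nonzeroBlocks_ofWord :
    (nonzeroBlocks (ofWord (m * n) m w)).ncard = 2 * Nat.card {j // w j ≠ 0} := by
  have hN := two_le_of_neZero (m * n)
  have : NeZero (m * n) := ⟨by omega⟩
  have hm : m ≠ 0 := fun h => by simp [h] at hN
  have hw' := Nat.mul_le_mul_left m hw
  rw [ncard_nonzeroBlocks (ofWord_isNoncrossing hw') (ofWord_isSymmetric hw'),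
    sum_openedSize_ofWord hw' (fun i => if i ≠ 0 then 1 else 0) (by simp),
    Nat.card_eq_fintype_card, Fintype.card_subtype, Finset.card_filter]
  simp [hm]

theorem ncard_nonzeroBlocks_ofWord_size {i : ℕ} (hi : i ≠ 0) :
    {B | B ∈ nonzeroBlocks (ofWord (m * n) m w) ∧ B.ncard = m * i}.ncard =
      2 * Nat.card {j // w j = i} := by
  have hN := two_le_of_neZero (m * n)
  have : NeZero (m * n) := ⟨by omega⟩
  have hm : m ≠ 0 := fun h => by simp [h] at hN
  have hw' := Nat.mul_le_mul_left m hw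
  have h0 : 0 ≠ m * i := (Nat.mul_ne_zero hm hi).symm
  rw [ncard_nonzeroBlocks_filter (P := fun c => c = m * i) (ofWord_isNoncrossing hw')
    (ofWord_isSymmetric hw') h0,
    sum_openedSize_ofWord hw' (fun c => if c = m * i then 1 else 0)
      (if_neg h0),
    Nat.card_eq_fintype_card, Fintype.card_subtype, Finset.card_filter]
  simp [hm]

/-- All blocks have size `m` if and only if `n` letters of the word are non-zero. In this case all
of them are `1`, and there is no zero block. -/
theorem forall_ncard_eq_iff :
    Nat.card {j // w j ≠ 0} = n ↔ ∀ B ∈ (ofWord (m * n) m w).classes, B.ncard = m := by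
  have hN := two_le_of_neZero (m * n)
  have : NeZero (m * n) := ⟨by omega⟩
  have hm : 0 < m := Nat.pos_of_mul_pos_right (by omega : 0 < m * n)
  have hw' := Nat.mul_le_mul_left m hw
  have hn := ofWord_isNoncrossing hw'
  have hs := ofWord_isSymmetric hw'
  have hcard := ncard_zeroBlock_add hn hs
  rw [sum_openedSize_ofWord hw' (fun i => i) rfl, ← Finset.mul_sum] at hcard
  have hsupp : Nat.card {j // w j ≠ 0} = ∑ j, if w j ≠ 0 then 1 else 0 := by
    rw [Nat.card_eq_fintype_card, Fintype.card_subtype, Finset.card_filter]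
  have hle : ∀ j ∈ Finset.univ, (if w j ≠ 0 then 1 else 0) ≤ w j := fun j _ => by
    split_ifs <;> omega
  rw [hsupp]
  constructor
  · intro h
    have hsum : ∑ j, w j = n := le_antisymm hw (h.symm.le.trans (Finset.sum_le_sum hle))
    have heq := (Finset.sum_eq_sum_iff_of_le hle).1 (h.trans hsum.symm)
    have hone (a : Pt (m * n)) (ha : IsOpener (ofWord (m * n) m w) a) :
        {x | ofWord (m * n) m w x a}.ncard = m := by
      rw [← openedSize_of_isOpener ha]
      have h1 : openedSize (ofWord (m * n) m w) a ≠ 0 := fun h => openedSize_eq_zero_iff.1 h ha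
      obtain ⟨x, rfl⟩ := ZMod.intCast_surjective a
      rw [openedSize_ofWord hw', wordSize] at h1 ⊢
      split_ifs at h1 ⊢ with h2
      · exact absurd rfl h1
      have h3 := heq ((x % (m * n : ℕ) - 1 : ℤ) : ZMod (m * n - 1)) (Finset.mem_univ _)
      split_ifs at h3 with h4
      · rw [← h3, mul_one]
      · exact absurd (by rw [← h3, mul_zero]) h1
    rintro _ ⟨y, rfl⟩
    have hy : ¬ ofWord (m * n) m w (bar y) y := fun hy => by
      rw [hsum] at hcard
      have h1 : {x | ofWord (m * n) m w (bar x) x}.ncard = 0 := by omega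
      rw [Set.ncard_eq_zero (Set.toFinite _)] at h1
      exact Set.eq_empty_iff_forall_notMem.1 h1 y hy
    obtain ⟨b, hb, hyb⟩ := exists_isOpener hn hs hy
    rw [setOf_rel_eq hyb, hone b hb]
  · intro h
    have hone (j : ZMod (m * n - 1)) : (if w j ≠ 0 then 1 else 0) = w j := by
      have h1 := openedSize_ofWord hw' ((j.val + 1 : ℕ) : ℤ)
      rw [wordSize_natCast_succ _ _ (ZMod.val_lt j), ZMod.natCast_zmod_val, openedSize] at h1
      split_ifs at h1 with h2
      · rw [h _ ⟨_, rfl⟩] at h1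
        have h3 := Nat.eq_of_mul_eq_mul_left hm ((mul_one m).trans h1)
        rw [← h3]
        rfl
      · have h3 : w j = 0 := (Nat.mul_eq_zero.1 h1.symm).resolve_left hm.ne'
        rw [h3]
        rfl
    rw [Finset.sum_congr rfl fun j _ => hone j]
    by_contra hc
    have hlt : ∑ j, w j < n := lt_of_le_of_ne hw hc
    -- otherwise there is a zero block, and its size is a multiple of `2m`
    have h1 : {x | ofWord (m * n) m w (bar x) x}.ncard = 2 * m * (n - ∑ j, w j) := by
      rw [Nat.mul_sub, mul_assoc, mul_assoc]
      omega
    have h2 : 2 * m * 1 ≤ 2 * m * (n - ∑ j, w j) := Nat.mul_le_mul_left _ (by omega)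
    obtain ⟨y, hy⟩ := Set.nonempty_of_ncard_ne_zero (s := {x | ofWord (m * n) m w (bar x) x})
      (by omega)
    have h3 := h _ ⟨y, rfl⟩
    rw [setOf_rel_eq_zeroBlock hn hs hy, h1] at h3
    omega

end

end TypeB

theorem mainTheorem3 (m n : ℕ) (hm : 1 ≤ m) (hn : 1 ≤ n) (hmn : 2 ≤ m * n) :
    -- (1) all positive `m`-divisible type `B` non-crossing partitions
    CyclicSievingUnder (TypeB.mNCBPlus m n)
      ((QAnalog.qBinomial ((m + 1) * n - 1) n).comp (X ^ 2))
      TypeB.kappa (2 * (m * n) - 2) ∧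
    -- (2) those all of whose blocks have size `m`
    CyclicSievingUnder {π | π ∈ TypeB.mNCBPlus m n ∧ ∀ B ∈ π.classes, B.ncard = m}
      ((QAnalog.qBinomial (m * n - 1) n).comp (X ^ 2))
      TypeB.kappa (2 * (m * n) - 2) ∧
    -- (3) those of rank `s`, or, equivalently, with `2(n - s)` non-zero blocks
    (∀ s : ℕ, s ≤ n →
      (∀ π : TypeB.mNCB m n, (π : Setoid (TypeB.Pt (m * n))) ∈ TypeB.mNCBPlus m n →
        (TypeB.rank m n π = s ↔
          (TypeB.nonzeroBlocks (π : Setoid (TypeB.Pt (m * n)))).ncard = 2 * (n - s))) ∧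
      CyclicSievingUnder
        {π | π ∈ TypeB.mNCBPlus m n ∧ ∃ h : π ∈ TypeB.mNCB m n, TypeB.rank m n ⟨π, h⟩ = s}
        ((QAnalog.qBinomial n s * QAnalog.qBinomial (m * n - 1) (n - s)).comp (X ^ 2))
        TypeB.kappa (2 * (m * n) - 2)) ∧
    -- (4) those with `2 b_i` non-zero blocks of size `m i`, for `i = 1, …, n`
    (∀ b : ℕ → ℕ, ∑ i ∈ Finset.Icc 1 n, i * b i ≤ n →
      CyclicSievingUnder
        {π | π ∈ TypeB.mNCBPlus m n ∧ ∀ i ∈ Finset.Icc 1 n,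
          {B | B ∈ TypeB.nonzeroBlocks π ∧ B.ncard = m * i}.ncard = 2 * b i}
        ((QAnalog.qMultinomial (Finset.Icc 1 n) b *
          QAnalog.qBinomial (m * n - 1) (∑ i ∈ Finset.Icc 1 n, b i)).comp (X ^ 2))
        TypeB.kappa (2 * (m * n) - 2)) := by
  have : NeZero (m * n) := ⟨by omega⟩
  have : NeZero (m * n - 1) := ⟨by omega⟩
  refine ⟨?_, ?_, fun s hs => ⟨fun π _ => TypeB.rank_eq_iff π hs, ?_⟩, fun b hb => ?_⟩
  · have e : (m + 1) * n - 1 = m * n - 1 + n := by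
      rw [add_mul, one_mul]
      omega
    have h := TypeB.cyclicSievingUnder_of_ofWord (m := m) (n := n) (P := fun _ => True)
      (Q := fun _ => True) (fun w _ => Iff.rfl) (fun _ _ h => h)
      (QAnalog.qBinomial_coeff_nonneg (m * n - 1 + n) n) fun t ω hω => by
        simp only [true_and]
        exact Word.card_fixed_sum_le hω n
    simp only [and_true] at h
    rw [e]
    exact h
  · refine TypeB.cyclicSievingUnder_of_ofWord (Q := fun w => Nat.card {j // w j ≠ 0} = n)
      (fun w hw => TypeB.forall_ncard_eq_iff hw) (fun w t hw => ?_)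
      (QAnalog.qBinomial_coeff_nonneg _ _) fun t ω hω => ?_
    · exact (TypeB.card_comp_sub (fun i => i ≠ 0) w t).trans hw
    · have h := Word.card_fixed_support hω n (Nat.zero_le n)
      rwa [QAnalog.qBinomial_zero_right, one_mul, Nat.sub_zero] at h
  · refine TypeB.cyclicSievingUnder_of_ofWord (Q := fun w => Nat.card {j // w j ≠ 0} = n - s)
      (fun w hw => ?_) (fun w t hw => ?_)
      (QAnalog.mul_coeff_nonneg (QAnalog.qBinomial_coeff_nonneg _ _)
        (QAnalog.qBinomial_coeff_nonneg _ _)) fun t ω hω => Word.card_fixed_support hω n hs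
    · have hmem := (TypeB.bijOn_ofWord.mapsTo hw : TypeB.ofWord (m * n) m w ∈ TypeB.mNCBPlus m n).1
      have h := TypeB.rank_eq_iff ⟨_, hmem⟩ hs
      rw [TypeB.ncard_nonzeroBlocks_ofWord hw] at h
      rw [← Nat.mul_right_inj two_ne_zero, ← h]
      exact ⟨fun h' => ⟨hmem, h'⟩, fun ⟨_, h'⟩ => h'⟩
    · exact (TypeB.card_comp_sub (fun i => i ≠ 0) w t).trans hw
  · refine TypeB.cyclicSievingUnder_of_ofWord
      (Q := fun w => ∀ i ∈ Finset.Icc 1 n, Nat.card {j // w j = i} = b i)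
      (fun w hw => forall₂_congr fun i hi => ?_) (fun w t hw i hi => ?_)
      (QAnalog.mul_coeff_nonneg (QAnalog.qMultinomial_coeff_nonneg _ _)
        (QAnalog.qBinomial_coeff_nonneg _ _)) fun t ω hω => Word.card_fixed_content hω n hb
    · rw [TypeB.ncard_nonzeroBlocks_ofWord_size hw (by have := (Finset.mem_Icc.1 hi).1; omega),
        Nat.mul_right_inj two_ne_zero]
    · exact (TypeB.card_comp_sub (fun c => c = i) w t).trans (hw i hi)
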